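/- **Setting.** Let $n\ge 2$, $\tau>n-1$, $\nu=\tau+1$, $\kappa=3/2$. On $\mathbb C^n$ and $\mathbb R^n$, $|\cdot|$ is the sup-norm, except that $|k|=|k_1|+\dots+|k_n|$ for $k\in\mathbb Z^n$; $\langle x,y\rangle=\sum_i x_iy_i$. For $\alpha>0$ and $\Omega\subset\mathbb R^n$ let $\Omega_\alpha$ be the set of all $\omega\in\Omega$ that have distance at least $\alpha$ to $\partial\Omega$ and satisfy $|\langle k,\omega\rangle|\ge\alpha/|k|^\tau$ for all $0\ne k\in\mathbb Z^n$. Functions of $(I,\theta,\omega)$ are "real analytic" on a complex domain if they are analytic there, real for real arguments, and $2\pi$-periodic in each $\theta_i$; functions of $\omega$ are "real analytic" if they are analytic and real for real $\omega$. A *normal form* is $N=e(\omega)+\langle\omega,I\rangle$ with $e$ real analytic. A transformation $\mathcal F:D\times O\to D'\times O'$ *in the group $\mathcal G$* is a real analytic map (acting on the torus of angles: $\mathcal F(I,\theta+2\pi k,\omega)=\mathcal F(I,\theta,\omega)+(0,2\pi k,0)$ for $k\in\mathbb Z^n$) of the form $$\mathcal F(I,\theta,\omega)=(U(I,\theta,\omega),\,V(\theta,\omega),\,\varphi(\omega)),$$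 with $U$ affine in $I$, with $\Phi=(U,V)$ for each $\omega$ injective and symplectic for $\sum_i dI_i\wedge d\theta_i$, and with $\varphi$ injective on $O$ with invertible derivative. **Parameters.** Given positive numbers $\alpha,r_0,s_0,c,c_0,K_0,E_0$, put $\sigma_0=s_0/20$, $h_0=\alpha c_0E_0\sigma_0^\nu$ and, for $j\ge0$, $$\sigma_{j+1}=\tfrac{\sigma_j}2,\quad K_{j+1}=4K_j,\quad h_{j+1}=\frac{h_j}{4^\nu},\quad E_{j+1}=c^{\kappa-1}E_j^\kappa,\quad \eta_j=\sqrt{E_j},\quad r_{j+1}=\eta_jr_j,\quad s_{j+1}=s_j-5\sigma_j,$$ $$\epsilon_j=\alpha E_jr_j\sigma_j^\nu,\qquad D_j=\{|I|<r_j\}\times\{|\Im\theta|<s_j\},\qquad O_j=\{\omega\in\mathbb C^n:|\omega-\Omega_\alpha|<h_j\}.$$ For given $x_0,e_0>0$ call $(K_0,E_0)$ *admissible* if $$K_0\ge1,\qquad K_0\sigma_0\ge x_0,\qquad E_0\le e_0,\qquad K_0^ne^{-K_0\sigma_0}\le E_0,\qquad h_0\le\frac{\alpha}{2K_0^\nu}.$$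 **Iterative Lemma.** There are constants $c\ge1$, $c_0>0$, $x_0>0$, $e_0>0$ and $C\ge1$, depending only on $n$ and $\tau$, such that for every $s_0>0$ there is a pair $(K_0,E_0)$ that is admissible for all $\alpha,r_0>0$, and such that the following holds for all $\alpha,r_0,s_0>0$, all admissible $(K_0,E_0)$, and all $\Omega\subset\mathbb R^n$. Let $N=e(\omega)+\langle\omega,I\rangle$ be a normal form with $e$ real analytic on $O_0$, let $P_0$ be real analytic on $D_0\times O_0$ with $$|P_0|\le\epsilon_0=\alpha E_0r_0\sigma_0^\nu\quad\text{on } D_0\times O_0,$$ and let $H=N+P_0$. Then there are transformations $\mathcal F_j:D_{j+1}\times O_{j+1}\to D_j\times O_j$ in $\mathcal G$, normal forms $N_j=e_j(\omega)+\langle\omega,I\rangle$ with $e_j$ real analytic on $O_j$, and functions $P_j$ real analytic on $D_j\times O_j$ ($j\ge0$), where $N_0=N$ and $P_0$ is the given function, such that for every $j\ge0$ the composition $$\mathcal F^j=\mathcal F_0\circ\dots\circ\mathcal F_{j-1}:D_j\times O_j\to D_0\times O_0\qquad(\mathcal F^0=\mathrm{id})$$ is in $\mathcal G$, and $$H\circ\mathcal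 F^j=N_j+P_j,\qquad |P_j|\le\epsilon_j\qquad\text{on } D_j\times O_j.$$ Moreover, for every $j\ge0$, $$|\bar W_0(\mathcal F^{j+1}-\mathcal F^j)|\le C\,\frac{\epsilon_j}{r_jh_j}\qquad\text{on } D_{j+1}\times O_{j+1},$$ where $\bar W_0=\mathrm{diag}(r_0^{-1}\mathrm{Id},\sigma_0^{-1}\mathrm{Id},h_0^{-1}\mathrm{Id})$. -/

import Mathlib

open Set

noncomputable section

namespace KAM

/-- Complex vectors; the norm is the sup-norm `max_i |z_i|`. -/
abbrev CVec (n : ℕ) := Fin n → ℂ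

/-- Complexified phase space, with points `(I, θ)`. The angles are written on the universal cover
of the torus; `2π`-periodicity in `θ` is required separately. -/
abbrev Phase (n : ℕ) := CVec n × CVec n

/-- Phase space together with the frequency parameter: points `((I, θ), ω)`. -/
abbrev Ext (n : ℕ) := Phase n × CVec n

/-! ### Frequencies and complex domains -/

/-- The diophantine condition `|⟨k, ω⟩| ≥ α / |k|^τ` for all integer vectors `k ≠ 0`, where
`|k| = |k_1| + ⋯ + |k_n|`. -/
def IsDiophantine {n : ℕ} (α τ : ℝ) (ω : Fin n → ℝ) : Prop :=
  ∀ k : Fin n → ℤ, k ≠ 0 → α / (∑ i, |(k i : ℝ)|) ^ τ ≤ |∑ i, (k i : ℝ) * ω i|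

/-- The set `Ω_α` of the diophantine frequencies in `Ω` which have at least distance `α` to the
boundary of `Ω`. -/
def diophantineSet {n : ℕ} (α τ : ℝ) (Ω : Set (Fin n → ℝ)) : Set (Fin n → ℝ) :=
  {ω | ω ∈ Ω ∧ IsDiophantine α τ ω ∧ ∀ x ∈ frontier Ω, α ≤ dist ω x}

/-- The complex domain `{|I| < r} × {|Im θ| < s}`. -/
def phaseDom (n : ℕ) (r s : ℝ) : Set (Phase n) :=
  {z | ‖z.1‖ < r ∧ ‖fun i => (z.2 i).im‖ < s}

/-- The complex neighbourhood `{|ω - S| < h}` of a set `S` of real frequencies. -/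
def freqDom {n : ℕ} (S : Set (Fin n → ℝ)) (h : ℝ) : Set (CVec n) :=
  {ω | ∃ ξ ∈ S, ‖ω - fun i => (ξ i : ℂ)‖ < h}

/-! ### Real analytic functions on these domains -/

/-- All coordinates of the vector are real. -/
def IsRealVec {n : ℕ} (z : CVec n) : Prop := ∀ i, (z i).im = 0

/-- All coordinates of the point `((I, θ), ω)` are real. -/
def IsRealPt {n : ℕ} (x : Ext n) : Prop := IsRealVec x.1.1 ∧ IsRealVec x.1.2 ∧ IsRealVec x.2

/-- The deck transformation `θ ↦ θ + 2πk`. -/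
def shift {n : ℕ} (k : Fin n → ℤ) (x : Ext n) : Ext n :=
  ((x.1.1, fun i => x.1.2 i + 2 * (Real.pi : ℂ) * (k i : ℂ)), x.2)

/-- Real analytic functions of `(I, θ, ω)` on a complex domain, of period `2π` in each `θ_i`. -/
structure IsRealAnalytic {n : ℕ} (f : Ext n → ℂ) (A : Set (Ext n)) : Prop where
  analytic : AnalyticOnNhd ℂ f A
  real : ∀ x ∈ A, IsRealPt x → (f x).im = 0
  periodic : ∀ x ∈ A, ∀ k : Fin n → ℤ, f (shift k x) = f x

/-- Real analytic functions of the frequencies alone. -/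
structure IsRealAnalyticFreq {n : ℕ} (e : CVec n → ℂ) (O : Set (CVec n)) : Prop where
  analytic : AnalyticOnNhd ℂ e O
  real : ∀ ω ∈ O, IsRealVec ω → (e ω).im = 0

/-- The normal form `N = e(ω) + ⟨ω, I⟩`. -/
def normalForm {n : ℕ} (e : CVec n → ℂ) (x : Ext n) : ℂ :=
  e x.2 + ∑ i, x.2 i * x.1.1 i

/-! ### The group of transformations -/

/-- The (complexified) standard symplectic form `∑ dI_i ∧ dθ_i`. -/
def sympForm {n : ℕ} (u v : Phase n) : ℂ :=
  ∑ i, (u.1 i * v.2 i - v.1 i * u.2 i)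

/-- `F` is a real analytic transformation `D × O → D' × O'` of the group `𝒢`:
`F (I, θ, ω) = (Φ (I, θ, ω), φ ω)`, where `Φ = (U, V)` is a coordinate change which is symplectic
for each `ω`, with `U` affine in `I` and `V` independent of `I`, and where `φ` is a change of the
parameters alone. -/
structure InGroup {n : ℕ} (F : Ext n → Ext n) (D : Set (Phase n)) (O : Set (CVec n))
    (D' : Set (Phase n)) (O' : Set (CVec n)) : Prop where
  mapsTo : MapsTo F (D ×ˢ O) (D' ×ˢ O')
  analytic : AnalyticOnNhd ℂ F (D ×ˢ O)
  real : ∀ x ∈ D ×ˢ O, IsRealPt x → IsRealPt (F x)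
  /-- `F` is the lift of a map which acts on the torus and is homotopic to the identity there. -/
  equivariant : ∀ x ∈ D ×ˢ O, ∀ k : Fin n → ℤ, F (shift k x) = shift k (F x)
  shape : ∃ (b : CVec n → CVec n → CVec n) (A : CVec n → CVec n → CVec n →ₗ[ℂ] CVec n)
      (V : CVec n → CVec n → CVec n) (φ : CVec n → CVec n),
    (∀ I θ ω, (I, θ) ∈ D → ω ∈ O →
      F ((I, θ), ω) = ((b θ ω + A θ ω I, V θ ω), φ ω)) ∧
    InjOn φ O ∧ ∀ ω ∈ O, (fderiv ℂ φ ω).IsInvertible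
  injective : ∀ ω ∈ O, InjOn (fun z => (F (z, ω)).1) D
  symplectic : ∀ ω ∈ O, ∀ z ∈ D, ∀ u v : Phase n,
    sympForm (fderiv ℂ (fun w => (F (w, ω)).1) z u) (fderiv ℂ (fun w => (F (w, ω)).1) z v) =
      sympForm u v

/-- The composition `F_0 ∘ ⋯ ∘ F_{j-1}`, the identity for `j = 0`. -/
def compSeq {n : ℕ} (F : ℕ → Ext n → Ext n) : ℕ → Ext n → Ext n
  | 0 => id
  | j + 1 => compSeq F j ∘ F j

/-- The weighted norm `|W x|` for `W = diag(r⁻¹ Id, σ⁻¹ Id, h⁻¹ Id)` and the sup-norm. -/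
def weightedNorm {n : ℕ} (r σ h : ℝ) (x : Ext n) : ℝ :=
  max (max (r⁻¹ * ‖x.1.1‖) (σ⁻¹ * ‖x.1.2‖)) (h⁻¹ * ‖x.2‖)

/-! ### The parameter sequences -/

/-- The numbers that determine the parameter sequences. -/
structure Params where
  α : ℝ
  τ : ℝ
  c : ℝ
  c₀ : ℝ
  r₀ : ℝ
  s₀ : ℝ
  K₀ : ℝ
  E₀ : ℝ

namespace Params

/-- `ν = τ + 1` -/
def ν (p : Params) : ℝ := p.τ + 1

/-- `κ = 3/2` -/
def κ : ℝ := 3 / 2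

/-- `σ_0 = s_0 / 20`, `σ_{j+1} = σ_j / 2` -/
def σ (p : Params) : ℕ → ℝ
  | 0 => p.s₀ / 20
  | j + 1 => p.σ j / 2

/-- `K_{j+1} = 4 K_j` -/
def K (p : Params) : ℕ → ℝ
  | 0 => p.K₀
  | j + 1 => 4 * p.K j

/-- `h_0 = α c_0 E_0 σ_0^ν`, `h_{j+1} = h_j / 4^ν` -/
def h (p : Params) : ℕ → ℝ
  | 0 => p.α * p.c₀ * p.E₀ * p.σ 0 ^ p.ν
  | j + 1 => p.h j / 4 ^ p.ν

/-- `E_{j+1} = c^{κ-1} E_j^κ` -/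
def E (p : Params) : ℕ → ℝ
  | 0 => p.E₀
  | j + 1 => p.c ^ (κ - 1) * p.E j ^ κ

/-- `η_j^2 = E_j` -/
def η (p : Params) (j : ℕ) : ℝ := √(p.E j)

/-- `r_{j+1} = η_j r_j` -/
def r (p : Params) : ℕ → ℝ
  | 0 => p.r₀
  | j + 1 => p.η j * p.r j

/-- `s_{j+1} = s_j - 5 σ_j` -/
def s (p : Params) : ℕ → ℝ
  | 0 => p.s₀
  | j + 1 => p.s j - 5 * p.σ j

/-- `ε_j = α E_j r_j σ_j^ν` -/
def ε (p : Params) (j : ℕ) : ℝ := p.α * p.E j * p.r j * p.σ j ^ p.ν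

/-- The domain `D_j`. -/
def D (p : Params) (n j : ℕ) : Set (Phase n) := phaseDom n (p.r j) (p.s j)

/-- The domain `O_j`. -/
def O {n : ℕ} (p : Params) (Ω : Set (Fin n → ℝ)) (j : ℕ) : Set (CVec n) :=
  freqDom (diophantineSet p.α p.τ Ω) (p.h j)

/-- The requirements on the choice of the initial values `K_0` and `E_0`: `K_0 σ_0` is large,
`E_0` is small, and `K_0^n e^{-K_0 σ_0} ≤ E_0` and `h_0 ≤ α / (2 K_0^ν)`. -/
structure Admissible (p : Params) (n : ℕ) (x₀ e₀ : ℝ) : Prop where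
  one_le_K : 1 ≤ p.K 0
  large : x₀ ≤ p.K 0 * p.σ 0
  small : p.E 0 ≤ e₀
  truncation : p.K 0 ^ n * Real.exp (-(p.K 0 * p.σ 0)) ≤ p.E 0
  divisors : p.h 0 ≤ p.α / (2 * p.K 0 ^ p.ν)

end Params

end KAM

end

noncomputable section

namespace KAM

/-! ### Cauchy estimates along complex lines -/

section Cauchy

variable {E F : Type*} [NormedAddCommGroup E] [NormedSpace ℂ E]
  [NormedAddCommGroup F] [NormedSpace ℂ F]

/-! The proof is Newton's method with loss of domain. On a small neighbourhood `|I| < η r` of the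
torus `I = 0`, the part of `P` beyond its affine part in `I` is only of order `η² ε`. The affine
part, except for its mean over the angles, is removed by a symplectic change of coordinates with a
generating function `⟨I, θ⟩ + G`, where `⟨ω, ∂_θ G⟩` is minus the affine part without its mean, up
to truncation at `|k| ≤ K`. The means are no obstruction: that of `P` at `I = 0` is added to the
energy, and that of `∂_I P` shifts the frequency, which `φ` undoes by inverting `ω ↦ ω + shift`.
What remains is of order `ε (E + η² + K^n e^{-Kσ})`. Since `η² = E` and the truncation term is at
most `E`, this is a constant times `E ε`, which the parameter sequences turn into the next `ε`.

The size of `G` is governed by small divisors. Within distance `h ≤ α / (2 K^ν)` of a diophantine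
`ξ`, each `⟨k, ω⟩` with `0 < |k| ≤ K` is at least half as large as `⟨k, ξ⟩` (`half_le_norm_cdot`).
To lose only `σ^τ`, with no extra power of `σ` depending on `n`, Cauchy's inequality is used: the
Fourier coefficients are summed by Bessel's inequality with exponential weights
(`IsPeriodicHol.sum_sq_fcoeff_exp_le`), the divisors by Rüssmann's bound (`sum_exp_div_sq_kdot_le`).
The result is `HomData.norm_homSol_le`; differentiating `G` costs one further `σ`, in all `σ^ν`.

The coordinate change `(I, θ) ↦ (U, V)` is given by `U = I + ∂_θ G(I, V)` and `θ = V + ∂_I G(I, V)`.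
As `G` is affine in `I`, the second equation does not contain `I`; a contraction depending on
parameters solves it (`exists_differentiableOn_fixedPoint`), and likewise the equation for `φ`.
Symplecticity is the symmetry of the Hessian of `G` (`sympForm_of_generating`). Analyticity of all
that is constructed follows from complex differentiability by Osgood's lemma
(`analyticOnNhd_of_differentiableOn`).

In the iteration, smallness of `E_0` makes `ε_j / (r_j h_j)` at least halve at each step
(`Params.IsTuned.ε_div_le`). Hence the Lipschitz constants of the single steps have a product below
2, and `F^{j+1} - F^j = F^j ∘ F_j - F^j` is at most twice the displacement of `F_j`. -/

theorem hasDerivAt_comp_line {f : E → F} {x v : E} {z : ℂ}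
    (h : DifferentiableAt ℂ f (x + z • v)) :
    HasDerivAt (fun z : ℂ => f (x + z • v)) (fderiv ℂ f (x + z • v) v) z := by
  have h1 : HasDerivAt (fun z : ℂ => x + z • v) v z := by
    simpa using ((hasDerivAt_id z).smul_const v).const_add x
  exact h.hasFDerivAt.comp_hasDerivAt z h1

theorem hasDerivAt_comp_ofReal' {g : ℂ → F} {g' : F} {t : ℝ} (h : HasDerivAt g g' (t : ℂ)) :
    HasDerivAt (fun t : ℝ => g (t : ℂ)) g' t := by
  have := HasDerivAt.scomp t h Complex.ofRealCLM.hasDerivAt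
  simpa [Function.comp_def] using this

/-- Nothing is assumed on the boundary circle, so Cauchy's estimate is used on radii `ρ < R`, and
`ρ` tends to `R`. -/
theorem norm_deriv_le_of_ball {g : ℂ → F} {c : ℂ} {M R : ℝ} (hR : 0 < R)
    (hd : ∀ z, ‖z - c‖ < R → DifferentiableAt ℂ g z) (hM : ∀ z, ‖z - c‖ < R → ‖g z‖ ≤ M) :
    ‖deriv g c‖ ≤ M / R := by
  have key : ∀ ρ ∈ Ioo 0 R, ‖deriv g c‖ ≤ M / ρ := by
    intro ρ hρ
    refine Complex.norm_deriv_le_of_forall_mem_sphere_norm_le hρ.1 ?_ ?_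
    · apply DifferentiableOn.diffContOnCl
      intro z hz
      have : z ∈ Metric.closedBall c ρ := Metric.closure_ball_subset_closedBall hz
      rw [Metric.mem_closedBall, dist_eq_norm] at this
      exact (hd z (this.trans_lt hρ.2)).differentiableWithinAt
    · intro z hz
      rw [mem_sphere_iff_norm] at hz
      exact hM z (hz ▸ hρ.2)
  have hlim : Filter.Tendsto (fun ρ : ℝ => M / ρ) (nhdsWithin R (Iio R)) (nhds (M / R)) :=
    (ContinuousAt.div continuousAt_const continuousAt_id hR.ne').tendsto.mono_left
      nhdsWithin_le_nhds
  refine ge_of_tendsto hlim ?_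
  filter_upwards [Ioo_mem_nhdsLT hR] with ρ hρ using key ρ hρ

/-- Cauchy's estimate for a directional derivative. -/
theorem norm_fderiv_apply_le {f : E → F} {x v : E} {M R : ℝ} (hR : 0 < R)
    (hd : ∀ z : ℂ, ‖z‖ < R → DifferentiableAt ℂ f (x + z • v))
    (hM : ∀ z : ℂ, ‖z‖ < R → ‖f (x + z • v)‖ ≤ M) :
    ‖fderiv ℂ f x v‖ ≤ M / R := by
  have h0 := (hasDerivAt_comp_line (hd 0 (by simpa using hR))).deriv
  rw [zero_smul, add_zero] at h0
  rw [← h0]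
  refine norm_deriv_le_of_ball hR (fun z hz => ?_) (fun z hz => ?_)
  · rw [sub_zero] at hz
    exact (hasDerivAt_comp_line (hd z hz)).differentiableAt
  · rw [sub_zero] at hz
    exact hM z hz

/-- Mean value inequality along a segment, from derivative bounds in its direction. -/
theorem norm_sub_le_of_fderiv_segment {f : E → F} {x v : E} {C : ℝ}
    (hd : ∀ t : ℝ, t ∈ Icc (0 : ℝ) 1 → DifferentiableAt ℂ f (x + (t : ℂ) • v))
    (hC : ∀ t : ℝ, t ∈ Icc (0 : ℝ) 1 → ‖fderiv ℂ f (x + (t : ℂ) • v) v‖ ≤ C) :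
    ‖f (x + v) - f x‖ ≤ C := by
  have h : ∀ t ∈ Icc (0 : ℝ) 1, HasDerivWithinAt (fun t : ℝ => f (x + (t : ℂ) • v))
      (fderiv ℂ f (x + (t : ℂ) • v) v) (Icc 0 1) t := fun t ht =>
    (hasDerivAt_comp_ofReal' (hasDerivAt_comp_line (hd t ht))).hasDerivWithinAt
  have := norm_image_sub_le_of_norm_deriv_le_segment_01' h
    (fun t ht => hC t (Ico_subset_Icc_self ht))
  simpa using this

/-- A bound on a complex neighbourhood of a segment bounds the increment along the segment. -/
theorem norm_sub_le_of_segment {f : E → F} {x v : E} {M R : ℝ} (hR : 0 < R)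
    (hd : ∀ t ∈ Icc (0 : ℝ) 1, ∀ z : ℂ, ‖z‖ < R →
      DifferentiableAt ℂ f (x + (t : ℂ) • v + z • v))
    (hM : ∀ t ∈ Icc (0 : ℝ) 1, ∀ z : ℂ, ‖z‖ < R → ‖f (x + (t : ℂ) • v + z • v)‖ ≤ M) :
    ‖f (x + v) - f x‖ ≤ M / R := by
  refine norm_sub_le_of_fderiv_segment (fun t ht => ?_) (fun t ht => ?_)
  · simpa using hd t ht 0 (by simpa using hR)
  · exact norm_fderiv_apply_le hR (hd t ht) (hM t ht)

/-- The remainder of the first order Taylor expansion of a bounded function along a line. -/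
theorem norm_taylor_remainder_le [CompleteSpace F] {f : E → F} {x v : E} {M R : ℝ} (hR : 4 ≤ R)
    (hd : ∀ z : ℂ, ‖z‖ < R → DifferentiableAt ℂ f (x + z • v))
    (hM : ∀ z : ℂ, ‖z‖ < R → ‖f (x + z • v)‖ ≤ M) :
    ‖f (x + v) - f x - fderiv ℂ f x v‖ ≤ 8 * M / R ^ 2 := by
  have hM0 : 0 ≤ M := (norm_nonneg _).trans (hM 0 (by simp; linarith))
  set g : ℂ → F := fun z => f (x + z • v) with hg
  have hgd : ∀ z : ℂ, ‖z‖ < R → DifferentiableAt ℂ g z := fun z hz =>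
    (hasDerivAt_comp_line (hd z hz)).differentiableAt
  have hg0 : deriv g 0 = fderiv ℂ f x v := by
    have := (hasDerivAt_comp_line (hd 0 (by simp; linarith))).deriv
    rwa [zero_smul, add_zero] at this
  have hball : DifferentiableOn ℂ g (Metric.ball 0 R) := fun z hz =>
    (hgd z (by simpa using hz)).differentiableWithinAt
  have hd' : DifferentiableOn ℂ (deriv g) (Metric.ball 0 R) := hball.deriv Metric.isOpen_ball
  have hd2 : ∀ z : ℂ, ‖z‖ < R → DifferentiableAt ℂ (deriv g) z := fun z hz =>
    hd'.differentiableAt (Metric.isOpen_ball.mem_nhds (by simpa using hz))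
  -- Two Cauchy estimates, on discs of radius `R / 2` and `R / 4`. The condition `4 ≤ R` gives `1 +
  -- R / 4 ≤ R / 2`, so the second works on the whole unit disc.
  have hb1 : ∀ z : ℂ, ‖z‖ ≤ R / 2 → ‖deriv g z‖ ≤ M / (R / 2) := by
    intro z hz
    have hlt : ∀ w : ℂ, ‖w - z‖ < R / 2 → ‖w‖ < R := fun w hw => by
      have := norm_le_norm_sub_add w z
      linarith
    exact norm_deriv_le_of_ball (by linarith) (fun w hw => hgd w (hlt w hw))
      (fun w hw => hM w (hlt w hw))
  have hb2 : ∀ z : ℂ, ‖z‖ ≤ 1 → ‖deriv (deriv g) z‖ ≤ M / (R / 2) / (R / 4) := by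
    intro z hz
    have hlt : ∀ w : ℂ, ‖w - z‖ < R / 4 → ‖w‖ ≤ R / 2 := fun w hw => by
      have := norm_le_norm_sub_add w z
      linarith
    exact norm_deriv_le_of_ball (by linarith)
      (fun w hw => hd2 w ((hlt w hw).trans_lt (by linarith))) (fun w hw => hb1 w (hlt w hw))
  have hC : M / (R / 2) / (R / 4) = 8 * M / R ^ 2 := by
    have : R ≠ 0 := by linarith
    field_simp
    ring
  rw [hC] at hb2
  have hb3 : ∀ z : ℂ, ‖z‖ ≤ 1 → ‖deriv g z - deriv g 0‖ ≤ 8 * M / R ^ 2 := by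
    intro z hz
    have hC0 : 0 ≤ 8 * M / R ^ 2 := by positivity
    have := (convex_closedBall (0 : ℂ) 1).norm_image_sub_le_of_norm_deriv_le (f := deriv g)
      (C := 8 * M / R ^ 2) (fun w hw => hd2 w (by
        have : ‖w‖ ≤ 1 := by simpa using hw
        linarith)) (fun w hw => hb2 w (by simpa using hw)) (x := 0) (y := z)
        (by simp) (by simpa using hz)
    rw [sub_zero] at this
    nlinarith [norm_nonneg z]
  have hk : ∀ t ∈ Icc (0 : ℝ) 1, HasDerivWithinAt
      (fun t : ℝ => g (t : ℂ) - (t : ℂ) • deriv g 0)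
      (deriv g (t : ℂ) - deriv g 0) (Icc 0 1) t := by
    intro t ht
    have ht1 : ‖(t : ℂ)‖ < R := by
      rw [Complex.norm_real, Real.norm_of_nonneg ht.1]; linarith [ht.2]
    have h1 := (hgd t ht1).hasDerivAt.sub (((hasDerivAt_id (t : ℂ)).smul_const (deriv g 0)))
    rw [one_smul] at h1
    exact (hasDerivAt_comp_ofReal' h1).hasDerivWithinAt
  have := norm_image_sub_le_of_norm_deriv_le_segment_01' hk (fun t ht => hb3 t (by
    rw [Complex.norm_real, Real.norm_of_nonneg ht.1]; exact ht.2.le))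
  simp only [hg, Complex.ofReal_one, one_smul, Complex.ofReal_zero, zero_smul, add_zero,
    sub_zero] at this
  rw [← hg0]
  convert this using 2
  abel

end Cauchy

/-! ### Osgood's lemma -/

section Osgood

open MeasureTheory

variable {E F : Type*} [NormedAddCommGroup E] [NormedSpace ℂ E]
  [NormedAddCommGroup F] [NormedSpace ℂ F]

theorem norm_fderiv_le_of_ball {f : E → F} {x : E} {M R : ℝ} (hR : 0 < R)
    (hd : DifferentiableOn ℂ f (Metric.ball x R)) (hM : ∀ y ∈ Metric.ball x R, ‖f y‖ ≤ M) :
    ‖fderiv ℂ f x‖ ≤ M / R := by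
  have hM0 : 0 ≤ M := (norm_nonneg _).trans (hM x (Metric.mem_ball_self hR))
  refine ContinuousLinearMap.opNorm_le_bound _ (by positivity) fun v => ?_
  rcases eq_or_ne v 0 with rfl | hv
  · simp
  have hv' : 0 < ‖v‖ := norm_pos_iff.2 hv
  have hmem : ∀ z : ℂ, ‖z‖ < R / ‖v‖ → x + z • v ∈ Metric.ball x R := fun z hz => by
    rw [mem_ball_iff_norm, add_sub_cancel_left, norm_smul]
    rwa [lt_div_iff₀ hv'] at hz
  have := norm_fderiv_apply_le (f := f) (x := x) (v := v) (M := M) (div_pos hR hv')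
    (fun z hz => hd.differentiableAt (Metric.isOpen_ball.mem_nhds (hmem z hz)))
    (fun z hz => hM _ (hmem z hz))
  convert this using 1
  field_simp

/-- Integrals of holomorphic functions, bounded locally uniformly, are holomorphic. -/
theorem differentiableOn_integral_of_locally_bounded [CompleteSpace F]
    {X : Type*} [MeasurableSpace X] {μ : Measure X} [IsFiniteMeasure μ] {G : E → X → F} {U : Set E}
    (hU : IsOpen U)
    (hd : ∀ x, DifferentiableOn ℂ (fun ω => G ω x) U)
    (hm : ∀ ω ∈ U, AEStronglyMeasurable (G ω) μ)
    (hm' : ∀ ω ∈ U, AEStronglyMeasurable (fun x => fderiv ℂ (fun ω => G ω x) ω) μ)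
    (hb : ∀ ω ∈ U, ∃ ρ > 0, ∃ M, ∀ ω' ∈ Metric.ball ω ρ, ω' ∈ U ∧ ∀ x, ‖G ω' x‖ ≤ M) :
    DifferentiableOn ℂ (fun ω => ∫ x, G ω x ∂μ) U := by
  intro ω hω
  obtain ⟨ρ, hρ, M, hM⟩ := hb ω hω
  have hs : Metric.ball ω (ρ / 2) ∈ nhds ω := Metric.ball_mem_nhds _ (by linarith)
  -- Cauchy's estimate on balls of half the radius turns the local bound on `G` into the constant
  -- that dominates its derivative.
  have := hasFDerivAt_integral_of_dominated_of_fderiv_le (μ := μ) (F := G)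
    (F' := fun ω x => fderiv ℂ (fun ω => G ω x) ω) (bound := fun _ => M / (ρ / 2)) (𝕜 := ℂ) hs
    (Filter.Eventually.mono (hU.mem_nhds hω) fun ω' h => hm ω' h) ?_ (hm' ω hω) ?_ (integrable_const _) ?_
  · exact this.differentiableAt.differentiableWithinAt
  · exact ⟨hm ω hω, HasFiniteIntegral.of_bounded
      (Filter.Eventually.of_forall (hM ω (Metric.mem_ball_self hρ)).2)⟩
  · refine Filter.Eventually.of_forall fun x ω' hω' => ?_
    have hsub : ∀ y ∈ Metric.ball ω' (ρ / 2), y ∈ Metric.ball ω ρ := fun y hy => by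
      rw [Metric.mem_ball] at *
      linarith [dist_triangle y ω' ω]
    exact norm_fderiv_le_of_ball (by linarith)
      ((hd x).mono fun y hy => (hM y (hsub y hy)).1) fun y hy => (hM y (hsub y hy)).2 x
  · refine Filter.Eventually.of_forall fun x ω' hω' => ?_
    refine ((hd x).differentiableAt (hU.mem_nhds (hM ω' ?_).1)).hasFDerivAt
    exact Metric.ball_subset_ball (by linarith) hω'

/-- Directional derivatives of holomorphic functions are holomorphic. -/
theorem differentiableOn_fderiv_apply [FiniteDimensional ℂ E] [FiniteDimensional ℂ F] {f : E → F} {U : Set E}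
    (hU : IsOpen U) (hf : DifferentiableOn ℂ f U) (v : E) :
    DifferentiableOn ℂ (fun x => fderiv ℂ f x v) U := by
  borelize E
  intro x₀ hx₀
  have hE : ProperSpace E := FiniteDimensional.proper ℂ E
  have hF : CompleteSpace F := FiniteDimensional.complete ℂ F
  have hEF : ProperSpace (E →L[ℂ] F) := FiniteDimensional.proper ℂ _
  obtain ⟨R, hR, hRU⟩ := Metric.nhds_basis_closedBall.mem_iff.1 (hU.mem_nhds hx₀)
  obtain ⟨M, hM⟩ := (isCompact_closedBall x₀ R).exists_bound_of_continuousOn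
    (hf.continuousOn.mono hRU)
  set r : ℝ := R / (4 * (‖v‖ + 1)) with hr
  have hr0 : 0 < r := by positivity
  have hrv : r * ‖v‖ ≤ R / 4 := by
    rw [hr, div_mul_eq_mul_div, div_le_div_iff₀ (by positivity) (by norm_num)]
    nlinarith [norm_nonneg v]
  have hin : ∀ x ∈ Metric.ball x₀ (R / 2), ∀ z : ℂ, ‖z‖ ≤ 2 * r →
      x + z • v ∈ Metric.closedBall x₀ R := by
    intro x hx z hz
    rw [mem_ball_iff_norm] at hx
    rw [mem_closedBall_iff_norm]
    have h1 : ‖z • v‖ ≤ R / 2 := by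
      rw [norm_smul]
      nlinarith [norm_nonneg v]
    calc ‖x + z • v - x₀‖ = ‖(x - x₀) + z • v‖ := by congr 1; abel
      _ ≤ ‖x - x₀‖ + ‖z • v‖ := norm_add_le _ _
      _ ≤ R := by linarith
  have hdiff : ∀ x ∈ Metric.ball x₀ (R / 2), ∀ z : ℂ, ‖z‖ ≤ 2 * r →
      DifferentiableAt ℂ f (x + z • v) := fun x hx z hz =>
    hf.differentiableAt (hU.mem_nhds (hRU (hin x hx z hz)))
  -- Cauchy's formula writes the derivative at `x` along `v` as a circle integral of `f (x + z v) /
  -- z²`, which contains `x` only through values of `f`; so it is holomorphic in `x` by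
  -- differentiation under the integral.
  set G : E → ℝ → F := fun x t =>
    deriv (circleMap 0 r) t • ((circleMap 0 r t - 0) ^ 2)⁻¹ • f (x + circleMap 0 r t • v) with hG
  have hc : ∀ t, ‖circleMap 0 r t‖ = r := fun t => by simp [abs_of_pos hr0]
  have hform : ∀ x ∈ Metric.ball x₀ (R / 2), fderiv ℂ f x v =
      (2 * Real.pi * Complex.I : ℂ)⁻¹ • ∫ t in Ioc 0 (2 * Real.pi), G x t := by
    intro x hx
    have h1 := Complex.two_pi_I_inv_smul_circleIntegral_sub_sq_inv_smul_of_differentiable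
      (U := Metric.ball 0 (2 * r)) (c := 0) (w₀ := 0) (R := r) (f := fun z => f (x + z • v))
      Metric.isOpen_ball (Metric.closedBall_subset_ball (by linarith)) (fun z hz => by
        have : ‖z‖ ≤ 2 * r := by simpa using (Metric.ball_subset_closedBall hz)
        exact (hasDerivAt_comp_line (hdiff x hx z this)).differentiableAt.differentiableWithinAt)
      (Metric.mem_ball_self hr0)
    have h0 := (hasDerivAt_comp_line (hdiff x hx 0 (by simp; linarith))).deriv
    rw [zero_smul, add_zero] at h0
    rw [h0] at h1
    rw [← h1, circleIntegral, intervalIntegral.integral_of_le (by positivity)]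
  have hmeas : Measurable fun t : ℝ => circleMap 0 r t := (continuous_circleMap 0 r).measurable
  have hmain : DifferentiableOn ℂ (fun x => ∫ t in Ioc 0 (2 * Real.pi), G x t)
      (Metric.ball x₀ (R / 2)) := by
    have hkc : Continuous fun t : ℝ =>
        deriv (circleMap 0 r) t • ((circleMap 0 r t - 0) ^ 2)⁻¹ := by
      have : ∀ t, circleMap 0 r t - 0 ≠ 0 := fun t h => by
        have := hc t
        rw [sub_zero] at h
        rw [h, norm_zero] at this
        linarith
      simp only [deriv_circleMap]
      fun_prop (disch := intro t; exact pow_ne_zero _ (this t))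
    have hlin : ∀ t : ℝ, ∀ x, x ∈ Metric.ball x₀ (R / 2) →
        HasFDerivAt (fun x => G x t)
          ((deriv (circleMap 0 r) t • ((circleMap 0 r t - 0) ^ 2)⁻¹) •
            fderiv ℂ f (x + circleMap 0 r t • v)) x := by
      intro t x hx
      have h1 := (hdiff x hx (circleMap 0 r t) (by rw [hc]; linarith)).hasFDerivAt.comp x
        ((hasFDerivAt_id (𝕜 := ℂ) x).add_const (circleMap 0 r t • v))
      have h2 := h1.const_smul (deriv (circleMap 0 r) t • ((circleMap 0 r t - 0) ^ 2)⁻¹)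
      simp only [hG, ← smul_assoc]
      exact h2
    refine differentiableOn_integral_of_locally_bounded Metric.isOpen_ball ?_ ?_ ?_ ?_
    · exact fun t x hx => (hlin t x hx).differentiableAt.differentiableWithinAt
    · intro x hx
      apply Continuous.aestronglyMeasurable
      simp only [hG, ← smul_assoc]
      refine hkc.smul (continuous_iff_continuousAt.2 fun t => ?_)
      have h1 := (hdiff x hx (circleMap 0 r t) (by rw [hc]; linarith)).continuousAt
      exact ContinuousAt.comp (f := fun t => x + circleMap 0 r t • v) (g := f) h1 (by fun_prop)
    · intro x hx
      borelize F
      borelize (E →L[ℂ] F)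
      have h1 : ∀ t, fderiv ℂ (fun x => G x t) x = _ := fun t => (hlin t x hx).fderiv
      simp only [h1]
      -- Continuity of `fderiv ℂ f` is not yet known; derivatives are always measurable, and this
      -- suffices here.
      have h2 : AEStronglyMeasurable (fun t => fderiv ℂ f (x + circleMap 0 r t • v))
          (volume.restrict (Ioc 0 (2 * Real.pi))) := by
        exact ((measurable_fderiv ℂ f).comp
          (by fun_prop : Continuous fun t => x + circleMap 0 r t • v).measurable).aestronglyMeasurable
      exact hkc.aestronglyMeasurable.smul h2
    · intro x hx
      obtain ⟨ρ, hρ, hρs⟩ := Metric.isOpen_iff.1 Metric.isOpen_ball x hx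
      refine ⟨ρ, hρ, r * (r ^ 2)⁻¹ * M, fun y hy => ⟨hρs hy, fun t => ?_⟩⟩
      have := hM _ (hin y (hρs hy) (circleMap 0 r t) (by rw [hc]; linarith))
      simp only [hG, norm_smul, norm_inv, norm_pow, sub_zero, hc, deriv_circleMap, norm_mul,
        Complex.norm_I, mul_one]
      rw [mul_assoc]
      gcongr
  have := (hmain.const_smul ((2 * Real.pi * Complex.I : ℂ)⁻¹)).congr hform
  exact (this.differentiableAt (Metric.ball_mem_nhds _ (by linarith))).differentiableWithinAt

end Osgood

/-! ### From holomorphic derivatives to convergent power series -/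

section OsgoodLemma

universe u

variable {E F : Type u} [NormedAddCommGroup E] [NormedSpace ℂ E] [FiniteDimensional ℂ E]
  [NormedAddCommGroup F] [NormedSpace ℂ F] [FiniteDimensional ℂ F]

theorem differentiableOn_fderiv {f : E → F} {U : Set E} (hU : IsOpen U)
    (hf : DifferentiableOn ℂ f U) : DifferentiableOn ℂ (fderiv ℂ f) U := by
  let b := Module.finBasis ℂ E
  have h : ∀ x, fderiv ℂ f x = ∑ i, ContinuousLinearMap.smulRightL ℂ E F
      (LinearMap.toContinuousLinearMap (b.coord i)) (fderiv ℂ f x (b i)) := by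
    intro x
    ext v
    have hv : fderiv ℂ f x v = fderiv ℂ f x (∑ i, b.repr v i • b i) := by rw [b.sum_repr v]
    rw [hv]
    simp only [map_sum, map_smul, sum_apply, ContinuousLinearMap.smulRightL_apply_apply]
    rfl
  have h2 : fderiv ℂ f = fun x => ∑ i, ContinuousLinearMap.smulRightL ℂ E F
      (LinearMap.toContinuousLinearMap (b.coord i)) (fderiv ℂ f x (b i)) := funext h
  rw [h2]
  refine DifferentiableOn.fun_sum fun i _ => ?_
  exact (ContinuousLinearMap.differentiable _).comp_differentiableOn
    (differentiableOn_fderiv_apply hU hf (b i))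

/-- The induction replaces `F` by `E →L[ℂ] F`. This is why `F` is quantified inside the statement
and shares its universe with `E`. -/
theorem contDiffOn_of_differentiableOn (m : ℕ) : ∀ {F : Type u} [NormedAddCommGroup F]
    [NormedSpace ℂ F] [FiniteDimensional ℂ F] {f : E → F} {U : Set E},
    IsOpen U → DifferentiableOn ℂ f U → ContDiffOn ℂ m f U := by
  induction m with
  | zero =>
    intro F _ _ _ f U hU hf
    exact contDiffOn_zero.2 hf.continuousOn
  | succ m ih =>
    intro F _ _ _ f U hU hf
    have := (contDiffOn_succ_iff_fderiv_of_isOpen (n := (m : WithTop ℕ∞)) (f := f) (𝕜 := ℂ) hU).2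
      ⟨hf, fun h => by simp at h, ih hU (differentiableOn_fderiv hU hf)⟩
    exact_mod_cast this

theorem differentiableOn_iteratedFDeriv {f : E → F} {U : Set E} (hU : IsOpen U)
    (hf : DifferentiableOn ℂ f U) (m : ℕ) : DifferentiableOn ℂ (iteratedFDeriv ℂ m f) U := by
  intro x hx
  refine (ContDiffAt.differentiableAt_iteratedFDeriv (n := ((m + 1 : ℕ) : WithTop ℕ∞))
    ((contDiffOn_of_differentiableOn (m + 1) hU hf).contDiffAt (hU.mem_nhds hx)) ?_
    ).differentiableWithinAt
  exact_mod_cast Nat.lt_succ_self m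

/-- Each derivative costs a distance `δ` and a factor `1 / δ`. The absence of a factorial is
repaired later by letting `δ` depend on `m`. -/
theorem norm_iteratedFDeriv_le_of_ball {f : E → F} {x : E} {R M δ : ℝ} (hδ : 0 < δ)
    (hf : DifferentiableOn ℂ f (Metric.ball x R)) (hM : ∀ y ∈ Metric.ball x R, ‖f y‖ ≤ M) (m : ℕ) :
    ∀ y, dist y x + m * δ < R → ‖iteratedFDeriv ℂ m f y‖ ≤ M / δ ^ m := by
  induction m with
  | zero =>
    intro y hy
    simpa using hM y (by simpa using hy)
  | succ m ih =>
    intro y hy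
    push_cast at hy
    rw [← norm_fderiv_iteratedFDeriv, pow_succ, ← div_div]
    have hz : ∀ z ∈ Metric.ball y δ, dist z x + m * δ < R := fun z hz => by
      rw [Metric.mem_ball] at hz
      linarith [dist_triangle z y x]
    refine norm_fderiv_le_of_ball hδ
      ((differentiableOn_iteratedFDeriv Metric.isOpen_ball hf m).mono fun z h => ?_)
      fun z h => ih z (hz z h)
    have := hz z h
    have h2 : 0 ≤ m * δ := by positivity
    rw [Metric.mem_ball]
    linarith

theorem iteratedDeriv_comp_line {f : E → F} {U : Set E} (hU : IsOpen U)
    (hf : DifferentiableOn ℂ f U) (x v : E) (m : ℕ) :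
    ∀ z : ℂ, x + z • v ∈ U → iteratedDeriv m (fun z : ℂ => f (x + z • v)) z =
      iteratedFDeriv ℂ m f (x + z • v) fun _ => v := by
  induction m with
  | zero => intro z _; simp
  | succ m ih =>
    intro z hz
    have hopen : IsOpen {z : ℂ | x + z • v ∈ U} := hU.preimage (by fun_prop)
    rw [iteratedDeriv_succ, iteratedFDeriv_succ_apply_left]
    have h1 : iteratedDeriv m (fun z : ℂ => f (x + z • v)) =ᶠ[nhds z]
        fun z => iteratedFDeriv ℂ m f (x + z • v) fun _ => v :=
      Filter.mem_of_superset (hopen.mem_nhds hz) fun w hw => ih w hw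
    rw [h1.deriv_eq]
    have h2 := hasDerivAt_comp_line
      ((differentiableOn_iteratedFDeriv hU hf m).differentiableAt (hU.mem_nhds hz))
    exact ((ContinuousMultilinearMap.apply ℂ (fun _ : Fin m => E) F
      (fun _ => v)).hasFDerivAt.comp_hasDerivAt z h2).deriv

/-- **Osgood's lemma**: holomorphic functions on open subsets of finite dimensional spaces are
analytic. -/
theorem analyticOnNhd_of_differentiableOn {f : E → F} {U : Set E} (hU : IsOpen U)
    (hf : DifferentiableOn ℂ f U) : AnalyticOnNhd ℂ f U := by
  intro x hx
  have hE : ProperSpace E := FiniteDimensional.proper ℂ E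
  have hF : CompleteSpace F := FiniteDimensional.complete ℂ F
  obtain ⟨R, hR, hRU⟩ := Metric.nhds_basis_closedBall.mem_iff.1 (hU.mem_nhds hx)
  obtain ⟨M, hM⟩ := (isCompact_closedBall x R).exists_bound_of_continuousOn
    (hf.continuousOn.mono hRU)
  have hM0 : 0 ≤ M := (norm_nonneg _).trans (hM x (Metric.mem_closedBall_self hR.le))
  have hfb : DifferentiableOn ℂ f (Metric.ball x R) :=
    hf.mono (Metric.ball_subset_closedBall.trans hRU)
  -- The choice `δ = R / (2m)` bounds the `m`-th derivative by `M (2m / R)^m`, and `m^m ≤ e^m m!`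
  -- makes this `M m! q^m`.
  set q : ℝ := 2 * Real.exp 1 / R with hq
  have hq0 : 0 < q := by positivity
  let p : FormalMultilinearSeries ℂ E F := fun m => ((m.factorial : ℂ)⁻¹) • iteratedFDeriv ℂ m f x
  have hp : ∀ m, ‖p m‖ ≤ M * q ^ m := by
    intro m
    have hb : ‖iteratedFDeriv ℂ m f x‖ ≤ M * (m.factorial * q ^ m) := by
      rcases Nat.eq_zero_or_pos m with rfl | hm
      · simpa using hM x (Metric.mem_closedBall_self hR.le)
      have hm' : (0 : ℝ) < m := by exact_mod_cast hm
      have := norm_iteratedFDeriv_le_of_ball (δ := R / (2 * m)) (by positivity) hfb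
        (fun y hy => hM y (Metric.ball_subset_closedBall hy)) m x (by
          rw [dist_self, zero_add]
          field_simp
          linarith)
      refine this.trans ?_
      rw [div_eq_mul_inv]
      refine mul_le_mul_of_nonneg_left ?_ hM0
      have h1 := Real.pow_div_factorial_le_exp (m : ℝ) hm'.le m
      rw [div_le_iff₀ (by positivity)] at h1
      rw [← inv_pow, inv_div, div_pow, mul_pow, hq, div_pow, mul_pow, ← Real.exp_nat_mul, mul_one,
        ← mul_div_assoc]
      rw [div_le_div_iff_of_pos_right (by positivity)]
      calc (2 : ℝ) ^ m * m ^ m ≤ 2 ^ m * (Real.exp m * m.factorial) := by gcongr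
        _ = m.factorial * (2 ^ m * Real.exp m) := by ring
    have hfac : (0 : ℝ) < m.factorial := by positivity
    simp only [p, norm_smul, norm_inv, Complex.norm_natCast]
    rw [inv_mul_le_iff₀ hfac]
    linarith
  have hrad : ENNReal.ofReal (q⁻¹) ≤ p.radius := by
    refine p.le_radius_of_bound M fun m => ?_
    rw [Real.coe_toNNReal _ (by positivity)]
    calc ‖p m‖ * q⁻¹ ^ m ≤ M * q ^ m * q⁻¹ ^ m := by gcongr; exact hp m
      _ = M := by rw [mul_assoc, ← mul_pow, mul_inv_cancel₀ hq0.ne', one_pow, mul_one]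
  refine ⟨p, ENNReal.ofReal q⁻¹, hrad, by simpa using hq0, fun {v} hv => ?_⟩
  have hv' : ‖v‖ < q⁻¹ := by
    rw [Metric.mem_eball, edist_zero_right] at hv
    rw [← ofReal_norm, ENNReal.ofReal_lt_ofReal_iff (by positivity)] at hv
    exact hv
  have hqR : q⁻¹ * 2 ≤ R := by
    rw [hq, inv_div, div_mul_eq_mul_div, div_le_iff₀ (by positivity)]
    nlinarith [Real.add_one_le_exp (1 : ℝ)]
  have hline : ∀ z ∈ Metric.ball (0 : ℂ) 2, x + z • v ∈ Metric.ball x R := fun z hz => by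
    rw [mem_ball_iff_norm, add_sub_cancel_left, norm_smul]
    have : ‖z‖ < 2 := by simpa using hz
    nlinarith [norm_nonneg z, norm_nonneg v]
  -- The sum is identified on each complex line through `x` by the one-variable theorem, evaluated
  -- at `z = 1`. The disc of radius 2 stays in the domain because `2 ‖v‖ < 2 q⁻¹ ≤ R`.
  have hs := Complex.hasSum_taylorSeries_on_ball (f := fun z : ℂ => f (x + z • v)) (c := 0) (r := 2)
    (fun z hz => (hasDerivAt_comp_line (hfb.differentiableAt
      (Metric.isOpen_ball.mem_nhds (hline z hz)))).differentiableAt.differentiableWithinAt)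
    (z := 1) (by simp)
  simp only [one_smul, sub_zero, one_pow] at hs
  convert hs using 2 with m
  rw [iteratedDeriv_comp_line Metric.isOpen_ball hfb x v m 0 (hline 0 (by simp))]
  simp [p]

end OsgoodLemma

/-! ### Fourier series of functions on a complex strip -/

section Fourier

open MeasureTheory UnitAddTorus Complex

local instance instMeasureSpaceUnitAddCircle : MeasureSpace UnitAddCircle :=
  ⟨AddCircle.haarAddCircle⟩

local instance instIsAddHaarMeasureUnitAddCircle :
    Measure.IsAddHaarMeasure (volume : Measure UnitAddCircle) :=
  inferInstanceAs (Measure.IsAddHaarMeasure AddCircle.haarAddCircle)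

local instance instIsProbabilityMeasureUnitAddCircle :
    IsProbabilityMeasure (volume : Measure UnitAddCircle) :=
  inferInstanceAs (IsProbabilityMeasure AddCircle.haarAddCircle)

variable {n : ℕ}

/-- The complex strip `{|Im θ| < s}`. -/
def strip (n : ℕ) (s : ℝ) : Set (CVec n) := {θ | ‖fun i => (θ i).im‖ < s}

/-- The `ℓ¹`-norm of an integer vector. -/
def l1 (k : Fin n → ℤ) : ℝ := ∑ i, |(k i : ℝ)|

/-- The lattice vector `2πk`. -/
def period (k : Fin n → ℤ) : CVec n := fun i => 2 * (Real.pi : ℂ) * (k i : ℂ)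

/-- The exponential `e^{i⟨k, θ⟩}`. -/
def expChar (k : Fin n → ℤ) (θ : CVec n) : ℂ := Complex.exp (I * ∑ i, (k i : ℂ) * θ i)

/-- The real angles `2πt`. -/
def angles (t : Fin n → ℝ) : CVec n := fun i => 2 * (Real.pi : ℂ) * (t i : ℂ)

/-- The representative with coordinates in `[0, 1)` of a point of the torus. -/
def torusRep (x : UnitAddTorus (Fin n)) : Fin n → ℝ := fun i => (AddCircle.equivIco 1 0 (x i) : ℝ)

/-- The function on the torus induced by a periodic function of the angles. -/
def torusLift (h : CVec n → ℂ) (x : UnitAddTorus (Fin n)) : ℂ := h (angles (torusRep x))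

/-- The Fourier coefficients of a periodic function of the angles. -/
def fcoeff (h : CVec n → ℂ) (k : Fin n → ℤ) : ℂ := mFourierCoeff (torusLift h) k

/-- Functions which are holomorphic and periodic on a strip. -/
structure IsPeriodicHol (h : CVec n → ℂ) (s : ℝ) : Prop where
  diff : DifferentiableOn ℂ h (strip n s)
  periodic : ∀ θ ∈ strip n s, ∀ k : Fin n → ℤ, h (θ + period k) = h θ

theorem mem_strip_iff {s : ℝ} (hs : 0 < s) {θ : CVec n} :
    θ ∈ strip n s ↔ ∀ i, |(θ i).im| < s := by
  simp only [strip, mem_ofPred_eq, pi_norm_lt_iff hs, Real.norm_eq_abs]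

theorem isOpen_strip (s : ℝ) : IsOpen (strip n s) :=
  isOpen_lt (by fun_prop) continuous_const

theorem strip_mono {s s' : ℝ} (h : s ≤ s') : strip n s ⊆ strip n s' := fun _ hθ => lt_of_lt_of_le hθ h

theorem period_im (k : Fin n → ℤ) (i : Fin n) : (period k i).im = 0 := by
  simp [period]

theorem angles_im (t : Fin n → ℝ) (i : Fin n) : (angles t i).im = 0 := by
  simp [angles]

theorem angles_add_int (t : Fin n → ℝ) (k : Fin n → ℤ) :
    angles (fun i => t i + k i) = angles t + period k := by
  ext i; simp [angles, period]; ring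

theorem expChar_add (k : Fin n → ℤ) (θ θ' : CVec n) :
    expChar k (θ + θ') = expChar k θ * expChar k θ' := by
  simp only [expChar, ← Complex.exp_add, Pi.add_apply, mul_add, Finset.sum_add_distrib]

theorem expChar_period (k l : Fin n → ℤ) : expChar k (period l) = 1 := by
  rw [expChar, Complex.exp_eq_one_iff]
  refine ⟨∑ i, k i * l i, ?_⟩
  push_cast
  rw [Finset.mul_sum, Finset.sum_mul]
  refine Finset.sum_congr rfl fun i _ => ?_
  simp only [period]
  ring

theorem norm_expChar (k : Fin n → ℤ) (θ : CVec n) :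
    ‖expChar k θ‖ = Real.exp (-∑ i, (k i : ℝ) * (θ i).im) := by
  rw [expChar, Complex.norm_exp]
  congr 1
  simp [Complex.mul_re, Complex.im_sum]

theorem abs_sum_mul_le (k : Fin n → ℤ) {y : Fin n → ℝ} {s : ℝ} (hy : ∀ i, |y i| ≤ s) :
    |∑ i, (k i : ℝ) * y i| ≤ l1 k * s := by
  rw [l1, Finset.sum_mul]
  refine (Finset.abs_sum_le_sum_abs _ _).trans (Finset.sum_le_sum fun i _ => ?_)
  rw [abs_mul]
  exact mul_le_mul_of_nonneg_left (hy i) (abs_nonneg _)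

theorem norm_expChar_le (k : Fin n → ℤ) {θ : CVec n} {s : ℝ} (hθ : ∀ i, |(θ i).im| ≤ s) :
    ‖expChar k θ‖ ≤ Real.exp (l1 k * s) := by
  rw [norm_expChar, Real.exp_le_exp]
  exact (neg_le_abs _).trans (abs_sum_mul_le k hθ)

theorem differentiable_expChar (k : Fin n → ℤ) : Differentiable ℂ (expChar k) := by
  unfold expChar
  fun_prop

theorem fourier_coe_eq (k : Fin n → ℤ) (t : Fin n → ℝ) :
    mFourier k (fun i => (t i : UnitAddCircle)) = expChar k (angles t) := by
  simp only [mFourier, ContinuousMap.coe_mk, fourier_coe_apply, expChar, Finset.mul_sum,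
    Complex.exp_sum, angles]
  refine Finset.prod_congr rfl fun i _ => ?_
  congr 1
  push_cast
  ring

theorem coe_torusRep (x : UnitAddTorus (Fin n)) : (fun i => (torusRep x i : UnitAddCircle)) = x := by
  ext i
  exact (AddCircle.equivIco 1 0).symm_apply_apply (x i)

theorem torusRep_coe (t : Fin n → ℝ) :
    ∃ k : Fin n → ℤ, torusRep (fun i => (t i : UnitAddCircle)) = fun i => t i + k i := by
  refine ⟨fun i => -⌊t i⌋, ?_⟩
  ext i
  have := AddCircle.coe_equivIco_mk_apply (1 : ℝ) (t i)
  simp only [torusRep]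
  rw [this]
  simp [Int.fract, sub_eq_add_neg]

theorem measurable_torusRep : Measurable (torusRep (n := n)) := by
  refine measurable_pi_lambda _ fun i => ?_
  exact measurable_subtype_coe.comp
    ((AddCircle.measurableEquivIco 1 0).measurable.comp (measurable_pi_apply i))

theorem measurable_angles : Measurable (angles (n := n)) := by
  unfold angles
  fun_prop

theorem torusLift_coe {h : CVec n → ℂ}
    (hper : ∀ t : Fin n → ℝ, ∀ k : Fin n → ℤ, h (angles t + period k) = h (angles t))
    (t : Fin n → ℝ) : torusLift h (fun i => (t i : UnitAddCircle)) = h (angles t) := by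
  obtain ⟨k, hk⟩ := torusRep_coe t
  rw [torusLift, hk, angles_add_int, hper]

/-- The representative in `[0, 1)` jumps, but periodicity hides the jumps: continuity may be tested
on `ℝⁿ`, whose projection to the torus is an open quotient map. -/
theorem continuous_torusLift {h : CVec n → ℂ}
    (hper : ∀ t : Fin n → ℝ, ∀ k : Fin n → ℤ, h (angles t + period k) = h (angles t))
    (hc : Continuous fun t : Fin n → ℝ => h (angles t)) : Continuous (torusLift h) := by
  have hq : IsOpenQuotientMap (Pi.map fun (_ : Fin n) (t : ℝ) => (t : UnitAddCircle)) :=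
    IsOpenQuotientMap.piMap fun _ => QuotientAddGroup.isOpenQuotientMap_mk
  rw [hq.isQuotientMap.continuous_iff]
  convert hc using 1
  ext t
  exact torusLift_coe hper t

theorem mFourier_mul_torusLift (h : CVec n → ℂ) (k : Fin n → ℤ) (x : UnitAddTorus (Fin n)) :
    mFourier k x * torusLift h x = torusLift (fun θ => expChar k θ * h θ) x := by
  conv_lhs => rw [← coe_torusRep x]
  rw [fourier_coe_eq, coe_torusRep]
  rfl

theorem fcoeff_eq_integral (h : CVec n → ℂ) (k : Fin n → ℤ) :
    fcoeff h k = ∫ x, torusLift (fun θ => expChar (-k) θ * h θ) x := by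
  rw [fcoeff, mFourierCoeff]
  simp only [smul_eq_mul, mFourier_mul_torusLift]

namespace IsPeriodicHol

variable {h : CVec n → ℂ} {s : ℝ}

theorem mul_expChar (hh : IsPeriodicHol h s) (k : Fin n → ℤ) :
    IsPeriodicHol (fun θ => expChar k θ * h θ) s where
  diff := (differentiable_expChar k).differentiableOn.mul hh.diff
  periodic θ hθ l := by
    rw [expChar_add, expChar_period, mul_one, hh.periodic θ hθ l]

theorem periodic_angles (hh : IsPeriodicHol h s) {z : CVec n} (hz : z ∈ strip n s)
    (t : Fin n → ℝ) (k : Fin n → ℤ) : h (angles t + period k + z) = h (angles t + z) := by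
  have := hh.periodic (angles t + z) (by
    simpa [strip, angles_im] using hz) k
  rw [← this]
  congr 1
  abel

theorem continuous_angles (hh : IsPeriodicHol h s) {z : CVec n} (hz : z ∈ strip n s) :
    Continuous fun t : Fin n → ℝ => h (angles t + z) := by
  refine hh.diff.continuousOn.comp_continuous (by unfold angles; fun_prop) fun t => ?_
  simpa [strip, angles_im] using hz

theorem continuous_torusLift_shift (hh : IsPeriodicHol h s) {z : CVec n} (hz : z ∈ strip n s) :
    Continuous (torusLift fun θ => h (θ + z)) :=
  continuous_torusLift (fun t k => hh.periodic_angles hz t k) (hh.continuous_angles hz)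

end IsPeriodicHol

theorem torusRep_mem (x : UnitAddTorus (Fin n)) : torusRep x ∈ Icc (0 : Fin n → ℝ) 1 := by
  refine ⟨fun i => ((AddCircle.equivIco 1 0 (x i)).2).1, fun i => ?_⟩
  exact (((AddCircle.equivIco 1 0 (x i)).2).2.trans_eq (zero_add 1)).le

/-- Torus averages of a function depending holomorphically on parameters are holomorphic. -/
theorem differentiableOn_integral_torusLift {E : Type*} [NormedAddCommGroup E] [NormedSpace ℂ E]
    [FiniteDimensional ℂ E] {f : CVec n × E → ℂ} {W : Set (CVec n × E)} {U : Set E}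
    (hW : IsOpen W) (hU : IsOpen U) (hf : DifferentiableOn ℂ f W)
    (hWU : ∀ ω ∈ U, ∀ t : Fin n → ℝ, (angles t, ω) ∈ W)
    (hper : ∀ ω ∈ U, ∀ t : Fin n → ℝ, ∀ k : Fin n → ℤ,
      f (angles t + period k, ω) = f (angles t, ω)) :
    DifferentiableOn ℂ (fun ω => ∫ x, torusLift (fun θ => f (θ, ω)) x) U := by
  borelize E
  have hE : ProperSpace E := FiniteDimensional.proper ℂ E
  have hang : Continuous (angles (n := n)) := by unfold angles; fun_prop
  have hdf : ∀ ω ∈ U, ∀ t : Fin n → ℝ, HasFDerivAt (fun ω => f (angles t, ω))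
      ((fderiv ℂ f (angles t, ω)).comp (ContinuousLinearMap.inr ℂ (CVec n) E)) ω := by
    intro ω hω t
    exact (hf.differentiableAt (hW.mem_nhds (hWU ω hω t))).hasFDerivAt.comp ω
      (hasFDerivAt_prodMk_right (angles t) ω)
  refine differentiableOn_integral_of_locally_bounded
    (G := fun ω x => torusLift (fun θ => f (θ, ω)) x) hU ?_ ?_ ?_ ?_
  · exact fun x ω hω => (hdf ω hω _).differentiableAt.differentiableWithinAt
  · intro ω hω
    refine (continuous_torusLift (hper ω hω) ?_).aestronglyMeasurable
    exact hf.continuousOn.comp_continuous (by fun_prop) fun t => hWU ω hω t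
  · intro ω hω
    have h1 : ∀ x, fderiv ℂ (fun ω => torusLift (fun θ => f (θ, ω)) x) ω =
        (fderiv ℂ f (angles (torusRep x), ω)).comp (ContinuousLinearMap.inr ℂ (CVec n) E) :=
      fun x => (hdf ω hω (torusRep x)).fderiv
    simp only [h1]
    have h2 : Continuous fun L : (CVec n × E) →L[ℂ] ℂ =>
        L.comp (ContinuousLinearMap.inr ℂ (CVec n) E) := by fun_prop
    have h3 : Measurable fun x : UnitAddTorus (Fin n) => (angles (torusRep x), ω) :=
      (measurable_angles.comp measurable_torusRep).prodMk measurable_const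
    have h4 : ProperSpace ((CVec n × E) →L[ℂ] ℂ) := FiniteDimensional.proper ℂ _
    exact h2.comp_aestronglyMeasurable
      ((measurable_fderiv ℂ f).comp h3).aestronglyMeasurable
  · intro ω hω
    obtain ⟨ρ, hρ, hρU⟩ := Metric.nhds_basis_closedBall.mem_iff.1 (hU.mem_nhds hω)
    have hK : IsCompact (Icc (0 : Fin n → ℝ) 1 ×ˢ Metric.closedBall ω ρ) :=
      isCompact_Icc.prod (isCompact_closedBall ω ρ)
    obtain ⟨M, hM⟩ := hK.exists_bound_of_continuousOn
      (f := fun p : (Fin n → ℝ) × E => f (angles p.1, p.2))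
      (hf.continuousOn.comp (by fun_prop) fun p hp => hWU p.2 (hρU hp.2) p.1)
    refine ⟨ρ, hρ, M, fun ω' hω' => ⟨hρU (Metric.ball_subset_closedBall hω'), fun x => ?_⟩⟩
    exact hM (torusRep x, ω') ⟨torusRep_mem x, Metric.ball_subset_closedBall hω'⟩

namespace IsPeriodicHol

variable {h : CVec n → ℂ} {s : ℝ}

/-- The mean over the torus does not change if the torus is shifted into the strip. -/
theorem integral_torusLift_shift (hh : IsPeriodicHol h s) {y : Fin n → ℝ}
    (hy : ‖y‖ < s) :
    ∫ x, torusLift (fun θ => h (θ + I • fun i => (y i : ℂ))) x = ∫ x, torusLift h x := by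
  set Y : CVec n := fun i => (y i : ℂ) with hY
  have hs : 0 < s := (norm_nonneg y).trans_lt hy
  have hmem : ∀ ζ : ℂ, ∀ t, angles t + ζ • Y ∈ strip n s ↔ |ζ.im| * ‖y‖ < s := by
    intro ζ t
    have : (fun i => ((angles t + ζ • Y) i).im) = ζ.im • y := by
      ext i
      simp [angles_im, hY]
    rw [strip, mem_ofPred_eq, this, norm_smul, Real.norm_eq_abs]
  set U : Set ℂ := {ζ | |ζ.im| * ‖y‖ < s} with hU
  have hUo : IsOpen U := isOpen_lt (by fun_prop) continuous_const
  have hUc : Convex ℝ U := by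
    intro a ha b hb u v hu hv huv
    simp only [hU, mem_ofPred_eq] at *
    have h1 : |(u • a + v • b).im| ≤ u * |a.im| + v * |b.im| := by
      simp only [Complex.add_im, Complex.real_smul, Complex.im_ofReal_mul]
      refine (abs_add_le _ _).trans ?_
      rw [abs_mul, abs_mul, abs_of_nonneg hu, abs_of_nonneg hv]
    have h2 := mul_le_mul_of_nonneg_right h1 (norm_nonneg y)
    refine h2.trans_lt ?_
    rw [add_mul, mul_assoc, mul_assoc]
    rcases hu.eq_or_lt with rfl | hu'
    · have : v = 1 := by linarith
      subst this; simpa using hb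
    · have := mul_le_mul_of_nonneg_left hb.le hv
      have := mul_lt_mul_of_pos_left ha hu'
      nlinarith
  -- The shift is made complex. For real `ζ` the mean `Q ζ` is constant by translation invariance of
  -- the measure; `Q` is holomorphic on a strip that contains `I`, so the identity theorem gives `Q
  -- I = Q 0`.
  set Q : ℂ → ℂ := fun ζ => ∫ x, torusLift (fun θ => h (θ + ζ • Y)) x with hQ
  have hQd : DifferentiableOn ℂ Q U := by
    refine differentiableOn_integral_torusLift (f := fun p : CVec n × ℂ => h (p.1 + p.2 • Y))
      (W := {p | p.1 + p.2 • Y ∈ strip n s}) ((isOpen_strip s).preimage (by fun_prop)) hUo ?_ ?_ ?_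
    · exact hh.diff.comp (by fun_prop) fun p hp => hp
    · exact fun ω hω t => (hmem ω t).2 hω
    · intro ω hω t k
      have h0 := (hmem ω 0).2 hω
      refine hh.periodic_angles (z := ω • Y) ?_ t k
      convert h0 using 1
      ext i; simp [angles]
  have hreal : ∀ t : ℝ, Q t = Q 0 := by
    intro t
    have hp : ∀ t : Fin n → ℝ, ∀ k : Fin n → ℤ, h (angles t + period k) = h (angles t) := by
      intro t k
      refine hh.periodic _ ?_ k
      have := (hmem 0 t).2 (by simpa using hs)
      simpa using this
    set a : Fin n → ℝ := fun i => t * y i / (2 * Real.pi) with ha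
    have hpi : (Real.pi : ℂ) ≠ 0 := by exact_mod_cast Real.pi_ne_zero
    have ha' : (t : ℂ) • Y = angles a := by
      ext i
      simp only [Pi.smul_apply, hY, smul_eq_mul, angles, ha]
      push_cast
      field_simp
    have hadd : ∀ u v : Fin n → ℝ, angles u + angles v = angles (u + v) := by
      intro u v
      ext i
      simp only [angles, Pi.add_apply]
      push_cast
      ring
    have h1 : ∀ x, torusLift (fun θ => h (θ + (t : ℂ) • Y)) x =
        torusLift h (x + fun i => (a i : UnitAddCircle)) := by
      intro x
      have h2 := torusLift_coe hp (torusRep x + a)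
      have h3 : (fun i => (((torusRep x + a) i : ℝ) : UnitAddCircle)) =
          x + fun i => (a i : UnitAddCircle) := by
        conv_rhs => rw [← coe_torusRep x]
        rfl
      rw [h3] at h2
      rw [h2, torusLift, ha', hadd]
    simp only [hQ, h1, zero_smul, add_zero]
    exact integral_add_right_eq_self (fun x => torusLift h x) _
  have hIm : I ∈ U := by simpa [hU] using hy
  have h0 : (0 : ℂ) ∈ U := by simpa [hU] using hs
  have hfreq : ∃ᶠ z in nhdsWithin (0 : ℂ) {0}ᶜ, Q z = Q 0 := by
    rw [frequently_nhdsWithin_iff]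
    have h1 : Filter.Tendsto (fun m : ℕ => (((1 : ℝ) / ((m : ℝ) + 1) : ℝ) : ℂ)) Filter.atTop
        (nhds 0) := by
      exact (Complex.continuous_ofReal.tendsto' 0 0 rfl).comp
        tendsto_one_div_add_atTop_nhds_zero_nat
    refine h1.frequently (Filter.Frequently.of_forall fun m => ⟨hreal _, ?_⟩)
    simp only [mem_compl_iff, mem_singleton_iff, Complex.ofReal_eq_zero]
    positivity
  have := (hQd.analyticOnNhd hUo).eqOn_of_preconnected_of_frequently_eq
    (analyticOnNhd_const (v := Q 0)) hUc.isPreconnected h0 hfreq hIm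
  simpa [hQ] using this

/-- The mean of `e^{-i⟨k, θ⟩} h` is invariant under shifts, so shifting `h` alone multiplies the
coefficient by a real exponential. All decay of Fourier coefficients comes from here. -/
theorem fcoeff_shift (hh : IsPeriodicHol h s) {y : Fin n → ℝ} (hy : ‖y‖ < s) (k : Fin n → ℤ) :
    fcoeff (fun θ => h (θ + I • fun i => (y i : ℂ))) k =
      expChar k (I • fun i => (y i : ℂ)) * fcoeff h k := by
  have h1 := (hh.mul_expChar (-k)).integral_torusLift_shift hy
  rw [← fcoeff_eq_integral] at h1
  rw [← h1, fcoeff_eq_integral, ← integral_const_mul]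
  refine integral_congr_ae (Filter.Eventually.of_forall fun x => ?_)
  simp only [torusLift]
  rw [expChar_add, ← mul_assoc, ← mul_assoc]
  congr 1
  have : expChar k (I • fun i => (y i : ℂ)) * expChar (-k) (I • fun i => (y i : ℂ)) = 1 := by
    rw [expChar, expChar, ← Complex.exp_add, Complex.exp_eq_one_iff]
    exact ⟨0, by simp⟩
  linear_combination (-expChar (-k) (angles (torusRep x))) * this

end IsPeriodicHol

/-- **Bessel's inequality** on the torus. -/
theorem sum_sq_fcoeff_le {h : CVec n → ℂ} {M : ℝ} (hc : Continuous (torusLift h))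
    (hM : ∀ t : Fin n → ℝ, ‖h (angles t)‖ ≤ M) (A : Finset (Fin n → ℤ)) :
    ∑ k ∈ A, ‖fcoeff h k‖ ^ 2 ≤ M ^ 2 := by
  set g : C(UnitAddTorus (Fin n), ℂ) := ⟨torusLift h, hc⟩ with hg
  have h1 := hasSum_sq_mFourierCoeff (g.toLp 2 volume ℂ)
  simp only [mFourierCoeff_toLp] at h1
  have h2 := sum_le_hasSum A (fun k _ => by positivity) h1
  refine h2.trans ?_
  have h3 : ∀ᵐ x, ‖(ContinuousMap.toLp 2 volume ℂ g) x‖ ^ 2 ≤ M ^ 2 := by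
    filter_upwards [ContinuousMap.coeFn_toLp (p := 2) (𝕜 := ℂ) volume g] with x hx
    rw [hx]
    exact pow_le_pow_left₀ (norm_nonneg _) (hM _) 2
  have h4 := integral_mono_of_nonneg (Filter.Eventually.of_forall fun x => by positivity)
    (integrable_const (M ^ 2)) h3
  simpa using h4

theorem norm_fcoeff_le {h : CVec n → ℂ} {M : ℝ} (hc : Continuous (torusLift h))
    (hM : ∀ t : Fin n → ℝ, ‖h (angles t)‖ ≤ M) (k : Fin n → ℤ) : ‖fcoeff h k‖ ≤ M := by
  have h1 := sum_sq_fcoeff_le hc hM {k}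
  rw [Finset.sum_singleton] at h1
  exact le_of_sq_le_sq h1 ((norm_nonneg _).trans (hM 0))

theorem conj_fcoeff {h : CVec n → ℂ} (hr : ∀ t : Fin n → ℝ, (h (angles t)).im = 0)
    (k : Fin n → ℤ) : (starRingEnd ℂ) (fcoeff h k) = fcoeff h (-k) := by
  rw [fcoeff, mFourierCoeff, ← integral_conj, fcoeff, mFourierCoeff]
  refine integral_congr_ae (Filter.Eventually.of_forall fun x => ?_)
  simp only [smul_eq_mul, map_mul, mFourier_neg, Complex.conj_conj]
  congr 1
  exact Complex.conj_eq_iff_im.2 (hr _)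

end Fourier

/-! ### Exponential decay of coefficients and convergence on the strip -/

section FourierDecay

open Complex UnitAddTorus

variable {n : ℕ}

theorem sum_Icc_exp_abs_le {a : ℝ} (ha : 0 < a) (N : ℕ) :
    ∑ m ∈ Finset.Icc (-(N : ℤ)) N, Real.exp (-(a * |(m : ℝ)|)) ≤ 1 + 2 / a := by
  have hgeom : ∀ N : ℕ, ∑ m ∈ Finset.Icc (-(N : ℤ)) N, Real.exp (-(a * |(m : ℝ)|)) =
      1 + 2 * ∑ m ∈ Finset.range N, Real.exp (-(a * ((m : ℝ) + 1))) := by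
    intro N
    induction N with
    | zero => simp
    | succ N ih =>
      have h1 : Finset.Icc (-((N + 1 : ℕ) : ℤ)) ((N + 1 : ℕ) : ℤ) =
          insert (-((N + 1 : ℕ) : ℤ)) (insert ((N + 1 : ℕ) : ℤ)
            (Finset.Icc (-(N : ℤ)) (N : ℤ))) := by
        ext m
        simp only [Finset.mem_insert, Finset.mem_Icc]
        push_cast
        omega
      have habs : |(N : ℝ) + 1| = N + 1 := abs_of_nonneg (by positivity)
      have habs' : |-(N : ℝ) - 1| = N + 1 := by
        rw [← habs, ← abs_neg]; congr 1; ring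
      rw [h1, Finset.sum_insert (by
        simp only [Finset.mem_insert, Finset.mem_Icc]; push_cast; omega),
        Finset.sum_insert (by simp only [Finset.mem_Icc]; push_cast; omega), ih,
        Finset.sum_range_succ]
      push_cast
      rw [neg_add', habs', habs]
      ring
  rw [hgeom N]
  have hq0 : 0 < Real.exp (-a) := Real.exp_pos _
  have hq1 : Real.exp (-a) < 1 := Real.exp_lt_one_iff.2 (by linarith)
  have h2 : ∑ m ∈ Finset.range N, Real.exp (-(a * ((m : ℝ) + 1))) ≤ 1 / a := by
    have h3 : ∀ m : ℕ, Real.exp (-(a * ((m : ℝ) + 1))) = Real.exp (-a) * Real.exp (-a) ^ m := by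
      intro m
      rw [← Real.exp_nat_mul, ← Real.exp_add]
      congr 1; ring
    simp only [h3]
    rw [← Finset.mul_sum]
    have h4 := (summable_geometric_of_lt_one hq0.le hq1).sum_le_tsum (Finset.range N)
      (fun _ _ => by positivity)
    rw [tsum_geometric_of_lt_one hq0.le hq1] at h4
    refine (mul_le_mul_of_nonneg_left h4 hq0.le).trans ?_
    rw [← div_eq_mul_inv, div_le_div_iff₀ (by linarith) ha]
    have h5 : Real.exp (-a) * (1 + a) ≤ 1 := by
      have := mul_le_mul_of_nonneg_left (Real.add_one_le_exp a) hq0.le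
      rw [← Real.exp_add, neg_add_cancel, Real.exp_zero] at this
      linarith
    linarith
  calc _ ≤ 1 + 2 * (1 / a) := by gcongr
    _ = _ := by ring

theorem sum_exp_l1_le {a : ℝ} (ha : 0 < a) (A : Finset (Fin n → ℤ)) :
    ∑ k ∈ A, Real.exp (-(a * l1 k)) ≤ (1 + 2 / a) ^ n := by
  obtain ⟨N, hN⟩ : ∃ N : ℕ, ∀ k ∈ A, ∀ i, |k i| ≤ N := by
    refine ⟨∑ k ∈ A, ∑ i, (k i).natAbs, fun k hk i => ?_⟩
    rw [Int.abs_eq_natAbs]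
    have h1 := Finset.single_le_sum (f := fun i => (k i).natAbs) (fun _ _ => Nat.zero_le _)
      (Finset.mem_univ i)
    have h2 := Finset.single_le_sum (f := fun k : Fin n → ℤ => ∑ i, (k i).natAbs)
      (fun _ _ => Nat.zero_le _) hk
    exact_mod_cast h1.trans h2
  have hsub : A ⊆ Fintype.piFinset fun _ : Fin n => Finset.Icc (-(N : ℤ)) N := by
    intro k hk
    rw [Fintype.mem_piFinset]
    exact fun i => Finset.mem_Icc.2 (abs_le.1 (hN k hk i))
  refine (Finset.sum_le_sum_of_subset_of_nonneg hsub fun _ _ _ => (Real.exp_pos _).le).trans ?_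
  have h1 : ∀ k : Fin n → ℤ, Real.exp (-(a * l1 k)) = ∏ i, Real.exp (-(a * |(k i : ℝ)|)) := by
    intro k
    rw [← Real.exp_sum, l1, Finset.mul_sum, Finset.sum_neg_distrib]
  simp only [h1]
  rw [← Finset.prod_univ_sum (fun _ : Fin n => Finset.Icc (-(N : ℤ)) N)
    fun _ m => Real.exp (-(a * |(m : ℝ)|))]
  calc ∏ _i : Fin n, ∑ m ∈ Finset.Icc (-(N : ℤ)) N, Real.exp (-(a * |(m : ℝ)|))
      ≤ ∏ _i : Fin n, (1 + 2 / a) := by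
        refine Finset.prod_le_prod (fun _ _ => Finset.sum_nonneg fun _ _ => (Real.exp_pos _).le)
          fun _ _ => sum_Icc_exp_abs_le ha N
    _ = _ := by simp

theorem summable_exp_l1 {a : ℝ} (ha : 0 < a) :
    Summable fun k : Fin n → ℤ => Real.exp (-(a * l1 k)) :=
  summable_of_sum_le (fun _ => (Real.exp_pos _).le) fun A => sum_exp_l1_le ha A

namespace IsPeriodicHol

variable {h : CVec n → ℂ} {s : ℝ} {M : ℝ}

theorem smul_I_mem {y : Fin n → ℝ} (hy : ‖y‖ < s) :
    (I • fun i => (y i : ℂ)) ∈ strip n s := by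
  simpa [strip] using hy

/-- Bessel's inequality, for all shifted tori at once. -/
theorem sum_sq_fcoeff_exp_le (hh : IsPeriodicHol h s) (hM : ∀ θ ∈ strip n s, ‖h θ‖ ≤ M) {s' : ℝ}
    (hs' : 0 ≤ s') (hss' : s' < s) (A : Finset (Fin n → ℤ)) :
    ∑ k ∈ A, ‖fcoeff h k‖ ^ 2 * Real.exp (2 * s' * l1 k) ≤ 2 ^ n * M ^ 2 := by
  have hs : 0 < s := hs'.trans_lt hss'
  -- The `2^n` shifts are the corners of the cube `[-s', s']^n`. For each `k` the corner with signs
  -- opposite to those of `k` produces the full weight `e^{2 s' |k|}`, so the sum over all corners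
  -- dominates it.
  let y : (Fin n → Bool) → Fin n → ℝ := fun ε i => if ε i then s' else -s'
  have hy : ∀ ε, ‖y ε‖ < s := by
    intro ε
    rw [pi_norm_lt_iff hs]
    intro i
    simp only [y]
    split_ifs <;> simpa [abs_of_nonneg hs'] using hss'
  have hsum : ∀ ε, ∑ k ∈ A, ‖fcoeff (fun θ => h (θ + I • fun i => (y ε i : ℂ))) k‖ ^ 2 ≤ M ^ 2 := by
    intro ε
    have hmem := smul_I_mem (hy ε)
    refine sum_sq_fcoeff_le (hh.continuous_torusLift_shift hmem) (fun t => hM _ ?_) A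
    simpa [strip, angles_im] using hmem
  have hexp : ∀ k : Fin n → ℤ, Real.exp (2 * s' * l1 k) ≤
      ∑ ε, ‖expChar k (I • fun i => (y ε i : ℂ))‖ ^ 2 := by
    intro k
    have h1 := Finset.single_le_sum
      (f := fun ε : Fin n → Bool => ‖expChar k (I • fun i => (y ε i : ℂ))‖ ^ 2)
      (fun _ _ => by positivity) (Finset.mem_univ fun i => decide (k i < 0))
    refine le_trans (le_of_eq ?_) h1
    rw [norm_expChar, ← Real.exp_nat_mul]
    congr 1
    rw [l1, mul_assoc, Finset.mul_sum, ← Finset.sum_neg_distrib]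
    push_cast
    congr 1
    refine Finset.sum_congr rfl fun i _ => ?_
    by_cases hk : k i < 0
    · have : (k i : ℝ) < 0 := by exact_mod_cast hk
      simp [y, hk, abs_of_neg this]
      ring
    · have : (0 : ℝ) ≤ k i := by exact_mod_cast not_lt.1 hk
      simp [y, hk, abs_of_nonneg this]
      ring
  calc ∑ k ∈ A, ‖fcoeff h k‖ ^ 2 * Real.exp (2 * s' * l1 k)
      ≤ ∑ k ∈ A, ‖fcoeff h k‖ ^ 2 * ∑ ε, ‖expChar k (I • fun i => (y ε i : ℂ))‖ ^ 2 := by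
        gcongr with k _
        exact hexp k
    _ = ∑ ε, ∑ k ∈ A, ‖fcoeff (fun θ => h (θ + I • fun i => (y ε i : ℂ))) k‖ ^ 2 := by
        rw [Finset.sum_comm]
        refine Finset.sum_congr rfl fun k _ => ?_
        rw [Finset.mul_sum]
        refine Finset.sum_congr rfl fun ε _ => ?_
        rw [hh.fcoeff_shift (hy ε), norm_mul, mul_pow, mul_comm]
    _ ≤ ∑ _ε : Fin n → Bool, M ^ 2 := Finset.sum_le_sum fun ε _ => hsum ε
    _ = _ := by simp

theorem norm_fcoeff_exp_le (hh : IsPeriodicHol h s) (hM : ∀ θ ∈ strip n s, ‖h θ‖ ≤ M) {s' : ℝ}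
    (hs' : 0 ≤ s') (hss' : s' < s) (k : Fin n → ℤ) :
    ‖fcoeff h k‖ ≤ 2 ^ n * M * Real.exp (-(s' * l1 k)) := by
  have hM0 : 0 ≤ M := (norm_nonneg _).trans (hM 0 (by
    have : 0 < s := hs'.trans_lt hss'
    rw [mem_strip_iff this]; exact fun i => by simpa using this))
  have h1 := hh.sum_sq_fcoeff_exp_le hM hs' hss' {k}
  rw [Finset.sum_singleton] at h1
  have h2 : (‖fcoeff h k‖ * Real.exp (s' * l1 k)) ^ 2 ≤ (2 ^ n * M) ^ 2 := by
    rw [mul_pow, ← Real.exp_nat_mul, mul_pow]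
    push_cast
    rw [← mul_assoc 2 s']
    refine h1.trans ?_
    have h3 : (1 : ℝ) ≤ 2 ^ n := one_le_pow₀ (by norm_num)
    have : (2 : ℝ) ^ n ≤ (2 ^ n) ^ 2 := by nlinarith
    gcongr
  have h3 := le_of_sq_le_sq h2 (by positivity)
  rw [Real.exp_neg, ← div_eq_mul_inv, le_div_iff₀ (Real.exp_pos _)]
  exact h3

/-- A periodic holomorphic function is the sum of its Fourier series on the whole strip. -/
theorem hasSum_fcoeff (hh : IsPeriodicHol h s) (hM : ∀ θ ∈ strip n s, ‖h θ‖ ≤ M) {θ : CVec n}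
    (hθ : θ ∈ strip n s) : HasSum (fun k => fcoeff h k * expChar k θ) (h θ) := by
  set y : Fin n → ℝ := fun i => (θ i).im with hy
  set t : Fin n → ℝ := fun i => (θ i).re / (2 * Real.pi) with ht
  have hys : ‖y‖ < s := hθ
  have hs : 0 < s := (norm_nonneg y).trans_lt hys
  have hθ' : angles t + (I • fun i => (y i : ℂ)) = θ := by
    ext i
    have hpi : (Real.pi : ℂ) ≠ 0 := by exact_mod_cast Real.pi_ne_zero
    simp only [Pi.add_apply, angles, ht, Pi.smul_apply, smul_eq_mul, hy]
    push_cast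
    field_simp
    rw [mul_comm I, Complex.re_add_im]
  have hmem := smul_I_mem hys
  obtain ⟨s', hs1, hs2⟩ := exists_between hys
  have hs'0 : 0 ≤ s' := (norm_nonneg y).trans hs1.le
  set g : C(UnitAddTorus (Fin n), ℂ) := ⟨_, hh.continuous_torusLift_shift hmem⟩ with hg
  have hcoef : ∀ k, mFourierCoeff g k = expChar k (I • fun i => (y i : ℂ)) * fcoeff h k :=
    fun k => hh.fcoeff_shift hys k
  -- The coefficients decay at a rate `s'` strictly above `‖y‖`, while the shift by `y` costs at
  -- most `e^{‖y‖ |k|}`.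
  have hsummable : Summable (mFourierCoeff g) := by
    refine Summable.of_norm_bounded
      (g := fun k => 2 ^ n * M * Real.exp (-((s' - ‖y‖) * l1 k)))
      ((summable_exp_l1 (by linarith)).mul_left _) fun k => ?_
    rw [hcoef, norm_mul]
    have h1 := norm_expChar_le k (θ := I • fun i => (y i : ℂ)) (s := ‖y‖) (fun i => by
      simpa using norm_le_pi_norm y i)
    have h2 := hh.norm_fcoeff_exp_le hM hs'0 hs2 k
    calc _ ≤ Real.exp (l1 k * ‖y‖) * (2 ^ n * M * Real.exp (-(s' * l1 k))) := by gcongr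
      _ = 2 ^ n * M * Real.exp (-((s' - ‖y‖) * l1 k)) := by
        rw [mul_left_comm, ← Real.exp_add]
        congr 2
        ring
  have h1 := hasSum_mFourier_series_apply_of_summable hsummable fun i => (t i : UnitAddCircle)
  have h2 : g (fun i => (t i : UnitAddCircle)) = h θ := by
    rw [← hθ']
    exact torusLift_coe (h := fun θ => h (θ + I • fun i => (y i : ℂ)))
      (fun t k => hh.periodic_angles hmem t k) t
  rw [h2] at h1
  convert h1 using 2 with k
  rw [hcoef, fourier_coe_eq, smul_eq_mul, ← hθ', expChar_add]
  ring

end IsPeriodicHol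

/-- Fourier coefficients depend holomorphically on parameters. -/
theorem differentiableOn_fcoeff {E : Type*} [NormedAddCommGroup E] [NormedSpace ℂ E]
    [FiniteDimensional ℂ E] {f : CVec n × E → ℂ} {s : ℝ} {U : Set E} (hs : 0 < s)
    (hU : IsOpen U) (hf : DifferentiableOn ℂ f (strip n s ×ˢ U))
    (hper : ∀ ω ∈ U, ∀ θ ∈ strip n s, ∀ k : Fin n → ℤ, f (θ + period k, ω) = f (θ, ω))
    (k : Fin n → ℤ) : DifferentiableOn ℂ (fun ω => fcoeff (fun θ => f (θ, ω)) k) U := by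
  have hang : ∀ t : Fin n → ℝ, angles t ∈ strip n s := fun t => by
    rw [mem_strip_iff hs]
    intro i
    simpa [angles_im] using hs
  have := differentiableOn_integral_torusLift (n := n) (E := E)
    (f := fun p => expChar (-k) p.1 * f p) (W := strip n s ×ˢ U)
    ((isOpen_strip s).prod hU) hU ?_ (fun ω hω t => ⟨hang t, hω⟩) ?_
  · simpa only [fcoeff_eq_integral] using this
  · exact ((differentiable_expChar (-k)).comp differentiable_fst).differentiableOn.mul hf
  · intro ω hω t l
    simp only [expChar_add, expChar_period, mul_one]
    rw [hper ω hω _ (hang t)]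

end FourierDecay

/-! ### Small divisors -/

section SmallDivisors

variable {n : ℕ}

/-- The frequency `⟨k, ξ⟩`. -/
def kdot (k : Fin n → ℤ) (ξ : Fin n → ℝ) : ℝ := ∑ i, (k i : ℝ) * ξ i

theorem l1_nonneg (k : Fin n → ℤ) : 0 ≤ l1 k := Finset.sum_nonneg fun _ _ => abs_nonneg _

theorem l1_pos {k : Fin n → ℤ} (hk : k ≠ 0) : 0 < l1 k := by
  obtain ⟨i, hi⟩ := Function.ne_iff.1 hk
  refine Finset.sum_pos' (fun _ _ => abs_nonneg _) ⟨i, Finset.mem_univ i, abs_pos.2 ?_⟩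
  exact_mod_cast hi

theorem l1_neg (k : Fin n → ℤ) : l1 (-k) = l1 k := by simp [l1]

theorem l1_sub_le (k l : Fin n → ℤ) : l1 (k - l) ≤ l1 k + l1 l := by
  simp only [l1, ← Finset.sum_add_distrib, Pi.sub_apply]
  push_cast
  exact Finset.sum_le_sum fun i _ => abs_sub _ _

theorem kdot_sub (k l : Fin n → ℤ) (ξ : Fin n → ℝ) : kdot (k - l) ξ = kdot k ξ - kdot l ξ := by
  simp [kdot, sub_mul]

theorem IsDiophantine.le_abs_kdot {α τ : ℝ} {ξ : Fin n → ℝ} (hξ : IsDiophantine α τ ξ) (hα : 0 < α)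
    (hτ : 0 ≤ τ) {k : Fin n → ℤ} (hk : k ≠ 0) {t : ℝ} (ht : l1 k ≤ t) :
    α / t ^ τ ≤ |kdot k ξ| := by
  refine le_trans ?_ (hξ k hk)
  have h0 := l1_pos hk
  have h1 : l1 k ^ τ ≤ t ^ τ := Real.rpow_le_rpow h0.le ht hτ
  exact div_le_div_of_nonneg_left hα.le (Real.rpow_pos_of_pos h0 τ) h1

/-- The sum `∑ 1 / q²` over all nonzero integers `q`. -/
def zetaInt : ℝ := ∑' q : ℤ, 1 / (q : ℝ) ^ 2

theorem zetaInt_nonneg : 0 ≤ zetaInt := tsum_nonneg fun _ => by positivity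

/-- Real numbers with mutual distances at least `1` and absolute values at least `1`. -/
theorem sum_inv_sq_le_of_separated {ι : Type*} (A : Finset ι) (x : ι → ℝ)
    (h1 : ∀ k ∈ A, 1 ≤ |x k|) (h2 : ∀ k ∈ A, ∀ l ∈ A, k ≠ l → 1 ≤ |x k - x l|) :
    ∑ k ∈ A, 1 / x k ^ 2 ≤ 4 * zetaInt := by
  -- Points at mutual distance at least 1 have different floors, so the sum is compared with `∑ 1 /
  -- q²` over integers.
  have hinj : InjOn (fun k => ⌊x k⌋) A := by
    intro k hk l hl hkl
    by_contra hne
    have := Int.abs_sub_lt_one_of_floor_eq_floor hkl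
    linarith [h2 k hk l hl hne]
  have hterm : ∀ k ∈ A, 1 / x k ^ 2 ≤ 4 * (1 / (⌊x k⌋ : ℝ) ^ 2) := by
    intro k hk
    have hx := h1 k hk
    have hf1 := Int.floor_le (x k)
    have hf2 := Int.lt_floor_add_one (x k)
    -- A vanishing floor would make the comparison term `1 / 0 = 0`; it is excluded because it means
    -- `0 ≤ x k < 1`.
    have hne : (⌊x k⌋ : ℝ) ≠ 0 := by
      intro h0
      rw [h0] at hf1 hf2
      rw [abs_of_nonneg hf1] at hx
      linarith
    have habs : |(⌊x k⌋ : ℝ)| ≤ 2 * |x k| := by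
      rw [abs_le]
      constructor
      · linarith [neg_abs_le (x k)]
      · linarith [le_abs_self (x k)]
    have hsq : (⌊x k⌋ : ℝ) ^ 2 ≤ 4 * x k ^ 2 := by
      rw [← sq_abs, ← sq_abs (x k)]
      nlinarith [abs_nonneg (⌊x k⌋ : ℝ)]
    have hxp : 0 < x k ^ 2 := by
      rw [← sq_abs]; positivity
    rw [mul_one_div, div_le_div_iff₀ hxp (by positivity)]
    linarith
  calc ∑ k ∈ A, 1 / x k ^ 2 ≤ ∑ k ∈ A, 4 * (1 / (⌊x k⌋ : ℝ) ^ 2) := Finset.sum_le_sum hterm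
    _ = 4 * ∑ q ∈ A.image fun k => ⌊x k⌋, 1 / (q : ℝ) ^ 2 := by
        rw [← Finset.mul_sum, Finset.sum_image hinj]
    _ ≤ 4 * zetaInt := by
        gcongr
        exact (Real.summable_one_div_int_pow.2 one_lt_two).sum_le_tsum _ fun _ _ => by positivity

/-- The diophantine condition, applied to differences `k - l` of length at most `2t`, separates the
numbers `⟨k, ξ⟩` by `d = α / (2t)^τ`. So only boundedly many divisors are of the worst size, and no
power of `t` is paid for the number of lattice points. -/
theorem sum_inv_sq_kdot_le {α τ : ℝ} {ξ : Fin n → ℝ} (hξ : IsDiophantine α τ ξ) (hα : 0 < α)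
    (hτ : 0 ≤ τ) {t : ℝ} (ht : 0 < t) (A : Finset (Fin n → ℤ))
    (hA : ∀ k ∈ A, k ≠ 0 ∧ l1 k ≤ t) :
    ∑ k ∈ A, 1 / kdot k ξ ^ 2 ≤ 4 * zetaInt * (2 * t) ^ (2 * τ) / α ^ 2 := by
  set d : ℝ := α / (2 * t) ^ τ with hd
  have hd0 : 0 < d := by positivity
  clear_value d
  have h1 := sum_inv_sq_le_of_separated A (fun k => kdot k ξ / d)
    (fun k hk => by
      rw [abs_div, abs_of_pos hd0, one_le_div hd0]
      rw [hd]
      exact hξ.le_abs_kdot hα hτ (hA k hk).1 (by linarith [(hA k hk).2]))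
    (fun k hk l hl hkl => by
      rw [← sub_div, ← kdot_sub, abs_div, abs_of_pos hd0, one_le_div hd0, hd]
      refine hξ.le_abs_kdot hα hτ (sub_ne_zero.2 hkl) ((l1_sub_le k l).trans ?_)
      linarith [(hA k hk).2, (hA l hl).2])
  have h2 : ∀ k, 1 / kdot k ξ ^ 2 = (1 / d ^ 2) * (1 / (kdot k ξ / d) ^ 2) := by
    intro k
    rw [div_pow, one_div_div, ← mul_div_assoc, one_div_mul_cancel (by positivity)]
  have h3 : 1 / d ^ 2 = (2 * t) ^ (2 * τ) / α ^ 2 := by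
    rw [hd, div_pow, one_div_div, mul_comm 2 τ, Real.rpow_mul (by positivity), Real.rpow_two]
  simp only [h2]
  rw [← Finset.mul_sum]
  calc (1 / d ^ 2) * ∑ k ∈ A, 1 / (kdot k ξ / d) ^ 2 ≤ (1 / d ^ 2) * (4 * zetaInt) := by gcongr
    _ = _ := by rw [h3]; ring

open MeasureTheory in
/-- Rüssmann's bound for sums over small divisors. -/
theorem sum_exp_div_sq_kdot_le {α τ : ℝ} {ξ : Fin n → ℝ} (hξ : IsDiophantine α τ ξ) (hα : 0 < α)
    (hτ : 0 ≤ τ) {σ : ℝ} (hσ : 0 < σ) (A : Finset (Fin n → ℤ)) (hA : ∀ k ∈ A, k ≠ 0) :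
    ∑ k ∈ A, Real.exp (-(2 * σ * l1 k)) * (1 / kdot k ξ ^ 2) ≤
      4 * zetaInt * Real.Gamma (2 * τ + 1) / (α * σ ^ τ) ^ 2 := by
  set a : ℝ := 2 * σ with ha
  have ha0 : 0 < a := by positivity
  have hint : IntegrableOn (fun t : ℝ => a * Real.exp (-a * t)) (Ioi 0) :=
    (integrableOn_exp_mul_Ioi (by linarith) 0).const_mul a
  -- Abel summation in integral form: the weight is written as an integral over `t > |k|`, so that
  -- for each `t` only the sum over `|k| < t` occurs. Integrating its bound against `a e^{-at}`
  -- gives the Gamma function.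
  have h1 : ∀ k : Fin n → ℤ, Real.exp (-(a * l1 k)) =
      ∫ t in Ioi (0 : ℝ), (Ioi (l1 k)).indicator (fun t => a * Real.exp (-a * t)) t := by
    intro k
    rw [setIntegral_indicator measurableSet_Ioi,
      inter_eq_self_of_subset_right (Ioi_subset_Ioi (l1_nonneg k)), integral_const_mul,
      integral_exp_mul_Ioi (by linarith)]
    field_simp
  have hi : ∀ k ∈ A, Integrable (fun t => (Ioi (l1 k)).indicator
      (fun t => a * Real.exp (-a * t)) t * (1 / kdot k ξ ^ 2)) (volume.restrict (Ioi 0)) :=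
    fun k _ => (hint.indicator measurableSet_Ioi).mul_const _
  simp only [h1, ← integral_mul_const]
  rw [← integral_finsetSum A hi]
  have hB : IntegrableOn (fun t : ℝ => t ^ (2 * τ + 1 - 1) * Real.exp (-(a * t))) (Ioi 0) := by
    simpa using integrableOn_rpow_mul_exp_neg_mul_rpow (s := 2 * τ + 1 - 1) (p := 1) (b := a)
      (by linarith) one_pos ha0
  have hle : ∀ t ∈ Ioi (0 : ℝ), ∑ k ∈ A, (Ioi (l1 k)).indicator
      (fun t => a * Real.exp (-a * t)) t * (1 / kdot k ξ ^ 2) ≤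
      (a * (4 * zetaInt * 2 ^ (2 * τ) / α ^ 2)) * (t ^ (2 * τ + 1 - 1) * Real.exp (-(a * t))) := by
    intro t ht
    have ht' : 0 < t := ht
    have h2 := sum_inv_sq_kdot_le hξ hα hτ ht' (A.filter fun k => l1 k < t) (fun k hk => by
      rw [Finset.mem_filter] at hk
      exact ⟨hA k hk.1, hk.2.le⟩)
    have h3 : ∑ k ∈ A, (Ioi (l1 k)).indicator (fun t => a * Real.exp (-a * t)) t *
        (1 / kdot k ξ ^ 2) =
        a * Real.exp (-a * t) * ∑ k ∈ A.filter fun k => l1 k < t, 1 / kdot k ξ ^ 2 := by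
      rw [Finset.mul_sum, Finset.sum_filter]
      refine Finset.sum_congr rfl fun k _ => ?_
      by_cases hk : l1 k < t
      · simp [hk]
      · simp [hk]
    rw [h3]
    refine (mul_le_mul_of_nonneg_left h2 (by positivity)).trans (le_of_eq ?_)
    rw [Real.mul_rpow (by norm_num) ht'.le, add_sub_cancel_right, neg_mul]
    ring
  refine (setIntegral_mono_on (integrable_finsetSum A hi) (hB.const_mul _) measurableSet_Ioi
    hle).trans (le_of_eq ?_)
  rw [integral_const_mul, Real.integral_rpow_mul_exp_neg_mul_Ioi (by linarith) ha0,
    Real.rpow_add_one (by positivity), ha, one_div, Real.inv_rpow (by positivity),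
    Real.mul_rpow (by norm_num) hσ.le, mul_pow, mul_comm 2 τ, Real.rpow_mul hσ.le, Real.rpow_two]
  have h2 : (2 : ℝ) ^ (τ * 2) ≠ 0 := by positivity
  have h3 : σ ^ τ ≠ 0 := by positivity
  field_simp

end SmallDivisors

/-! ### The homological equation -/

section Homological

open Complex

variable {n : ℕ}

/-- The complex frequency `⟨k, ω⟩`. -/
def cdot (k : Fin n → ℤ) (ω : CVec n) : ℂ := ∑ i, (k i : ℂ) * ω i

theorem isOpen_freqDom (S : Set (Fin n → ℝ)) (h : ℝ) : IsOpen (freqDom S h) := by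
  have : freqDom S h = ⋃ ξ ∈ S, {ω : CVec n | ‖ω - fun i => (ξ i : ℂ)‖ < h} := by
    ext ω; simp [freqDom]
  rw [this]
  exact isOpen_biUnion fun ξ _ => isOpen_lt (by fun_prop) continuous_const

theorem norm_cdot_le (k : Fin n → ℤ) (ω : CVec n) : ‖cdot k ω‖ ≤ l1 k * ‖ω‖ := by
  rw [cdot, l1, Finset.sum_mul]
  refine (norm_sum_le _ _).trans (Finset.sum_le_sum fun i _ => ?_)
  rw [norm_mul, Complex.norm_intCast]
  exact mul_le_mul_of_nonneg_left (norm_le_pi_norm ω i) (abs_nonneg _)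

theorem cdot_sub (k : Fin n → ℤ) (ω ω' : CVec n) : cdot k (ω - ω') = cdot k ω - cdot k ω' := by
  simp [cdot, mul_sub]

theorem cdot_ofReal (k : Fin n → ℤ) (ξ : Fin n → ℝ) :
    cdot k (fun i => (ξ i : ℂ)) = (kdot k ξ : ℂ) := by
  simp [cdot, kdot]

/-- For `|k| ≤ K` the complex perturbation changes `⟨k, ξ⟩` by at most `K h ≤ α / (2 K^τ)`, half of
the diophantine lower bound. -/
theorem half_le_norm_cdot {α τ K h : ℝ} {ξ : Fin n → ℝ} (hξ : IsDiophantine α τ ξ) (hα : 0 < α)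
    (hτ : 0 ≤ τ) (hK : 0 < K) (hh : h ≤ α / (2 * K ^ (τ + 1))) {k : Fin n → ℤ} (hk : k ≠ 0)
    (hkK : l1 k ≤ K) {ω : CVec n} (hω : ‖ω - fun i => (ξ i : ℂ)‖ < h) :
    0 < |kdot k ξ| ∧ |kdot k ξ| / 2 ≤ ‖cdot k ω‖ := by
  have h1 := hξ.le_abs_kdot hα hτ hk hkK
  have hp : 0 < α / K ^ τ := by positivity
  refine ⟨hp.trans_le h1, ?_⟩
  have h2 := norm_cdot_le k (ω - fun i => (ξ i : ℂ))
  rw [cdot_sub, cdot_ofReal] at h2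
  have h3 : l1 k * ‖ω - fun i => (ξ i : ℂ)‖ ≤ α / K ^ τ / 2 := by
    calc l1 k * ‖ω - fun i => (ξ i : ℂ)‖ ≤ K * (α / (2 * K ^ (τ + 1))) :=
          mul_le_mul hkK (hω.le.trans hh) (norm_nonneg _) hK.le
      _ = α / K ^ τ / 2 := by
          rw [Real.rpow_add_one hK.ne']
          field_simp
  have h4 := norm_sub_norm_le (kdot k ξ : ℂ) (cdot k ω)
  rw [Complex.norm_real, Real.norm_eq_abs, norm_sub_rev] at h4
  linarith

theorem finite_l1_le (K : ℝ) : {k : Fin n → ℤ | k ≠ 0 ∧ l1 k ≤ K}.Finite := by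
  refine ((Set.finite_Icc (fun _ : Fin n => -⌈K⌉) (fun _ => ⌈K⌉))).subset fun k hk => ?_
  have h1 : ∀ i, |(k i : ℝ)| ≤ (⌈K⌉ : ℝ) := fun i =>
    (Finset.single_le_sum (f := fun i => |(k i : ℝ)|) (fun _ _ => abs_nonneg _)
      (Finset.mem_univ i)).trans (hk.2.trans (Int.le_ceil K))
  refine ⟨fun i => ?_, fun i => ?_⟩
  · have := (abs_le.1 (h1 i)).1
    exact_mod_cast this
  · have := (abs_le.1 (h1 i)).2
    exact_mod_cast this

/-- The nonzero integer vectors of length at most `K`. -/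
def modes (n : ℕ) (K : ℝ) : Finset (Fin n → ℤ) := (finite_l1_le (n := n) K).toFinset

theorem mem_modes {K : ℝ} {k : Fin n → ℤ} : k ∈ modes n K ↔ k ≠ 0 ∧ l1 k ≤ K := by
  simp [modes]

/-- The solution of the homological equation, a trigonometric polynomial. -/
def homSol (f : CVec n × CVec n → ℂ) (K : ℝ) (p : CVec n × CVec n) : ℂ :=
  ∑ k ∈ modes n K, fcoeff (fun θ => f (θ, p.2)) k / (I * cdot k p.2) * expChar k p.1

/-- The mean value over the angles. -/
def angleMean (f : CVec n × CVec n → ℂ) (ω : CVec n) : ℂ := fcoeff (fun θ => f (θ, ω)) 0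

theorem hasDerivAt_expChar_line (k : Fin n → ℤ) (θ v : CVec n) :
    HasDerivAt (fun z : ℂ => expChar k (θ + z • v)) (I * cdot k v * expChar k θ) 0 := by
  have h1 : ∀ z : ℂ, expChar k (θ + z • v) = expChar k θ * Complex.exp (z * (I * cdot k v)) := by
    intro z
    rw [expChar_add]
    congr 1
    rw [expChar, cdot]
    congr 1
    rw [Finset.mul_sum, Finset.mul_sum, Finset.mul_sum]
    refine Finset.sum_congr rfl fun i _ => ?_
    simp only [Pi.smul_apply, smul_eq_mul]
    ring
  simp only [h1]
  have h2 := (((hasDerivAt_id (0 : ℂ)).mul_const (I * cdot k v)).cexp).const_mul (expChar k θ)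
  simp only [id, zero_mul, Complex.exp_zero, one_mul] at h2
  rw [mul_comm (I * cdot k v)]
  exact h2

theorem conj_expChar (k : Fin n → ℤ) {θ : CVec n} (hθ : IsRealVec θ) :
    (starRingEnd ℂ) (expChar k θ) = expChar (-k) θ := by
  rw [expChar, expChar, ← Complex.exp_conj]
  congr 1
  simp only [map_mul, Complex.conj_I, map_sum, Pi.neg_apply, Int.cast_neg, neg_mul,
    Finset.sum_neg_distrib, mul_neg]
  congr 2
  refine Finset.sum_congr rfl fun i _ => ?_
  rw [Complex.conj_eq_iff_im.2 (hθ i)]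
  congr 1
  exact map_intCast _ _

theorem conj_cdot (k : Fin n → ℤ) {ω : CVec n} (hω : IsRealVec ω) :
    (starRingEnd ℂ) (cdot k ω) = cdot k ω := by
  rw [cdot, map_sum]
  refine Finset.sum_congr rfl fun i _ => ?_
  rw [map_mul, Complex.conj_eq_iff_im.2 (hω i), map_intCast]

theorem cdot_neg (k : Fin n → ℤ) (ω : CVec n) : cdot (-k) ω = -cdot k ω := by
  simp [cdot]

/-- A constant in the estimates for the homological equation. -/
def homConst (n : ℕ) (τ : ℝ) : ℝ :=
  √(2 ^ n * (16 * zetaInt * Real.Gamma (2 * τ + 1))) + 10 ^ n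

theorem one_le_homConst (n : ℕ) (τ : ℝ) : 1 ≤ homConst n τ := by
  have : (1 : ℝ) ≤ 10 ^ n := one_le_pow₀ (by norm_num)
  have := Real.sqrt_nonneg (2 ^ n * (16 * zetaInt * Real.Gamma (2 * τ + 1)))
  unfold homConst
  linarith

/-- The assumptions for the homological equation: a function on a complex neighbourhood of the
torus, depending on frequencies which are close to diophantine ones. -/
structure HomData (n : ℕ) (α τ σ s K h M : ℝ) (S : Set (Fin n → ℝ))
    (f : CVec n × CVec n → ℂ) : Prop where
  α_pos : 0 < α
  τ_nonneg : 0 ≤ τ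
  σ_pos : 0 < σ
  σ_lt : 2 * σ < s
  one_le_K : 1 ≤ K
  one_le_Kσ : 1 ≤ K * σ
  h_le : h ≤ α / (2 * K ^ (τ + 1))
  dioph : ∀ ξ ∈ S, IsDiophantine α τ ξ
  diff : DifferentiableOn ℂ f (strip n s ×ˢ freqDom S h)
  periodic : ∀ ω ∈ freqDom S h, ∀ θ ∈ strip n s, ∀ k : Fin n → ℤ, f (θ + period k, ω) = f (θ, ω)
  real : ∀ ω ∈ freqDom S h, IsRealVec ω → ∀ θ : CVec n, IsRealVec θ → (f (θ, ω)).im = 0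
  bound : ∀ ω ∈ freqDom S h, ∀ θ ∈ strip n s, ‖f (θ, ω)‖ ≤ M

namespace HomData

variable {α τ σ s K h M : ℝ} {S : Set (Fin n → ℝ)} {f : CVec n × CVec n → ℂ}

theorem s_pos (H : HomData n α τ σ s K h M S f) : 0 < s := by linarith [H.σ_pos, H.σ_lt]

theorem isPeriodicHol (H : HomData n α τ σ s K h M S f) {ω : CVec n} (hω : ω ∈ freqDom S h) :
    IsPeriodicHol (fun θ => f (θ, ω)) s where
  diff := H.diff.comp (by fun_prop) fun θ hθ => ⟨hθ, hω⟩
  periodic θ hθ k := H.periodic ω hω θ hθ k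

theorem differentiableOn_fcoeff (H : HomData n α τ σ s K h M S f) (k : Fin n → ℤ) :
    DifferentiableOn ℂ (fun ω => fcoeff (fun θ => f (θ, ω)) k) (freqDom S h) :=
  KAM.differentiableOn_fcoeff H.s_pos (isOpen_freqDom S h) H.diff H.periodic k

theorem cdot_ne_zero (H : HomData n α τ σ s K h M S f) {ω : CVec n} (hω : ω ∈ freqDom S h)
    {k : Fin n → ℤ} (hk : k ∈ modes n K) : cdot k ω ≠ 0 := by
  obtain ⟨ξ, hξ, hd⟩ := hω
  rw [mem_modes] at hk
  have := half_le_norm_cdot (H.dioph ξ hξ) H.α_pos H.τ_nonneg (by linarith [H.one_le_K]) H.h_le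
    hk.1 hk.2 hd
  rw [← norm_pos_iff]
  linarith [this.1, this.2]

theorem differentiableOn_homSol (H : HomData n α τ σ s K h M S f) :
    DifferentiableOn ℂ (homSol f K) (univ ×ˢ freqDom S h) := by
  unfold homSol
  simp only [div_eq_mul_inv]
  refine DifferentiableOn.fun_sum fun k hk => ?_
  refine (DifferentiableOn.fun_mul ?_ (DifferentiableOn.fun_inv ?_ ?_)).fun_mul ?_
  · exact (H.differentiableOn_fcoeff k).comp differentiableOn_snd fun p hp => hp.2
  · unfold cdot
    fun_prop
  · exact fun p hp => mul_ne_zero Complex.I_ne_zero (H.cdot_ne_zero hp.2 hk)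
  · exact ((differentiable_expChar k).comp differentiable_fst).differentiableOn

/-- Differentiation along `ω` multiplies each exponential by `i⟨k, ω⟩`, which cancels the divisor.
Thus `homSol` solves the equation exactly for the truncated Fourier series without its mean. -/
theorem fderiv_homSol (H : HomData n α τ σ s K h M S f) {θ ω : CVec n} (hω : ω ∈ freqDom S h) :
    fderiv ℂ (homSol f K) (θ, ω) (ω, 0) =
      ∑ k ∈ modes n K, fcoeff (fun θ => f (θ, ω)) k * expChar k θ := by
  have hd := H.differentiableOn_homSol.differentiableAt
    ((isOpen_univ.prod (isOpen_freqDom S h)).mem_nhds (show (θ, ω) ∈ _ from ⟨trivial, hω⟩))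
  have h1 := hasDerivAt_comp_line (x := (θ, ω)) (v := ((ω, 0) : CVec n × CVec n)) (z := 0)
    (f := homSol f K) (by simpa using hd)
  rw [zero_smul, add_zero] at h1
  refine h1.unique ?_
  have h2 : (fun z : ℂ => homSol f K ((θ, ω) + z • ((ω, 0) : CVec n × CVec n))) = fun z =>
      ∑ k ∈ modes n K, fcoeff (fun θ => f (θ, ω)) k / (I * cdot k ω) * expChar k (θ + z • ω) := by
    ext z
    simp [homSol]
  rw [h2]
  refine HasDerivAt.fun_sum fun k hk => ?_
  have h3 := (hasDerivAt_expChar_line k θ ω).const_mul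
    (fcoeff (fun θ => f (θ, ω)) k / (I * cdot k ω))
  have h4 := H.cdot_ne_zero hω hk
  have h5 : fcoeff (fun θ => f (θ, ω)) k * expChar k θ =
      fcoeff (fun θ => f (θ, ω)) k / (I * cdot k ω) * (I * cdot k ω * expChar k θ) := by
    field_simp [Complex.I_ne_zero]
  rw [h5]
  exact h3

theorem homSol_periodic (f : CVec n × CVec n → ℂ) (K : ℝ) (θ ω : CVec n) (l : Fin n → ℤ) :
    homSol f K (θ + period l, ω) = homSol f K (θ, ω) := by
  simp only [homSol, expChar_add, expChar_period, mul_one]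

theorem conj_fcoeff (H : HomData n α τ σ s K h M S f) {ω : CVec n} (hω : ω ∈ freqDom S h)
    (hr : IsRealVec ω) (k : Fin n → ℤ) : (starRingEnd ℂ) (fcoeff (fun θ => f (θ, ω)) k) =
      fcoeff (fun θ => f (θ, ω)) (-k) :=
  KAM.conj_fcoeff (fun t => H.real ω hω hr _ fun i => angles_im t i) k

/-- Conjugation exchanges the terms of `k` and `-k`, and the set of retained modes is symmetric. -/
theorem homSol_real (H : HomData n α τ σ s K h M S f) {θ ω : CVec n} (hω : ω ∈ freqDom S h)
    (hr : IsRealVec ω) (hθ : IsRealVec θ) : (homSol f K (θ, ω)).im = 0 := by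
  rw [← Complex.conj_eq_iff_im]
  simp only [homSol, map_sum, map_mul, map_div₀, H.conj_fcoeff hω hr, conj_expChar _ hθ,
    conj_cdot _ hr, Complex.conj_I]
  refine Finset.sum_nbij' (fun k => -k) (fun k => -k) ?_ ?_ ?_ ?_ ?_
  · intro k hk
    rw [mem_modes] at *
    simpa [l1_neg] using hk
  · intro k hk
    rw [mem_modes] at *
    simpa [l1_neg] using hk
  · simp
  · simp
  · intro k _
    rw [cdot_neg, neg_mul, mul_neg]

theorem angleMean_real (H : HomData n α τ σ s K h M S f) {ω : CVec n} (hω : ω ∈ freqDom S h)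
    (hr : IsRealVec ω) : (angleMean f ω).im = 0 := by
  rw [← Complex.conj_eq_iff_im, angleMean, H.conj_fcoeff hω hr, neg_zero]

theorem norm_angleMean_le (H : HomData n α τ σ s K h M S f) {ω : CVec n} (hω : ω ∈ freqDom S h) :
    ‖angleMean f ω‖ ≤ M := by
  have h0 : ∀ t : Fin n → ℝ, angles t ∈ strip n s := fun t => by
    rw [mem_strip_iff H.s_pos]
    intro i
    simpa [angles_im] using H.s_pos
  have hP := H.isPeriodicHol hω
  have h1 := hP.continuous_torusLift_shift (z := 0) (by
    rw [mem_strip_iff H.s_pos]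
    exact fun i => by simpa using H.s_pos)
  simp only [add_zero] at h1
  exact norm_fcoeff_le h1 (fun t => H.bound ω hω _ (h0 t)) 0

theorem strip_bound {a : ℝ} {θ : CVec n} (hθ : θ ∈ strip n a) (i : Fin n) : |(θ i).im| ≤ a :=
  (norm_le_pi_norm (fun i => (θ i).im) i).trans (le_of_lt hθ)

/-- Cauchy's inequality separates coefficients from divisors: Bessel's inequality handles the first
factor and Rüssmann's bound the second. Estimating term by term would lose further powers of `σ`. -/
theorem norm_homSol_le (H : HomData n α τ σ s K h M S f) {θ ω : CVec n} (hω : ω ∈ freqDom S h)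
    (hθ : θ ∈ strip n (s - 2 * σ)) : ‖homSol f K (θ, ω)‖ ≤ homConst n τ * M / (α * σ ^ τ) := by
  have hσ := H.σ_pos
  have hα := H.α_pos
  have hM0 : 0 ≤ M := (norm_nonneg _).trans (H.norm_angleMean_le hω)
  obtain ⟨ξ, hξ, hd⟩ := id hω
  set c : (Fin n → ℤ) → ℂ := fcoeff (fun θ => f (θ, ω)) with hc
  -- Of the loss `2σ`, an amount `σ / 2` keeps the weight of `u` strictly inside the strip and `σ`
  -- damps the divisors in `v`.
  set u : (Fin n → ℤ) → ℝ := fun k => ‖c k‖ * Real.exp ((s - σ / 2) * l1 k) with hu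
  set v : (Fin n → ℤ) → ℝ := fun k => 2 / |kdot k ξ| * Real.exp (-(σ * l1 k)) with hv
  have hterm : ∀ k ∈ modes n K, ‖c k / (I * cdot k ω) * expChar k θ‖ ≤ u k * v k := by
    intro k hk
    rw [mem_modes] at hk
    have hkd := half_le_norm_cdot (H.dioph ξ hξ) hα H.τ_nonneg (by linarith [H.one_le_K]) H.h_le
      hk.1 hk.2 hd
    have h1 := norm_expChar_le k (strip_bound hθ)
    rw [norm_mul, norm_div, norm_mul, Complex.norm_I, one_mul]
    have h2 : 1 / ‖cdot k ω‖ ≤ 2 / |kdot k ξ| := by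
      rw [div_le_div_iff₀ (by linarith [hkd.1, hkd.2]) hkd.1]
      linarith [hkd.2]
    have h3 : Real.exp (l1 k * (s - 2 * σ)) ≤
        Real.exp ((s - σ / 2) * l1 k) * Real.exp (-(σ * l1 k)) := by
      rw [← Real.exp_add, Real.exp_le_exp]
      nlinarith [l1_nonneg k]
    calc ‖c k‖ / ‖cdot k ω‖ * ‖expChar k θ‖ = ‖c k‖ * (1 / ‖cdot k ω‖) * ‖expChar k θ‖ := by ring
      _ ≤ ‖c k‖ * (2 / |kdot k ξ|) *
          (Real.exp ((s - σ / 2) * l1 k) * Real.exp (-(σ * l1 k))) := by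
          gcongr
          exact h1.trans h3
      _ = u k * v k := by simp only [hu, hv]; ring
  have hX : ∑ k ∈ modes n K, u k ^ 2 ≤ 2 ^ n * M ^ 2 := by
    have h1 := (H.isPeriodicHol hω).sum_sq_fcoeff_exp_le (fun θ hθ => H.bound ω hω θ hθ)
      (s' := s - σ / 2) (by linarith [H.σ_lt]) (by linarith) (modes n K)
    refine le_trans (le_of_eq (Finset.sum_congr rfl fun k _ => ?_)) h1
    simp only [hu]
    rw [mul_pow, ← Real.exp_nat_mul]
    congr 2
    push_cast
    ring
  have hY : ∑ k ∈ modes n K, v k ^ 2 ≤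
      16 * zetaInt * Real.Gamma (2 * τ + 1) / (α * σ ^ τ) ^ 2 := by
    have h1 := sum_exp_div_sq_kdot_le (H.dioph ξ hξ) hα H.τ_nonneg hσ (modes n K)
      fun k hk => (mem_modes.1 hk).1
    calc ∑ k ∈ modes n K, v k ^ 2
        = 4 * ∑ k ∈ modes n K, Real.exp (-(2 * σ * l1 k)) * (1 / kdot k ξ ^ 2) := by
          rw [Finset.mul_sum]
          refine Finset.sum_congr rfl fun k _ => ?_
          simp only [hv]
          rw [mul_pow, ← Real.exp_nat_mul, div_pow, sq_abs]
          push_cast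
          have : (2 : ℝ) * -(σ * l1 k) = -(2 * σ * l1 k) := by ring
          rw [this]
          ring
      _ ≤ 4 * (4 * zetaInt * Real.Gamma (2 * τ + 1) / (α * σ ^ τ) ^ 2) := by gcongr
      _ = _ := by ring
  have hG : 0 ≤ 16 * zetaInt * Real.Gamma (2 * τ + 1) :=
    mul_nonneg (mul_nonneg (by norm_num) zetaInt_nonneg)
      (Real.Gamma_pos_of_pos (by linarith [H.τ_nonneg])).le
  calc ‖homSol f K (θ, ω)‖ ≤ ∑ k ∈ modes n K, u k * v k :=
        (norm_sum_le _ _).trans (Finset.sum_le_sum hterm)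
    _ ≤ √(∑ k ∈ modes n K, u k ^ 2) * √(∑ k ∈ modes n K, v k ^ 2) :=
        Real.sum_mul_le_sqrt_mul_sqrt _ _ _
    _ ≤ √(2 ^ n * M ^ 2) * √(16 * zetaInt * Real.Gamma (2 * τ + 1) / (α * σ ^ τ) ^ 2) := by
        gcongr
    _ = √(2 ^ n * (16 * zetaInt * Real.Gamma (2 * τ + 1))) * M / (α * σ ^ τ) := by
        have h2n : (0 : ℝ) ≤ 2 ^ n := by positivity
        have hp : 0 ≤ α * σ ^ τ := by positivity
        rw [Real.sqrt_mul h2n (M ^ 2), Real.sqrt_sq hM0, Real.sqrt_div hG, Real.sqrt_sq hp,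
          Real.sqrt_mul h2n]
        ring
    _ ≤ homConst n τ * M / (α * σ ^ τ) := by
        unfold homConst
        gcongr
        exact le_add_of_nonneg_right (by positivity)

/-- The homological equation holds up to an exponentially small truncation error. -/
theorem norm_homological_error_le (H : HomData n α τ σ s K h M S f) {θ ω : CVec n}
    (hω : ω ∈ freqDom S h) (hθ : θ ∈ strip n (s - 2 * σ)) :
    ‖f (θ, ω) - angleMean f ω - fderiv ℂ (homSol f K) (θ, ω) (ω, 0)‖ ≤
      homConst n τ * (K ^ n * Real.exp (-(K * σ))) * M := by
  classical
  have hσ := H.σ_pos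
  have hK := H.one_le_K
  have hM0 : 0 ≤ M := (norm_nonneg _).trans (H.norm_angleMean_le hω)
  have hP := H.isPeriodicHol hω
  have hb : ∀ θ ∈ strip n s, ‖f (θ, ω)‖ ≤ M := fun θ hθ => H.bound ω hω θ hθ
  set c : (Fin n → ℤ) → ℂ := fcoeff (fun θ => f (θ, ω)) with hc
  -- The mean and the retained modes together; subtracting them from the Fourier series leaves
  -- exactly the modes with `|k| > K`.
  set G : Finset (Fin n → ℤ) := insert 0 (modes n K) with hG
  have h1 : HasSum (fun k => c k * expChar k θ) (f (θ, ω)) :=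
    hP.hasSum_fcoeff hb (strip_mono (by linarith) hθ)
  have h2 : HasSum (fun k => if k ∈ G then c k * expChar k θ else 0)
      (∑ k ∈ G, c k * expChar k θ) := by
    have : HasSum (fun k => if k ∈ G then c k * expChar k θ else 0)
        (∑ k ∈ G, if k ∈ G then c k * expChar k θ else 0) :=
      hasSum_sum_of_ne_finset_zero fun k hk => if_neg hk
    rwa [Finset.sum_congr rfl fun k hk => if_pos hk] at this
  have h3 : ∑ k ∈ G, c k * expChar k θ =
      angleMean f ω + fderiv ℂ (homSol f K) (θ, ω) (ω, 0) := by
    rw [hG, Finset.sum_insert (by simp [mem_modes]), H.fderiv_homSol hω]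
    congr 1
    simp [expChar, angleMean, hc]
  have h4 := h1.sub h2
  rw [h3, ← sub_sub] at h4
  -- For `|k| > K` the decay `e^{-3σ|k|/2}` splits into the gain `e^{-Kσ}` and a summable factor
  -- `e^{-σ|k|/2}`. The sum of the latter is at most `(1 + 4/σ)^n ≤ (5K)^n`, as `Kσ ≥ 1`; this
  -- produces `K^n` and the summand `10^n` of `homConst`.
  set B : ℝ := 2 ^ n * M * Real.exp (-(K * σ)) with hB
  have hs : Summable fun k : Fin n → ℤ => Real.exp (-(σ / 2 * l1 k)) :=
    summable_exp_l1 (by linarith)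
  have h5 := h4.norm_le_of_bounded (hs.hasSum.mul_left B) fun k => ?_
  · have h6 : ∑' k : Fin n → ℤ, Real.exp (-(σ / 2 * l1 k)) ≤ (5 * K) ^ n := by
      refine (hs.tsum_le_of_sum_le fun A => sum_exp_l1_le (by linarith) A).trans ?_
      gcongr
      have : 2 / (σ / 2) ≤ 4 * K := by
        rw [div_le_iff₀ (by linarith)]
        nlinarith [H.one_le_Kσ]
      linarith
    calc _ ≤ B * (5 * K) ^ n := h5.trans (by gcongr)
      _ = 10 ^ n * (K ^ n * Real.exp (-(K * σ))) * M := by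
        rw [hB, mul_pow, show (10 : ℝ) = 2 * 5 by norm_num, mul_pow]
        ring
      _ ≤ _ := by
        unfold homConst
        gcongr
        exact le_add_of_nonneg_left (Real.sqrt_nonneg _)
  · by_cases hk : k ∈ G
    · simp only [hk, if_true, sub_self, norm_zero]
      positivity
    · simp only [hk, if_false, sub_zero, norm_mul]
      have hkK : K < l1 k := by
        simp only [hG, Finset.mem_insert, mem_modes, not_or, not_and, not_le] at hk
        exact hk.2 hk.1
      have e1 := norm_expChar_le k (strip_bound hθ)
      have e2 := hP.norm_fcoeff_exp_le hb (s' := s - σ / 2) (by linarith [H.σ_lt]) (by linarith) k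
      calc ‖c k‖ * ‖expChar k θ‖
          ≤ 2 ^ n * M * Real.exp (-((s - σ / 2) * l1 k)) * Real.exp (l1 k * (s - 2 * σ)) := by
            gcongr
        _ = 2 ^ n * M * Real.exp (-(3 / 2 * σ * l1 k)) := by
            rw [mul_assoc, ← Real.exp_add]
            congr 2
            ring
        _ ≤ 2 ^ n * M * Real.exp (-(K * σ) + -(σ / 2 * l1 k)) := by
            gcongr
            nlinarith
        _ = B * Real.exp (-(σ / 2 * l1 k)) := by
            rw [Real.exp_add, hB]
            ring

end HomData

end Homological

/-! ### Fixed points depending on parameters -/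

section FixedPoint

open Filter Topology

universe u

variable {X Y : Type u} [NormedAddCommGroup X] [NormedSpace ℂ X] [FiniteDimensional ℂ X]
  [NormedAddCommGroup Y] [NormedSpace ℂ Y] [FiniteDimensional ℂ Y]

theorem isInvertible_of_injective {L : Y →L[ℂ] Y} (h : Function.Injective L) : L.IsInvertible := by
  let e := (LinearEquiv.ofInjectiveEndo (L : Y →ₗ[ℂ] Y) h).toContinuousLinearEquiv
  refine ⟨e, ?_⟩
  ext v
  rfl

/-- Solutions of `y = T (x, y)` for a contraction `T` depending holomorphically on parameters. -/
theorem exists_differentiableOn_fixedPoint {T : X × Y → Y} {U : Set X} {W : Set (X × Y)} {ρ : ℝ}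
    (hU : IsOpen U) (hW : IsOpen W) (hT : DifferentiableOn ℂ T W)
    (hρ : 0 ≤ ρ) (hUW : U ×ˢ Metric.closedBall 0 ρ ⊆ W)
    (hmaps : ∀ x ∈ U, ∀ y ∈ Metric.closedBall (0 : Y) ρ, ‖T (x, y)‖ ≤ ρ)
    (hcontr : ∀ x ∈ U, ∀ y ∈ Metric.closedBall (0 : Y) ρ, ∀ v : Y,
      ‖fderiv ℂ T (x, y) (0, v)‖ ≤ 1 / 2 * ‖v‖) :
    ∃ g : X → Y, DifferentiableOn ℂ g U ∧
      (∀ x ∈ U, ‖g x‖ ≤ ρ ∧ g x = T (x, g x)) ∧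
      (∀ x ∈ U, ∀ y, ‖y‖ ≤ ρ → y = T (x, y) → y = g x) ∧
      ∀ x ∈ U, ∀ C : Set Y, IsClosed C → 0 ∈ C → (∀ y ∈ C, ‖y‖ ≤ ρ → T (x, y) ∈ C) → g x ∈ C := by
  have hXc : CompleteSpace X := FiniteDimensional.complete ℂ X
  have hYc : CompleteSpace Y := FiniteDimensional.complete ℂ Y
  have hLip : ∀ x ∈ U, ∀ y ∈ Metric.closedBall (0 : Y) ρ, ∀ y' ∈ Metric.closedBall (0 : Y) ρ,
      ‖T (x, y') - T (x, y)‖ ≤ 1 / 2 * ‖y' - y‖ := by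
    intro x hx y hy y' hy'
    have hseg : ∀ t ∈ Icc (0 : ℝ) 1, y + (t : ℂ) • (y' - y) ∈ Metric.closedBall (0 : Y) ρ := by
      intro t ht
      have := (convex_closedBall (0 : Y) ρ).add_smul_sub_mem hy hy' ht
      rwa [← Complex.coe_smul] at this
    have h1 := norm_sub_le_of_fderiv_segment (f := T) (x := (x, y)) (v := ((0, y' - y) : X × Y))
      (C := 1 / 2 * ‖y' - y‖)
      (fun t ht => hT.differentiableAt (hW.mem_nhds (by
        simpa using hUW ⟨hx, hseg t ht⟩)))
      (fun t ht => by
        simpa using hcontr x hx _ (hseg t ht) (y' - y))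
    simpa using h1
  -- Running the contraction inside a closed invariant set places the fixed point there. With `C`
  -- the set of real vectors this later yields reality of the solutions.
  have hexC : ∀ x ∈ U, ∀ C : Set Y, IsClosed C → 0 ∈ C → (∀ y ∈ C, ‖y‖ ≤ ρ → T (x, y) ∈ C) →
      ∃ y ∈ C, ‖y‖ ≤ ρ ∧ y = T (x, y) := by
    intro x hx C hCc hC0 hCm
    have hm : MapsTo (fun y => T (x, y)) (Metric.closedBall (0 : Y) ρ ∩ C)
        (Metric.closedBall 0 ρ ∩ C) := fun y hy =>
      ⟨by simpa using hmaps x hx y hy.1, hCm y hy.2 (by simpa using hy.1)⟩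
    have hc : ContractingWith (1 / 2) (hm.restrict _ _ _) := by
      refine ⟨by norm_num, LipschitzWith.of_dist_le_mul fun a b => ?_⟩
      have := hLip x hx b.1 b.2.1 a.1 a.2.1
      simpa [Subtype.dist_eq, dist_eq_norm] using this
    obtain ⟨y, hy, hfix, -⟩ := hc.exists_fixedPoint'
      (Metric.isClosed_closedBall.inter hCc).isComplete hm
      ⟨Metric.mem_closedBall_self hρ, hC0⟩ (edist_ne_top _ _)
    exact ⟨y, hy.2, by simpa using hy.1, hfix.symm⟩
  have hex : ∀ x ∈ U, ∃ y, ‖y‖ ≤ ρ ∧ y = T (x, y) := fun x hx => by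
    obtain ⟨y, -, hy⟩ := hexC x hx univ isClosed_univ trivial fun _ _ _ => trivial
    exact ⟨y, hy⟩
  choose! g hg using hex
  have huniq : ∀ x ∈ U, ∀ y, ‖y‖ ≤ ρ → y = T (x, y) → y = g x := by
    intro x hx y hy hfix
    have h1 := hLip x hx (g x) (by simpa using (hg x hx).1) y (by simpa using hy)
    rw [← hfix, ← (hg x hx).2] at h1
    have : ‖y - g x‖ ≤ 0 := by linarith
    exact sub_eq_zero.1 (norm_le_zero_iff.1 this)
  refine ⟨g, ?_, hg, huniq, fun x hx C hCc hC0 hCm => ?_⟩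
  swap
  · obtain ⟨y, hyC, hy1, hy2⟩ := hexC x hx C hCc hC0 hCm
    rwa [← huniq x hx y hy1 hy2]
  intro x₀ hx₀
  set y₀ := g x₀ with hy₀
  have hmem₀ : (x₀, y₀) ∈ W := hUW ⟨hx₀, by simpa using (hg x₀ hx₀).1⟩
  have hcont : Tendsto g (𝓝 x₀) (𝓝 y₀) := by
    have h1 : ∀ᶠ x in 𝓝 x₀, ‖g x - y₀‖ ≤ 2 * ‖T (x, y₀) - T (x₀, y₀)‖ := by
      filter_upwards [hU.mem_nhds hx₀] with x hx
      have h2 := hLip x hx y₀ (by simpa using (hg x₀ hx₀).1) (g x) (by simpa using (hg x hx).1)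
      have h3 : g x - y₀ = (T (x, g x) - T (x, y₀)) + (T (x, y₀) - T (x₀, y₀)) := by
        rw [← (hg x hx).2, ← (hg x₀ hx₀).2]; abel
      have h4 := norm_add_le (T (x, g x) - T (x, y₀)) (T (x, y₀) - T (x₀, y₀))
      rw [← h3] at h4
      linarith
    have h5 : ContinuousAt (fun x => T (x, y₀)) x₀ :=
      ContinuousAt.comp (f := fun x => (x, y₀)) (g := T)
        (hT.differentiableAt (hW.mem_nhds hmem₀)).continuousAt (by fun_prop)
    have h6 : Tendsto (fun x => 2 * ‖T (x, y₀) - T (x₀, y₀)‖) (𝓝 x₀) (𝓝 0) := by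
      have := ((h5.tendsto.sub_const (T (x₀, y₀))).norm).const_mul 2
      simpa using this
    rw [tendsto_iff_norm_sub_tendsto_zero]
    exact squeeze_zero' (Eventually.of_forall fun _ => norm_nonneg _) h1 h6
  -- Contraction makes the `y`-derivative of `y - T (x, y)` injective, hence invertible. The
  -- implicit function theorem then gives a differentiable solution, which agrees with `g` near `x₀`
  -- because `g` is continuous there.
  have hstr : HasStrictFDerivAt (fun p : X × Y => p.2 - T p)
      (ContinuousLinearMap.snd ℂ X Y - fderiv ℂ T (x₀, y₀)) (x₀, y₀) :=
    hasStrictFDerivAt_snd.sub (analyticOnNhd_of_differentiableOn hW hT _ hmem₀).hasStrictFDerivAt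
  have hinv : ((ContinuousLinearMap.snd ℂ X Y - fderiv ℂ T (x₀, y₀)).comp
      (ContinuousLinearMap.inr ℂ X Y)).IsInvertible := by
    refine isInvertible_of_injective ((injective_iff_map_eq_zero _).2 fun v hv => ?_)
    have h1 : v = fderiv ℂ T (x₀, y₀) (0, v) := by
      simpa [sub_eq_zero] using hv
    have h2 := hcontr x₀ hx₀ y₀ (by simpa using (hg x₀ hx₀).1) v
    rw [← h1] at h2
    exact norm_le_zero_iff.1 (by linarith)
  have hev := hstr.eventually_apply_eq_iff_implicitFunctionOfProdDomain hinv
  have hlim : Tendsto (fun x => (x, g x)) (𝓝 x₀) (𝓝 (x₀, y₀)) := by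
    rw [nhds_prod_eq]
    exact tendsto_id.prodMk hcont
  have heq : g =ᶠ[𝓝 x₀] hstr.implicitFunctionOfProdDomain hinv := by
    filter_upwards [hlim.eventually hev, hU.mem_nhds hx₀] with x hx hxU
    refine (hx.1 ?_).symm
    rw [sub_eq_zero.2 (hg x hxU).2, sub_eq_zero.2 (hg x₀ hx₀).2]
  exact ((hstr.hasStrictFDerivAt_implicitFunctionOfProdDomain
    hinv).hasFDerivAt.differentiableAt.congr_of_eventuallyEq heq).differentiableWithinAt

end FixedPoint

/-! ### Symplectic maps from generating functions -/

section Symplectic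

open Filter Topology

variable {n : ℕ}

theorem ite_eq_single (i : Fin n) :
    (fun j => if i = j then (1 : ℂ) else 0) = Pi.single i 1 := by
  ext j
  simp [Pi.single_apply, eq_comm]

theorem apply_inr_eq_sum (L : Phase n →L[ℂ] ℂ) (c : CVec n) :
    L (0, c) = ∑ i, c i * L (0, Pi.single i 1) := by
  have := LinearMap.pi_apply_eq_sum_univ
    ((L.comp (ContinuousLinearMap.inr ℂ (CVec n) (CVec n))) : CVec n →ₗ[ℂ] ℂ) c
  simpa [ite_eq_single] using this

theorem apply_inl_eq_sum (L : Phase n →L[ℂ] ℂ) (c : CVec n) :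
    L (c, 0) = ∑ i, c i * L (Pi.single i 1, 0) := by
  have := LinearMap.pi_apply_eq_sum_univ
    ((L.comp (ContinuousLinearMap.inl ℂ (CVec n) (CVec n))) : CVec n →ₗ[ℂ] ℂ) c
  simpa [ite_eq_single] using this

/-- A map given by a generating function `S` in mixed variables is symplectic. -/
theorem sympForm_of_generating {S : Phase n → ℂ} {Φ : Phase n → Phase n} {z : Phase n}
    (hΦ : DifferentiableAt ℂ Φ z) (hS : AnalyticAt ℂ S (z.1, (Φ z).2))
    (hU : ∀ᶠ w in 𝓝 z, ∀ i, (Φ w).1 i =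
      w.1 i + fderiv ℂ S (w.1, (Φ w).2) (0, Pi.single i 1))
    (hV : ∀ᶠ w in 𝓝 z, ∀ i, w.2 i =
      (Φ w).2 i + fderiv ℂ S (w.1, (Φ w).2) (Pi.single i 1, 0)) (u v : Phase n) :
    sympForm (fderiv ℂ Φ z u) (fderiv ℂ Φ z v) = sympForm u v := by
  set Φ' := fderiv ℂ Φ z with hΦ'
  have hΦd : HasFDerivAt Φ Φ' z := hΦ.hasFDerivAt
  set B := fderiv ℂ (fderiv ℂ S) (z.1, (Φ z).2) with hB
  set X' : Phase n →L[ℂ] Phase n := (ContinuousLinearMap.fst ℂ (CVec n) (CVec n)).prod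
    ((ContinuousLinearMap.snd ℂ (CVec n) (CVec n)).comp Φ') with hX'
  have hX : HasFDerivAt (fun w : Phase n => (w.1, (Φ w).2)) X' z :=
    hasFDerivAt_fst.prodMk hΦd.snd
  have hBX : ∀ a : Phase n, HasFDerivAt (fun w : Phase n => fderiv ℂ S (w.1, (Φ w).2) a)
      ((ContinuousLinearMap.apply ℂ ℂ a).comp (B.comp X')) z := fun a =>
    (ContinuousLinearMap.apply ℂ ℂ a).hasFDerivAt.comp z
      (hS.fderiv.differentiableAt.hasFDerivAt.comp z hX)
  have hsymm : ∀ a b, B a b = B b a := by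
    have : IsSymmSndFDerivAt ℂ S (z.1, (Φ z).2) :=
      (hS.contDiffAt (n := 2)).isSymmSndFDerivAt (by simp)
    exact fun a b => this.eq a b
  have hfst : ∀ (w : Phase n) i, HasFDerivAt (fun w : Phase n => w.1 i)
      ((ContinuousLinearMap.proj i).comp (ContinuousLinearMap.fst ℂ (CVec n) (CVec n))) w :=
    fun w i => ((ContinuousLinearMap.proj i).comp
      (ContinuousLinearMap.fst ℂ (CVec n) (CVec n))).hasFDerivAt
  have hsnd : ∀ (w : Phase n) i, HasFDerivAt (fun w : Phase n => w.2 i)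
      ((ContinuousLinearMap.proj i).comp (ContinuousLinearMap.snd ℂ (CVec n) (CVec n))) w :=
    fun w i => ((ContinuousLinearMap.proj i).comp
      (ContinuousLinearMap.snd ℂ (CVec n) (CVec n))).hasFDerivAt
  have hU' : ∀ a i, (Φ' a).1 i = a.1 i + B (X' a) (0, Pi.single i 1) := by
    intro a i
    have h1 := (hfst (Φ z) i).comp z hΦd
    have h2 := ((hfst z i).add (hBX (0, Pi.single i 1))).congr_of_eventuallyEq
      (hU.mono fun w hw => hw i)
    have := congrArg (fun L : Phase n →L[ℂ] ℂ => L a) (h1.unique h2)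
    simpa using this
  have hV' : ∀ a i, (Φ' a).2 i = a.2 i - B (X' a) (Pi.single i 1, 0) := by
    intro a i
    have h1 := (((hsnd (Φ z) i).comp z hΦd).add
      (hBX (Pi.single i 1, 0))).congr_of_eventuallyEq (hV.mono fun w hw => hw i)
    have := congrArg (fun L : Phase n →L[ℂ] ℂ => L a) ((hsnd z i).unique h1)
    rw [eq_sub_iff_add_eq]
    simpa using this.symm
  have hXa : ∀ a, X' a = (a.1, 0) + (0, (Φ' a).2) := by
    intro a
    simp [hX']
  -- After antisymmetrising in `a` and `b`, the Hessian terms combine to `B (X' a) (X' b) - B (X' b)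
  -- (X' a)`, which vanishes by symmetry.
  have key : ∀ a b : Phase n, ∑ i, (Φ' a).1 i * (Φ' b).2 i =
      ∑ i, a.1 i * b.2 i - B (X' b) (a.1, 0) + B (X' a) (0, (Φ' b).2) := by
    intro a b
    rw [apply_inl_eq_sum, apply_inr_eq_sum, ← Finset.sum_sub_distrib, ← Finset.sum_add_distrib]
    refine Finset.sum_congr rfl fun i _ => ?_
    rw [hU' a i, add_mul, mul_comm (B (X' a) _)]
    congr 1
    rw [hV' b i]
    ring
  simp only [sympForm, Finset.sum_sub_distrib]
  rw [key u v, key v u]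
  have h1 := hsymm (X' u) (X' v)
  conv_lhs at h1 => rw [hXa v, map_add]
  conv_rhs at h1 => rw [hXa u, map_add]
  linear_combination h1

end Symplectic

/-! ### The linearized problem of one KAM step -/

section Derivatives

open Filter Topology

variable {E F : Type*} [NormedAddCommGroup E] [NormedSpace ℂ E]
  [NormedAddCommGroup F] [NormedSpace ℂ F]

theorem fderiv_eq_of_eventually_periodic {f : E → F} {x a : E}
    (h : ∀ᶠ y in 𝓝 x, f (y + a) = f y) : fderiv ℂ f (x + a) = fderiv ℂ f x := by
  rw [← fderiv_comp_add_right]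
  exact EventuallyEq.fderiv_eq h

theorem im_fderiv_eq_zero {f : E → ℂ} {x v : E} (hd : DifferentiableAt ℂ f x)
    (h : ∀ᶠ t : ℝ in 𝓝 0, (f (x + (t : ℂ) • v)).im = 0) : (fderiv ℂ f x v).im = 0 := by
  have h1 : HasDerivAt (fun t : ℝ => f (x + (t : ℂ) • v)) (fderiv ℂ f x v) 0 := by
    have := hasDerivAt_comp_line (f := f) (x := x) (v := v) (z := ((0 : ℝ) : ℂ)) (by simpa using hd)
    have := hasDerivAt_comp_ofReal' this
    simpa using this
  have h2 := Complex.imCLM.hasFDerivAt.comp_hasDerivAt (0 : ℝ) h1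
  have h3 : HasDerivAt (fun t : ℝ => (f (x + (t : ℂ) • v)).im) 0 0 :=
    (hasDerivAt_const (0 : ℝ) (0 : ℝ)).congr_of_eventuallyEq h
  exact h2.unique h3

end Derivatives

/-! ### The affine part of the perturbation in the actions -/

section Step

open Filter Topology

variable {n : ℕ}

/-- The restriction to the torus `I = 0`. -/
def torusPart (P : Ext n → ℂ) (p : CVec n × CVec n) : ℂ := P ((0, p.1), p.2)

/-- The derivative with respect to `I_i` on the torus `I = 0`. -/
def actionPart (P : Ext n → ℂ) (i : Fin n) (p : CVec n × CVec n) : ℂ :=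
  fderiv ℂ P ((0, p.1), p.2) ((Pi.single i 1, 0), 0)

/-- The assumptions of one KAM step. -/
structure StepData (n : ℕ) (α τ r s σ K h η ε : ℝ) (S : Set (Fin n → ℝ)) (P : Ext n → ℂ) :
    Prop where
  n_pos : 0 < n
  α_pos : 0 < α
  τ_nonneg : 0 ≤ τ
  r_pos : 0 < r
  σ_pos : 0 < σ
  σ_lt : 5 * σ < s
  one_le_K : 1 ≤ K
  one_le_Kσ : 1 ≤ K * σ
  h_pos : 0 < h
  h_le : h ≤ α / (2 * K ^ (τ + 1))
  ε_pos : 0 < ε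
  η_pos : 0 < η
  η_le : η ≤ 1 / 8
  dioph : ∀ ξ ∈ S, IsDiophantine α τ ξ
  realAnalytic : IsRealAnalytic P (phaseDom n r s ×ˢ freqDom S h)
  bound : ∀ x ∈ phaseDom n r s ×ˢ freqDom S h, ‖P x‖ ≤ ε
  small₁ : n * homConst n τ * (ε / (α * r * σ ^ (τ + 1))) ≤ 1 / 32
  small₂ : n * homConst n τ * (ε / (r * h)) ≤ 1 / 32

theorem isOpen_phaseDom (r s : ℝ) : IsOpen (phaseDom n r s) := by
  have h1 : IsOpen {z : Phase n | ‖z.1‖ < r} := isOpen_lt (by fun_prop) continuous_const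
  exact h1.inter ((isOpen_strip s).preimage continuous_snd)

theorem shift_eq (k : Fin n → ℤ) (x : Ext n) : shift k x = x + ((0, period k), 0) := by
  refine Prod.ext (Prod.ext ?_ ?_) ?_
  · simp [shift]
  · ext i; simp [shift, period]
  · simp [shift]

namespace StepData

variable {α τ r s σ K h η ε : ℝ} {S : Set (Fin n → ℝ)} {P : Ext n → ℂ}

theorem isOpen_dom (_H : StepData n α τ r s σ K h η ε S P) :
    IsOpen (phaseDom n r s ×ˢ freqDom S h) :=
  (isOpen_phaseDom r s).prod (isOpen_freqDom S h)

theorem zero_mem (H : StepData n α τ r s σ K h η ε S P) {θ ω : CVec n} (hθ : θ ∈ strip n s)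
    (hω : ω ∈ freqDom S h) : (((0, θ), ω) : Ext n) ∈ phaseDom n r s ×ˢ freqDom S h :=
  ⟨⟨by simpa using H.r_pos, hθ⟩, hω⟩

theorem homData_torusPart (H : StepData n α τ r s σ K h η ε S P) :
    HomData n α τ σ s K h ε S (torusPart P) where
  α_pos := H.α_pos
  τ_nonneg := H.τ_nonneg
  σ_pos := H.σ_pos
  σ_lt := by linarith [H.σ_pos, H.σ_lt]
  one_le_K := H.one_le_K
  one_le_Kσ := H.one_le_Kσ
  h_le := H.h_le
  dioph := H.dioph
  diff := by
    refine DifferentiableOn.comp (g := P) H.realAnalytic.analytic.differentiableOn ?_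
      fun p hp => H.zero_mem hp.1 hp.2
    fun_prop
  periodic ω hω θ hθ k := H.realAnalytic.periodic _ (H.zero_mem hθ hω) k
  real ω hω hr θ hθ := by
    by_cases hs : θ ∈ strip n s
    · exact H.realAnalytic.real _ (H.zero_mem hs hω) ⟨fun i => by simp, hθ, hr⟩
    · refine absurd ?_ hs
      rw [mem_strip_iff (by linarith [H.σ_pos, H.σ_lt])]
      intro i
      rw [hθ i, abs_zero]
      linarith [H.σ_pos, H.σ_lt]
  bound ω hω θ hθ := H.bound _ (H.zero_mem hθ hω)

theorem real_mem_strip {a : ℝ} (ha : 0 < a) {θ : CVec n} (hθ : IsRealVec θ) : θ ∈ strip n a := by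
  rw [mem_strip_iff ha]
  intro i
  rwa [hθ i, abs_zero]

theorem isRealVec_add_smul {a b : CVec n} (ha : IsRealVec a) (hb : IsRealVec b) (t : ℝ) :
    IsRealVec (a + (t : ℂ) • b) := fun i => by
  simp [ha i, hb i]

theorem isRealVec_single (i : Fin n) : IsRealVec (Pi.single i 1 : CVec n) := fun j => by
  rcases eq_or_ne j i with rfl | hj
  · simp
  · simp [hj]

theorem isRealVec_zero : IsRealVec (0 : CVec n) := fun _ => rfl

theorem im_fderiv_apply_eq_zero (H : StepData n α τ r s σ K h η ε S P) {x : Ext n}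
    (hx : x ∈ phaseDom n r s ×ˢ freqDom S h) (hr : IsRealPt x) {v : Ext n} (hv : IsRealPt v) :
    (fderiv ℂ P x v).im = 0 := by
  refine im_fderiv_eq_zero (H.realAnalytic.analytic x hx).differentiableAt ?_
  have hc : ContinuousAt (fun t : ℝ => x + (t : ℂ) • v) 0 := by fun_prop
  have h1 : ∀ᶠ t : ℝ in 𝓝 0, x + (t : ℂ) • v ∈ phaseDom n r s ×ˢ freqDom S h :=
    hc.preimage_mem_nhds (by
      rw [Complex.ofReal_zero, zero_smul, add_zero]
      exact H.isOpen_dom.mem_nhds hx)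
  filter_upwards [h1] with t ht
  exact H.realAnalytic.real _ ht ⟨isRealVec_add_smul hr.1 hv.1 t,
    isRealVec_add_smul hr.2.1 hv.2.1 t, isRealVec_add_smul hr.2.2 hv.2.2 t⟩

theorem homData_actionPart (H : StepData n α τ r s σ K h η ε S P) (i : Fin n) :
    HomData n α τ σ s K h (ε / r) S (actionPart P i) where
  α_pos := H.α_pos
  τ_nonneg := H.τ_nonneg
  σ_pos := H.σ_pos
  σ_lt := by linarith [H.σ_pos, H.σ_lt]
  one_le_K := H.one_le_K
  one_le_Kσ := H.one_le_Kσ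
  h_le := H.h_le
  dioph := H.dioph
  diff := by
    have h1 : DifferentiableOn ℂ (fun p : CVec n × CVec n => fderiv ℂ P ((0, p.1), p.2))
        (strip n s ×ˢ freqDom S h) := by
      refine DifferentiableOn.comp (g := fderiv ℂ P) H.realAnalytic.analytic.fderiv.differentiableOn
        ?_ fun p hp => H.zero_mem hp.1 hp.2
      fun_prop
    exact h1.clm_apply (differentiableOn_const _)
  periodic ω hω θ hθ k := by
    have h1 : (((0, θ + period k), ω) : Ext n) = ((0, θ), ω) + ((0, period k), 0) := by simp
    rw [actionPart, actionPart, h1, fderiv_eq_of_eventually_periodic]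
    filter_upwards [H.isOpen_dom.mem_nhds (H.zero_mem hθ hω)] with y hy
    rw [← shift_eq, H.realAnalytic.periodic y hy]
  real ω hω hr θ hθ := by
    have hs := real_mem_strip (a := s) (by linarith [H.σ_pos, H.σ_lt]) hθ
    exact H.im_fderiv_apply_eq_zero (H.zero_mem hs hω) ⟨isRealVec_zero, hθ, hr⟩
      ⟨isRealVec_single i, isRealVec_zero, isRealVec_zero⟩
  bound ω hω θ hθ := by
    have hm : ∀ z : ℂ, ‖z‖ < r → (((0, θ), ω) : Ext n) + z • ((Pi.single i 1, 0), 0) ∈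
        phaseDom n r s ×ˢ freqDom S h := by
      intro z hz
      refine ⟨⟨?_, ?_⟩, ?_⟩
      · have : ‖(Pi.single i (1 : ℂ) : CVec n)‖ = 1 := by simp [Pi.norm_single]
        simpa [norm_smul, this] using hz
      · simpa [strip] using hθ
      · simpa using hω
    exact norm_fderiv_apply_le H.r_pos
      (fun z hz => (H.realAnalytic.analytic _ (hm z hz)).differentiableAt)
      fun z hz => H.bound _ (hm z hz)

end StepData

end Step

/-! ### The generating function and the frequency correction -/

section Generating

open Filter Topology

variable {n : ℕ}

/-- The correction of the frequencies. -/
def freqShift (P : Ext n → ℂ) (ω : CVec n) : CVec n := fun i => angleMean (actionPart P i) ω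

/-- The part of the generating function which is linear in the actions. -/
def angleGen (P : Ext n → ℂ) (K : ℝ) (p : CVec n × CVec n) : CVec n :=
  fun j => -homSol (actionPart P j) K p

/-- The part of the generating function which does not depend on the actions. -/
def constGen (P : Ext n → ℂ) (K : ℝ) (p : CVec n × CVec n) : ℂ := -homSol (torusPart P) K p

/-- The generating function, without its trivial part `⟨I, θ⟩`. -/
def genFun (P : Ext n → ℂ) (K : ℝ) (x : Ext n) : ℂ :=
  ∑ j, angleGen P K (x.1.2, x.2) j * x.1.1 j + constGen P K (x.1.2, x.2)

theorem add_mem_strip {a b : ℝ} (ha : 0 < a) (hb : 0 ≤ b) {θ y : CVec n} (hθ : θ ∈ strip n a)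
    (hy : ‖y‖ ≤ b) : θ + y ∈ strip n (a + b) := by
  rw [mem_strip_iff ha] at hθ
  rw [mem_strip_iff (by linarith)]
  intro i
  have h1 : |(y i).im| ≤ b := (Complex.abs_im_le_norm _).trans ((norm_le_pi_norm y i).trans hy)
  calc |((θ + y) i).im| = |(θ i).im + (y i).im| := by simp
    _ ≤ |(θ i).im| + |(y i).im| := abs_add_le _ _
    _ < a + b := by linarith [hθ i]

theorem add_mem_freqDom {S : Set (Fin n → ℝ)} {a b : ℝ} {ω y : CVec n} (hω : ω ∈ freqDom S a)
    (hy : ‖y‖ ≤ b) : ω + y ∈ freqDom S (a + b) := by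
  obtain ⟨ξ, hξ, h⟩ := hω
  refine ⟨ξ, hξ, ?_⟩
  calc ‖ω + y - fun i => (ξ i : ℂ)‖ = ‖(ω - fun i => (ξ i : ℂ)) + y‖ := by congr 1; abel
    _ ≤ ‖ω - fun i => (ξ i : ℂ)‖ + ‖y‖ := norm_add_le _ _
    _ < a + b := by linarith

theorem freqDom_mono {S : Set (Fin n → ℝ)} {a b : ℝ} (h : a ≤ b) : freqDom S a ⊆ freqDom S b :=
  fun _ ⟨ξ, hξ, hd⟩ => ⟨ξ, hξ, hd.trans_le h⟩

/-- Cauchy's estimate, for functions bounded on a ball of directions. -/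
theorem norm_fderiv_apply_le_of_norm {E F V : Type*} [NormedAddCommGroup E] [NormedSpace ℂ E]
    [NormedAddCommGroup F] [NormedSpace ℂ F] [NormedAddCommGroup V] [NormedSpace ℂ V]
    {f : E → F} {x : E} (ι : V →L[ℂ] E) {M R : ℝ} (hR : 0 < R)
    (hd : ∀ v : V, ‖v‖ < R → DifferentiableAt ℂ f (x + ι v))
    (hM : ∀ v : V, ‖v‖ < R → ‖f (x + ι v)‖ ≤ M) (v : V) :
    ‖fderiv ℂ f x (ι v)‖ ≤ M / R * ‖v‖ := by
  rcases eq_or_ne v 0 with rfl | hv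
  · simp
  have hv' : 0 < ‖v‖ := norm_pos_iff.2 hv
  have hz : ∀ z : ℂ, ‖z‖ < R / ‖v‖ → ‖z • v‖ < R := fun z hz => by
    rw [norm_smul]
    rwa [lt_div_iff₀ hv'] at hz
  have := norm_fderiv_apply_le (f := f) (x := x) (v := ι v) (M := M) (div_pos hR hv')
    (fun z h => by simpa using hd _ (hz z h)) (fun z h => by simpa using hM _ (hz z h))
  refine this.trans (le_of_eq ?_)
  field_simp

/-- The inclusion of the angles. -/
def inclAngle (n : ℕ) : CVec n →L[ℂ] Ext n :=
  (ContinuousLinearMap.inl ℂ (Phase n) (CVec n)).comp (ContinuousLinearMap.inr ℂ (CVec n) (CVec n))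

@[simp] theorem inclAngle_apply (v : CVec n) : inclAngle n v = ((0, v), 0) := rfl

/-- The small parameter of one KAM step. -/
def stepSize (n : ℕ) (α τ r σ ε : ℝ) : ℝ := homConst n τ * (ε / (α * r * σ ^ (τ + 1)))

namespace StepData

variable {α τ r s σ K h η ε : ℝ} {S : Set (Fin n → ℝ)} {P : Ext n → ℂ}

theorem homConst_pos (n : ℕ) (τ : ℝ) : 0 < homConst n τ := by
  linarith [one_le_homConst n τ]

theorem stepSize_pos (H : StepData n α τ r s σ K h η ε S P) : 0 < stepSize n α τ r σ ε := by
  have := H.α_pos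
  have := H.r_pos
  have := H.σ_pos
  have := H.ε_pos
  have := homConst_pos n τ
  unfold stepSize
  positivity

theorem one_le_n (H : StepData n α τ r s σ K h η ε S P) : (1 : ℝ) ≤ n := by
  exact_mod_cast H.n_pos

theorem n_mul_stepSize_le (H : StepData n α τ r s σ K h η ε S P) :
    n * stepSize n α τ r σ ε ≤ 1 / 32 := by
  have := H.small₁
  unfold stepSize
  linarith

theorem stepSize_le (H : StepData n α τ r s σ K h η ε S P) : stepSize n α τ r σ ε ≤ 1 / 32 := by
  nlinarith [H.n_mul_stepSize_le, H.one_le_n, H.stepSize_pos]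

theorem norm_angleGen_le (H : StepData n α τ r s σ K h η ε S P) {θ ω : CVec n}
    (hω : ω ∈ freqDom S h) (hθ : θ ∈ strip n (s - 2 * σ)) :
    ‖angleGen P K (θ, ω)‖ ≤ stepSize n α τ r σ ε * σ := by
  have := H.α_pos
  have := H.r_pos
  have hσ := H.σ_pos
  have h0 : 0 ≤ stepSize n α τ r σ ε * σ := by have := H.stepSize_pos; positivity
  rw [pi_norm_le_iff_of_nonneg h0]
  intro j
  rw [angleGen, norm_neg]
  refine ((H.homData_actionPart j).norm_homSol_le hω hθ).trans (le_of_eq ?_)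
  rw [stepSize, Real.rpow_add_one hσ.ne']
  field_simp

theorem norm_constGen_le (H : StepData n α τ r s σ K h η ε S P) {θ ω : CVec n}
    (hω : ω ∈ freqDom S h) (hθ : θ ∈ strip n (s - 2 * σ)) :
    ‖constGen P K (θ, ω)‖ ≤ stepSize n α τ r σ ε * r * σ := by
  have := H.α_pos
  have := H.r_pos
  have hσ := H.σ_pos
  rw [constGen, norm_neg]
  refine (H.homData_torusPart.norm_homSol_le hω hθ).trans (le_of_eq ?_)
  rw [stepSize, Real.rpow_add_one hσ.ne']
  field_simp

theorem differentiableOn_angleGen (H : StepData n α τ r s σ K h η ε S P) :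
    DifferentiableOn ℂ (angleGen P K) (univ ×ˢ freqDom S h) :=
  differentiableOn_pi.2 fun j => (H.homData_actionPart j).differentiableOn_homSol.neg

theorem differentiableOn_constGen (H : StepData n α τ r s σ K h η ε S P) :
    DifferentiableOn ℂ (constGen P K) (univ ×ˢ freqDom S h) :=
  H.homData_torusPart.differentiableOn_homSol.neg

theorem differentiableAt_angleGen (H : StepData n α τ r s σ K h η ε S P) {θ ω : CVec n}
    (hω : ω ∈ freqDom S h) : DifferentiableAt ℂ (angleGen P K) (θ, ω) :=
  H.differentiableOn_angleGen.differentiableAt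
    ((isOpen_univ.prod (isOpen_freqDom S h)).mem_nhds ⟨trivial, hω⟩)

theorem differentiableAt_constGen (H : StepData n α τ r s σ K h η ε S P) {θ ω : CVec n}
    (hω : ω ∈ freqDom S h) : DifferentiableAt ℂ (constGen P K) (θ, ω) :=
  H.differentiableOn_constGen.differentiableAt
    ((isOpen_univ.prod (isOpen_freqDom S h)).mem_nhds ⟨trivial, hω⟩)

theorem differentiableAt_genFun (H : StepData n α τ r s σ K h η ε S P) {x : Ext n}
    (hω : x.2 ∈ freqDom S h) : DifferentiableAt ℂ (genFun P K) x := by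
  have hπ : DifferentiableAt ℂ (fun x : Ext n => (x.1.2, x.2)) x := by fun_prop
  have h1 : DifferentiableAt ℂ (fun x : Ext n => angleGen P K (x.1.2, x.2)) x :=
    DifferentiableAt.comp (g := angleGen P K) (f := fun x : Ext n => (x.1.2, x.2)) x
      (H.differentiableAt_angleGen (θ := x.1.2) hω) hπ
  have h2 : DifferentiableAt ℂ (fun x : Ext n => constGen P K (x.1.2, x.2)) x :=
    DifferentiableAt.comp (g := constGen P K) (f := fun x : Ext n => (x.1.2, x.2)) x
      (H.differentiableAt_constGen (θ := x.1.2) hω) hπ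
  unfold genFun
  refine DifferentiableAt.add (DifferentiableAt.fun_sum fun j _ => ?_) h2
  exact (differentiableAt_pi.1 h1 j).mul (by fun_prop)

theorem isOpen_genDom (S : Set (Fin n → ℝ)) (h : ℝ) :
    IsOpen {x : Ext n | x.2 ∈ freqDom S h} := (isOpen_freqDom S h).preimage continuous_snd

theorem analyticAt_genFun (H : StepData n α τ r s σ K h η ε S P) {x : Ext n}
    (hω : x.2 ∈ freqDom S h) : AnalyticAt ℂ (genFun P K) x :=
  analyticOnNhd_of_differentiableOn (isOpen_genDom S h)
    (fun _ hy => (H.differentiableAt_genFun hy).differentiableWithinAt) x hω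

theorem norm_genFun_le (H : StepData n α τ r s σ K h η ε S P) {x : Ext n}
    (hω : x.2 ∈ freqDom S h) (hθ : x.1.2 ∈ strip n (s - 2 * σ)) (hI : ‖x.1.1‖ ≤ r) :
    ‖genFun P K x‖ ≤ 2 * n * stepSize n α τ r σ ε * r * σ := by
  have hδ := H.stepSize_pos
  have hr := H.r_pos
  have hσ := H.σ_pos
  have h1 : ‖∑ j, angleGen P K (x.1.2, x.2) j * x.1.1 j‖ ≤ n * (stepSize n α τ r σ ε * σ * r) := by
    refine (norm_sum_le _ _).trans ?_
    calc ∑ j : Fin n, ‖angleGen P K (x.1.2, x.2) j * x.1.1 j‖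
        ≤ ∑ _j : Fin n, stepSize n α τ r σ ε * σ * r := by
          refine Finset.sum_le_sum fun j _ => ?_
          rw [norm_mul]
          exact mul_le_mul ((norm_le_pi_norm _ j).trans (H.norm_angleGen_le hω hθ))
            ((norm_le_pi_norm _ j).trans hI) (norm_nonneg _) (by positivity)
      _ = _ := by simp
  refine (norm_add_le _ _).trans ((add_le_add h1 (H.norm_constGen_le hω hθ)).trans ?_)
  have h2 : 0 ≤ stepSize n α τ r σ ε * r * σ := by positivity
  nlinarith [H.one_le_n]

theorem norm_fderiv_genFun_le (H : StepData n α τ r s σ K h η ε S P) {x : Ext n}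
    (hω : x.2 ∈ freqDom S h) (hθ : x.1.2 ∈ strip n (s - 3 * σ)) (hI : ‖x.1.1‖ ≤ r) (v : CVec n) :
    ‖fderiv ℂ (genFun P K) x ((0, v), 0)‖ ≤ 2 * n * stepSize n α τ r σ ε * r * ‖v‖ := by
  have hσ := H.σ_pos
  have hs : ∀ v : CVec n, ‖v‖ < σ → x.1.2 + v ∈ strip n (s - 2 * σ) := fun v hv => by
    have := add_mem_strip (by linarith [H.σ_lt]) hσ.le hθ hv.le
    exact strip_mono (by linarith) this
  have := norm_fderiv_apply_le_of_norm (f := genFun P K) (x := x) (inclAngle n)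
    (M := 2 * n * stepSize n α τ r σ ε * r * σ) hσ
    (fun v _ => H.differentiableAt_genFun (by simpa using hω))
    (fun v hv => H.norm_genFun_le (by simpa using hω) (by simpa using hs v hv)
      (by simpa using hI)) v
  rwa [inclAngle_apply, mul_div_assoc, div_self hσ.ne', mul_one] at this

theorem norm_fderiv_angleGen_le (H : StepData n α τ r s σ K h η ε S P) {θ ω : CVec n}
    (hω : ω ∈ freqDom S h) (hθ : θ ∈ strip n (s - 3 * σ)) (v : CVec n) :
    ‖fderiv ℂ (angleGen P K) (θ, ω) (v, 0)‖ ≤ stepSize n α τ r σ ε * ‖v‖ := by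
  have hσ := H.σ_pos
  have hs : ∀ v : CVec n, ‖v‖ < σ → θ + v ∈ strip n (s - 2 * σ) := fun v hv => by
    have := add_mem_strip (by linarith [H.σ_lt]) hσ.le hθ hv.le
    exact strip_mono (by linarith) this
  have := norm_fderiv_apply_le_of_norm (f := angleGen P K) (x := (θ, ω))
    (ContinuousLinearMap.inl ℂ (CVec n) (CVec n))
    (M := stepSize n α τ r σ ε * σ) hσ
    (fun v _ => by simpa using H.differentiableAt_angleGen hω)
    (fun v hv => by simpa using H.norm_angleGen_le hω (hs v hv)) v
  rwa [ContinuousLinearMap.inl_apply, mul_div_assoc, div_self hσ.ne', mul_one] at this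

theorem fderiv_genFun_action (H : StepData n α τ r s σ K h η ε S P) {I θ ω : CVec n}
    (hω : ω ∈ freqDom S h) (v : CVec n) :
    fderiv ℂ (genFun P K) ((I, θ), ω) ((v, 0), 0) = ∑ j, angleGen P K (θ, ω) j * v j := by
  have h1 := hasDerivAt_comp_line (f := genFun P K) (x := ((I, θ), ω)) (v := ((v, 0), 0)) (z := 0)
    (H.differentiableAt_genFun (by simpa using hω))
  rw [zero_smul, add_zero] at h1
  refine h1.unique ?_
  have h2 : (fun z : ℂ => genFun P K (((I, θ), ω) + z • ((v, 0), 0))) = fun z =>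
      ∑ j, angleGen P K (θ, ω) j * (I j + z * v j) + constGen P K (θ, ω) := by
    ext z
    simp [genFun]
  rw [h2]
  refine HasDerivAt.add_const _ (HasDerivAt.fun_sum fun j _ => ?_)
  have := (((hasDerivAt_id (0 : ℂ)).mul_const (v j)).const_add (I j)).const_mul
    (angleGen P K (θ, ω) j)
  simpa using this

theorem fderiv_genFun_angle (H : StepData n α τ r s σ K h η ε S P) {I θ ω : CVec n}
    (hω : ω ∈ freqDom S h) (v : CVec n) :
    fderiv ℂ (genFun P K) ((I, θ), ω) ((0, v), 0) =
      ∑ j, fderiv ℂ (angleGen P K) (θ, ω) (v, 0) j * I j +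
        fderiv ℂ (constGen P K) (θ, ω) (v, 0) := by
  have h1 := hasDerivAt_comp_line (f := genFun P K) (x := ((I, θ), ω)) (v := ((0, v), 0)) (z := 0)
    (H.differentiableAt_genFun (by simpa using hω))
  rw [zero_smul, add_zero] at h1
  refine h1.unique ?_
  have h2 : (fun z : ℂ => genFun P K (((I, θ), ω) + z • ((0, v), 0))) = fun z =>
      ∑ j, angleGen P K ((θ, ω) + z • ((v, 0) : CVec n × CVec n)) j * I j +
        constGen P K ((θ, ω) + z • ((v, 0) : CVec n × CVec n)) := by
    ext z
    simp [genFun]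
  rw [h2]
  have h3 := hasDerivAt_comp_line (f := angleGen P K) (x := (θ, ω))
    (v := ((v, 0) : CVec n × CVec n)) (z := 0) (by
      rw [zero_smul, add_zero]; exact H.differentiableAt_angleGen hω)
  have h4 := hasDerivAt_comp_line (f := constGen P K) (x := (θ, ω))
    (v := ((v, 0) : CVec n × CVec n)) (z := 0) (by
      rw [zero_smul, add_zero]; exact H.differentiableAt_constGen hω)
  rw [zero_smul, add_zero] at h3 h4
  exact (HasDerivAt.fun_sum fun j _ => (hasDerivAt_pi.1 h3 j).mul_const (I j)).add h4

theorem genFun_add_period (P : Ext n → ℂ) (K : ℝ) (x : Ext n) (k : Fin n → ℤ) :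
    genFun P K (x + ((0, period k), 0)) = genFun P K x := by
  simp [genFun, angleGen, constGen, HomData.homSol_periodic]

theorem fderiv_genFun_add_period (P : Ext n → ℂ) (K : ℝ) (x : Ext n) (k : Fin n → ℤ) :
    fderiv ℂ (genFun P K) (x + ((0, period k), 0)) = fderiv ℂ (genFun P K) x :=
  fderiv_eq_of_eventually_periodic (Eventually.of_forall fun y => genFun_add_period P K y k)

theorem isRealVec_angleGen (H : StepData n α τ r s σ K h η ε S P) {θ ω : CVec n}
    (hω : ω ∈ freqDom S h) (hr : IsRealVec ω) (hθ : IsRealVec θ) :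
    IsRealVec (angleGen P K (θ, ω)) := fun j => by
  rw [angleGen, Complex.neg_im, (H.homData_actionPart j).homSol_real hω hr hθ, neg_zero]

theorem isRealVec_freqShift (H : StepData n α τ r s σ K h η ε S P) {ω : CVec n}
    (hω : ω ∈ freqDom S h) (hr : IsRealVec ω) : IsRealVec (freqShift P ω) := fun j =>
  (H.homData_actionPart j).angleMean_real hω hr

theorem genFun_real (H : StepData n α τ r s σ K h η ε S P) {x : Ext n}
    (hω : x.2 ∈ freqDom S h) (hr : IsRealPt x) : (genFun P K x).im = 0 := by
  have h1 := H.isRealVec_angleGen hω hr.2.2 hr.2.1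
  have h2 := H.homData_torusPart.homSol_real hω hr.2.2 hr.2.1
  simp only [genFun, constGen, Complex.add_im, Complex.im_sum, Complex.mul_im, Complex.neg_im, h2,
    h1 _, hr.1 _]
  simp

theorem fderiv_genFun_real (H : StepData n α τ r s σ K h η ε S P) {x : Ext n}
    (hω : x.2 ∈ freqDom S h) (hr : IsRealPt x) {v : CVec n} (hv : IsRealVec v) :
    (fderiv ℂ (genFun P K) x ((0, v), 0)).im = 0 := by
  refine im_fderiv_eq_zero (H.differentiableAt_genFun hω) (Eventually.of_forall fun t => ?_)
  refine H.genFun_real (by simpa using hω) ⟨?_, ?_, ?_⟩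
  · exact isRealVec_add_smul hr.1 isRealVec_zero t
  · exact isRealVec_add_smul hr.2.1 hv t
  · exact isRealVec_add_smul hr.2.2 isRealVec_zero t

theorem norm_freqShift_le (H : StepData n α τ r s σ K h η ε S P) {ω : CVec n}
    (hω : ω ∈ freqDom S h) : ‖freqShift P ω‖ ≤ ε / r := by
  have := H.r_pos
  have := H.ε_pos
  rw [pi_norm_le_iff_of_nonneg (by positivity)]
  exact fun j => (H.homData_actionPart j).norm_angleMean_le hω

theorem differentiableOn_freqShift (H : StepData n α τ r s σ K h η ε S P) :
    DifferentiableOn ℂ (freqShift P) (freqDom S h) :=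
  differentiableOn_pi.2 fun j => (H.homData_actionPart j).differentiableOn_fcoeff 0

/-- The frequency correction is a small fraction of the width `h`, so Cauchy's estimate at the scale
of `h` makes it a contraction. -/
theorem ε_div_r_le (H : StepData n α τ r s σ K h η ε S P) : ε / r ≤ h / 32 := by
  have h1 := H.small₂
  have hr := H.r_pos
  have hh := H.h_pos
  have h2 : 1 ≤ n * homConst n τ := by nlinarith [H.one_le_n, one_le_homConst n τ]
  have h3 : 0 < ε / (r * h) := by have := H.ε_pos; positivity
  have h4 : ε / (r * h) ≤ 1 / 32 := by nlinarith
  have h5 : ε / r = ε / (r * h) * h := by field_simp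
  rw [h5]
  nlinarith

end StepData

end Generating

/-! ### The implicit equations and the transformation of one step -/

section StepMap

open Filter Topology

variable {n : ℕ}

/-- The solutions of the implicit equations which define the transformation of one KAM step. -/
structure StepSol (n : ℕ) (α τ r s σ K h ε : ℝ) (S : Set (Fin n → ℝ)) (P : Ext n → ℂ)
    (φ : CVec n → CVec n) (V : CVec n × CVec n → CVec n) : Prop where
  φ_diff : DifferentiableOn ℂ φ (freqDom S (h / 2))
  φ_sub : ∀ ω ∈ freqDom S (h / 2), ‖φ ω - ω‖ ≤ ε / r
  φ_eq : ∀ ω ∈ freqDom S (h / 2), φ ω + freqShift P (φ ω) = ω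
  φ_real : ∀ ω ∈ freqDom S (h / 2), IsRealVec ω → IsRealVec (φ ω)
  V_diff : DifferentiableOn ℂ V (strip n (s - 4 * σ) ×ˢ freqDom S h)
  V_sub : ∀ θ ∈ strip n (s - 4 * σ), ∀ ω ∈ freqDom S h,
    ‖V (θ, ω) - θ‖ ≤ stepSize n α τ r σ ε * σ
  V_eq : ∀ θ ∈ strip n (s - 4 * σ), ∀ ω ∈ freqDom S h,
    V (θ, ω) + angleGen P K (V (θ, ω), ω) = θ
  V_period : ∀ θ ∈ strip n (s - 4 * σ), ∀ ω ∈ freqDom S h, ∀ k : Fin n → ℤ,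
    V (θ + period k, ω) = V (θ, ω) + period k
  V_real : ∀ θ ∈ strip n (s - 4 * σ), ∀ ω ∈ freqDom S h, IsRealVec θ → IsRealVec ω →
    IsRealVec (V (θ, ω))

theorem isClosed_isRealVec : IsClosed {y : CVec n | IsRealVec y} := by
  simp only [IsRealVec, ofPred_forall]
  exact isClosed_iInter fun i => isClosed_eq (by fun_prop) continuous_const

theorem IsRealVec.add {a b : CVec n} (ha : IsRealVec a) (hb : IsRealVec b) : IsRealVec (a + b) :=
  fun i => by simp [ha i, hb i]

theorem IsRealVec.neg {a : CVec n} (ha : IsRealVec a) : IsRealVec (-a) :=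
  fun i => by simp [ha i]

theorem add_period_mem_strip {a : ℝ} {θ : CVec n} (hθ : θ ∈ strip n a) (k : Fin n → ℤ) :
    θ + period k ∈ strip n a := by
  simpa [strip, period_im] using hθ

namespace StepData

variable {α τ r s σ K h η ε : ℝ} {S : Set (Fin n → ℝ)} {P : Ext n → ℂ}

/-- Writing `φ ω = ω + y`, the equation becomes `y = -freqShift (ω + y)`. Cauchy's estimate with
radius `h / 4` bounds the derivative of the right side by `4 ε / (r h) ≤ 1 / 8`. -/
theorem exists_freqMap (H : StepData n α τ r s σ K h η ε S P) :
    ∃ φ : CVec n → CVec n, DifferentiableOn ℂ φ (freqDom S (h / 2)) ∧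
      ∀ ω ∈ freqDom S (h / 2), ‖φ ω - ω‖ ≤ ε / r ∧ φ ω + freqShift P (φ ω) = ω ∧
        (IsRealVec ω → IsRealVec (φ ω)) := by
  have hh := H.h_pos
  have hr := H.r_pos
  have hε := H.ε_pos
  have h32 := H.ε_div_r_le
  have hmem : ∀ ω ∈ freqDom S (h / 2), ∀ y, ‖y‖ ≤ h / 2 → ω + y ∈ freqDom S h := fun ω hω y hy => by
    have := add_mem_freqDom hω hy
    rwa [add_halves] at this
  obtain ⟨g, hg, h1, -, h3⟩ := exists_differentiableOn_fixedPoint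
    (T := fun p : CVec n × CVec n => -freqShift P (p.1 + p.2)) (U := freqDom S (h / 2))
    (W := {p | p.1 + p.2 ∈ freqDom S h}) (ρ := ε / r) (isOpen_freqDom S _)
    ((isOpen_freqDom S h).preimage (by fun_prop))
    (DifferentiableOn.neg (DifferentiableOn.comp (g := freqShift P)
      (f := fun p : CVec n × CVec n => p.1 + p.2) H.differentiableOn_freqShift (by fun_prop)
      fun p hp => hp)) (by positivity)
    (fun p hp => hmem _ hp.1 _ ((mem_closedBall_zero_iff.1 hp.2).trans (by linarith)))
    (fun x hx y hy => by
      rw [norm_neg]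
      exact H.norm_freqShift_le (hmem _ hx _ ((mem_closedBall_zero_iff.1 hy).trans (by linarith))))
    (fun x hx y hy v => by
      have hy' := mem_closedBall_zero_iff.1 hy
      have hb : ∀ v : CVec n, ‖v‖ < h / 4 → x + (y + v) ∈ freqDom S h := fun v hv =>
        hmem _ hx _ ((norm_add_le _ _).trans (by linarith))
      have := norm_fderiv_apply_le_of_norm
        (f := fun p : CVec n × CVec n => -freqShift P (p.1 + p.2)) (x := (x, y))
        (ContinuousLinearMap.inr ℂ (CVec n) (CVec n)) (M := ε / r) (R := h / 4) (by positivity)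
        (fun v hv => by
          refine DifferentiableAt.neg (DifferentiableAt.comp (g := freqShift P) _ ?_ (by fun_prop))
          exact H.differentiableOn_freqShift.differentiableAt
            ((isOpen_freqDom S h).mem_nhds (by simpa using hb v hv)))
        (fun v hv => by
          rw [norm_neg]
          exact H.norm_freqShift_le (by simpa using hb v hv)) v
      refine this.trans (mul_le_mul_of_nonneg_right ?_ (norm_nonneg _))
      rw [div_le_iff₀ (by positivity)]
      linarith)
  refine ⟨fun ω => ω + g ω, differentiableOn_id.add hg, fun ω hω => ⟨?_, ?_, fun hr => ?_⟩⟩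
  · simpa using (h1 ω hω).1
  · have := (h1 ω hω).2
    simp only at this ⊢
    nth_rw 1 [this]
    abel
  · refine hr.add (h3 ω hω {y | IsRealVec y} isClosed_isRealVec isRealVec_zero fun y hy hyn => ?_)
    exact (H.isRealVec_freqShift (hmem _ hω _ (hyn.trans (by linarith))) (hr.add hy)).neg

/-- Here `∂_I G` does not depend on `I`, so the equation `θ = V + ∂_I G` concerns the angles alone.
Cauchy's estimate with radius `σ` gives the contraction constant `stepSize ≤ 1 / 32`. -/
theorem exists_angleMap (H : StepData n α τ r s σ K h η ε S P) :
    ∃ V : CVec n × CVec n → CVec n, DifferentiableOn ℂ V (strip n (s - 4 * σ) ×ˢ freqDom S h) ∧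
      ∀ θ ∈ strip n (s - 4 * σ), ∀ ω ∈ freqDom S h,
        ‖V (θ, ω) - θ‖ ≤ stepSize n α τ r σ ε * σ ∧ V (θ, ω) + angleGen P K (V (θ, ω), ω) = θ ∧
        (∀ k : Fin n → ℤ, V (θ + period k, ω) = V (θ, ω) + period k) ∧
        (IsRealVec θ → IsRealVec ω → IsRealVec (V (θ, ω))) := by
  have hσ := H.σ_pos
  have hδ := H.stepSize_pos
  have h32 := H.stepSize_le
  have hρ : stepSize n α τ r σ ε * σ ≤ σ := by nlinarith
  have hmem : ∀ θ ∈ strip n (s - 4 * σ), ∀ y, ‖y‖ ≤ 2 * σ → θ + y ∈ strip n (s - 2 * σ) :=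
    fun θ hθ y hy => by
      have := add_mem_strip (by linarith [H.σ_lt]) (by linarith) hθ hy
      exact strip_mono (by linarith) this
  set T : (CVec n × CVec n) × CVec n → CVec n := fun p => -angleGen P K (p.1.1 + p.2, p.1.2)
    with hTdef
  have hT : DifferentiableOn ℂ T {p | p.1.2 ∈ freqDom S h} :=
    (H.differentiableOn_angleGen.comp (by fun_prop) fun p hp => ⟨trivial, hp⟩).neg
  have hW : IsOpen {p : (CVec n × CVec n) × CVec n | p.1.2 ∈ freqDom S h} :=
    (isOpen_freqDom S h).preimage (by fun_prop)
  have hbound : ∀ x ∈ strip n (s - 4 * σ) ×ˢ freqDom S h, ∀ y : CVec n, ‖y‖ ≤ 2 * σ →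
      ‖T (x, y)‖ ≤ stepSize n α τ r σ ε * σ := fun x hx y hy => by
    rw [hTdef, norm_neg]
    exact H.norm_angleGen_le hx.2 (hmem _ hx.1 _ hy)
  obtain ⟨g, hg, h1, h2, h3⟩ := exists_differentiableOn_fixedPoint (T := T)
    (U := strip n (s - 4 * σ) ×ˢ freqDom S h) (ρ := stepSize n α τ r σ ε * σ)
    ((isOpen_strip _).prod (isOpen_freqDom S h)) hW hT (by positivity)
    (fun p hp => hp.1.2)
    (fun x hx y hy => hbound x hx y ((mem_closedBall_zero_iff.1 hy).trans (by linarith)))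
    (fun x hx y hy v => by
      have hy' := mem_closedBall_zero_iff.1 hy
      have := norm_fderiv_apply_le_of_norm (f := T) (x := (x, y))
        (ContinuousLinearMap.inr ℂ (CVec n × CVec n) (CVec n)) (M := stepSize n α τ r σ ε * σ)
        (R := σ) hσ
        (fun v hv => hT.differentiableAt (hW.mem_nhds (by simpa using hx.2)))
        (fun v hv => by
          simpa using hbound x hx (y + v) ((norm_add_le _ _).trans (by linarith))) v
      refine this.trans (mul_le_mul_of_nonneg_right ?_ (norm_nonneg _))
      rw [mul_div_assoc, div_self hσ.ne']
      linarith)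
  refine ⟨fun p => p.1 + g p, differentiableOn_fst.add hg, fun θ hθ ω hω =>
    ⟨?_, ?_, fun k => ?_, fun hθr hωr => ?_⟩⟩
  · simpa using (h1 (θ, ω) ⟨hθ, hω⟩).1
  · have := (h1 (θ, ω) ⟨hθ, hω⟩).2
    simp only [hTdef] at this
    simp only
    nth_rw 1 [this]
    abel
  -- The displacement at `θ + 2πk` solves the fixed point equation at `θ`, so by uniqueness it is
  -- the same.
  · have h4 := h1 (θ + period k, ω) ⟨add_period_mem_strip hθ k, hω⟩
    have := h2 (θ, ω) ⟨hθ, hω⟩ (g (θ + period k, ω)) h4.1 (by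
      refine h4.2.trans ?_
      simp only [hTdef]
      generalize g (θ + period k, ω) = y
      rw [add_right_comm]
      funext j
      simp only [angleGen, Pi.neg_apply, HomData.homSol_periodic])
    simp only [this]
    abel
  · refine hθr.add (h3 (θ, ω) ⟨hθ, hω⟩ {y | IsRealVec y} isClosed_isRealVec isRealVec_zero
      fun y hy hyn => ?_)
    exact (H.isRealVec_angleGen hω hωr (hθr.add hy)).neg

theorem exists_stepSol (H : StepData n α τ r s σ K h η ε S P) :
    ∃ φ V, StepSol n α τ r s σ K h ε S P φ V := by
  obtain ⟨φ, hφ, hφ'⟩ := H.exists_freqMap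
  obtain ⟨V, hV, hV'⟩ := H.exists_angleMap
  exact ⟨φ, V, hφ, fun ω hω => (hφ' ω hω).1, fun ω hω => (hφ' ω hω).2.1,
    fun ω hω => (hφ' ω hω).2.2, hV, fun θ hθ ω hω => (hV' θ hθ ω hω).1,
    fun θ hθ ω hω => (hV' θ hθ ω hω).2.1, fun θ hθ ω hω => (hV' θ hθ ω hω).2.2.1,
    fun θ hθ ω hω => (hV' θ hθ ω hω).2.2.2⟩

end StepData

/-- The increment of the actions. -/
def actionShift (P : Ext n → ℂ) (K : ℝ) (x : Ext n) : CVec n :=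
  fun i => fderiv ℂ (genFun P K) x ((0, Pi.single i 1), 0)

/-- The transformation with the generating function `⟨I, θ⟩ + genFun`. -/
def stepMap (P : Ext n → ℂ) (K : ℝ) (φ : CVec n → CVec n) (V : CVec n × CVec n → CVec n)
    (x : Ext n) : Ext n :=
  ((x.1.1 + actionShift P K ((x.1.1, V (x.1.2, φ x.2)), φ x.2), V (x.1.2, φ x.2)), φ x.2)

namespace StepSol

variable {α τ r s σ K h η ε : ℝ} {S : Set (Fin n → ℝ)} {P : Ext n → ℂ}
  {φ : CVec n → CVec n} {V : CVec n × CVec n → CVec n}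

theorem φ_mem (H : StepData n α τ r s σ K h η ε S P) (L : StepSol n α τ r s σ K h ε S P φ V)
    {ω : CVec n} (hω : ω ∈ freqDom S (h / 2)) : φ ω ∈ freqDom S h := by
  have := add_mem_freqDom hω (L.φ_sub ω hω)
  rw [add_sub_cancel] at this
  exact freqDom_mono (by linarith [H.h_pos, H.ε_div_r_le]) this

theorem V_mem (H : StepData n α τ r s σ K h η ε S P) (L : StepSol n α τ r s σ K h ε S P φ V)
    {θ ω : CVec n} (hθ : θ ∈ strip n (s - 4 * σ)) (hω : ω ∈ freqDom S h) :
    V (θ, ω) ∈ strip n (s - 3 * σ) := by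
  have hσ := H.σ_pos
  have hδ := H.stepSize_pos
  have h32 := H.stepSize_le
  have := add_mem_strip (by linarith [H.σ_lt]) (by positivity) hθ (L.V_sub θ hθ ω hω)
  rw [add_sub_cancel] at this
  exact strip_mono (by nlinarith) this

theorem norm_actionShift_le (H : StepData n α τ r s σ K h η ε S P) {x : Ext n}
    (hω : x.2 ∈ freqDom S h) (hθ : x.1.2 ∈ strip n (s - 3 * σ)) (hI : ‖x.1.1‖ ≤ r) :
    ‖actionShift P K x‖ ≤ 2 * n * stepSize n α τ r σ ε * r := by
  have := H.r_pos
  have := H.stepSize_pos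
  rw [pi_norm_le_iff_of_nonneg (by positivity)]
  intro i
  have h1 := H.norm_fderiv_genFun_le hω hθ hI (Pi.single i 1)
  have h2 : ‖(Pi.single i (1 : ℂ) : CVec n)‖ = 1 := by simp [Pi.norm_single]
  rwa [h2, mul_one] at h1

theorem differentiableOn_actionShift (H : StepData n α τ r s σ K h η ε S P) :
    DifferentiableOn ℂ (actionShift P K) {x : Ext n | x.2 ∈ freqDom S h} := by
  have h1 : AnalyticOnNhd ℂ (genFun P K) {x : Ext n | x.2 ∈ freqDom S h} :=
    fun x hx => H.analyticAt_genFun hx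
  exact differentiableOn_pi.2 fun i => h1.fderiv.differentiableOn.clm_apply (differentiableOn_const _)

theorem differentiableOn_stepMap (H : StepData n α τ r s σ K h η ε S P)
    (L : StepSol n α τ r s σ K h ε S P φ V) :
    DifferentiableOn ℂ (stepMap P K φ V) {x | x.1.2 ∈ strip n (s - 4 * σ) ∧ x.2 ∈ freqDom S (h / 2)} := by
  set A : Set (Ext n) := {x | x.1.2 ∈ strip n (s - 4 * σ) ∧ x.2 ∈ freqDom S (h / 2)}
  have h1 : DifferentiableOn ℂ (fun x : Ext n => φ x.2) A :=
    L.φ_diff.comp (by fun_prop) fun x hx => hx.2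
  have h2 : DifferentiableOn ℂ (fun x : Ext n => V (x.1.2, φ x.2)) A :=
    DifferentiableOn.comp (g := V) L.V_diff
      (DifferentiableOn.prodMk (by fun_prop) h1) fun x hx => ⟨hx.1, φ_mem H L hx.2⟩
  have h3 : DifferentiableOn ℂ (fun x : Ext n => ((x.1.1, V (x.1.2, φ x.2)), φ x.2)) A :=
    DifferentiableOn.prodMk (DifferentiableOn.prodMk (by fun_prop) h2) h1
  have h4 : DifferentiableOn ℂ
      (fun x : Ext n => actionShift P K ((x.1.1, V (x.1.2, φ x.2)), φ x.2)) A :=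
    DifferentiableOn.comp (g := actionShift P K) (differentiableOn_actionShift H) h3
      fun x hx => φ_mem H L hx.2
  exact DifferentiableOn.prodMk
    (DifferentiableOn.prodMk (DifferentiableOn.add (by fun_prop) h4) h2) h1

theorem stepMap_mem (H : StepData n α τ r s σ K h η ε S P)
    (L : StepSol n α τ r s σ K h ε S P φ V) {x : Ext n}
    (hx : x ∈ phaseDom n (r / 4) (s - 4 * σ) ×ˢ freqDom S (h / 2)) :
    stepMap P K φ V x ∈ phaseDom n r s ×ˢ freqDom S h := by
  obtain ⟨⟨hI, hθ⟩, hω⟩ := hx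
  have hr := H.r_pos
  have hσ := H.σ_pos
  have hφ := φ_mem H L hω
  have hV := V_mem H L hθ hφ
  have h1 := norm_actionShift_le H (x := ((x.1.1, V (x.1.2, φ x.2)), φ x.2)) hφ hV
    (by simp only; linarith)
  refine ⟨⟨?_, strip_mono (by linarith) hV⟩, hφ⟩
  refine (norm_add_le _ _).trans_lt ?_
  nlinarith [H.n_mul_stepSize_le]

theorem actionShift_eq (H : StepData n α τ r s σ K h η ε S P) {I θ ω : CVec n}
    (hω : ω ∈ freqDom S h) (i : Fin n) :
    actionShift P K ((I, θ), ω) i =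
      fderiv ℂ (constGen P K) (θ, ω) (Pi.single i 1, 0) +
        ∑ j, fderiv ℂ (angleGen P K) (θ, ω) (Pi.single i 1, 0) j * I j := by
  rw [actionShift, H.fderiv_genFun_angle hω, add_comm]

/-- The shift is affine in `I` with a small linear part. Hence `I ↦ I + actionShift` is injective
once the angles are known to agree. -/
theorem norm_actionShift_sub_le (H : StepData n α τ r s σ K h η ε S P) {I I' θ ω : CVec n}
    (hω : ω ∈ freqDom S h) (hθ : θ ∈ strip n (s - 3 * σ)) :
    ‖actionShift P K ((I, θ), ω) - actionShift P K ((I', θ), ω)‖ ≤ 1 / 32 * ‖I - I'‖ := by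
  have hδ := H.stepSize_pos
  rw [pi_norm_le_iff_of_nonneg (by positivity)]
  intro i
  rw [Pi.sub_apply, actionShift_eq H hω, actionShift_eq H hω, add_sub_add_left_eq_sub,
    ← Finset.sum_sub_distrib]
  refine (norm_sum_le _ _).trans ?_
  have h2 : ‖(Pi.single i (1 : ℂ) : CVec n)‖ = 1 := by simp [Pi.norm_single]
  calc ∑ j, ‖fderiv ℂ (angleGen P K) (θ, ω) (Pi.single i 1, 0) j * I j -
        fderiv ℂ (angleGen P K) (θ, ω) (Pi.single i 1, 0) j * I' j‖
      ≤ ∑ _j : Fin n, stepSize n α τ r σ ε * ‖I - I'‖ := by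
        refine Finset.sum_le_sum fun j _ => ?_
        rw [← mul_sub, norm_mul]
        refine mul_le_mul ((norm_le_pi_norm _ j).trans ?_) (norm_le_pi_norm (I - I') j)
          (norm_nonneg _) hδ.le
        simpa [h2] using H.norm_fderiv_angleGen_le hω hθ (Pi.single i 1)
    _ = n * stepSize n α τ r σ ε * ‖I - I'‖ := by simp; ring
    _ ≤ _ := mul_le_mul_of_nonneg_right H.n_mul_stepSize_le (norm_nonneg _)

/-- Differentiating `φ + freqShift ∘ φ = id` shows that the derivative of `φ` is injective, which
suffices in finite dimension. -/
theorem isInvertible_fderiv (H : StepData n α τ r s σ K h η ε S P)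
    (L : StepSol n α τ r s σ K h ε S P φ V) {ω : CVec n} (hω : ω ∈ freqDom S (h / 2)) :
    (fderiv ℂ φ ω).IsInvertible := by
  refine isInvertible_of_injective ?_
  have hn := (isOpen_freqDom S (h / 2)).mem_nhds hω
  have h1 := (L.φ_diff.differentiableAt hn).hasFDerivAt
  have h2 := (H.differentiableOn_freqShift.differentiableAt
    ((isOpen_freqDom S h).mem_nhds (φ_mem H L hω))).hasFDerivAt
  have h3 : HasFDerivAt (fun ω => φ ω + freqShift P (φ ω)) _ ω := h1.add (h2.comp ω h1)
  have h4 : HasFDerivAt (fun ω => φ ω + freqShift P (φ ω)) (.id ℂ (CVec n)) ω :=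
    (hasFDerivAt_id ω).congr_of_eventuallyEq (by
      filter_upwards [hn] with y hy
      exact L.φ_eq y hy)
  intro v w hvw
  have h5 := DFunLike.congr_fun (h3.unique h4)
  have hv := h5 v
  have hw := h5 w
  simp only [add_apply, ContinuousLinearMap.comp_apply,
    ContinuousLinearMap.id_apply] at hv hw
  rw [← hv, ← hw, hvw]

theorem symplectic_stepMap (H : StepData n α τ r s σ K h η ε S P)
    (L : StepSol n α τ r s σ K h ε S P φ V) {z : Phase n} {ω : CVec n}
    (hθ : z.2 ∈ strip n (s - 4 * σ)) (hω : ω ∈ freqDom S (h / 2)) (u v : Phase n) :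
    sympForm (fderiv ℂ (fun w => (stepMap P K φ V (w, ω)).1) z u)
      (fderiv ℂ (fun w => (stepMap P K φ V (w, ω)).1) z v) = sympForm u v := by
  have hφ := φ_mem H L hω
  have hopen : IsOpen {x : Ext n | x.1.2 ∈ strip n (s - 4 * σ) ∧ x.2 ∈ freqDom S (h / 2)} :=
    ((isOpen_strip _).preimage (f := fun x : Ext n => x.1.2) (by fun_prop)).inter
      ((isOpen_freqDom S _).preimage continuous_snd)
  have hd : DifferentiableAt ℂ (stepMap P K φ V) (z, ω) :=
    (differentiableOn_stepMap H L).differentiableAt (hopen.mem_nhds ⟨hθ, hω⟩)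
  have hF : ∀ w : Phase n, ∀ v : Phase n,
      fderiv ℂ (fun w => genFun P K (w, φ ω)) w v = fderiv ℂ (genFun P K) (w, φ ω) (v, 0) := by
    intro w v
    have h1 : HasFDerivAt (genFun P K) _ (w, φ ω) :=
      (H.differentiableAt_genFun (x := (w, φ ω)) hφ).hasFDerivAt
    have h2 := h1.comp w (hasFDerivAt_prodMk_left (𝕜 := ℂ) w (φ ω))
    exact DFunLike.congr_fun h2.fderiv v
  have hz : ∀ᶠ w : Phase n in 𝓝 z, w.2 ∈ strip n (s - 4 * σ) :=
    ((isOpen_strip _).preimage continuous_snd).mem_nhds hθ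
  refine sympForm_of_generating (S := fun w => genFun P K (w, φ ω)) ?_ ?_ ?_ ?_ u v
  · exact (DifferentiableAt.comp (g := stepMap P K φ V) (f := fun w : Phase n => (w, ω)) z hd
      (by fun_prop)).fst
  · exact AnalyticAt.fun_comp (g := genFun P K) (f := fun w : Phase n => (w, φ ω))
      (H.analyticAt_genFun hφ) (by fun_prop)
  · refine Eventually.of_forall fun w i => ?_
    rw [hF]
    rfl
  · filter_upwards [hz] with w hw i
    rw [hF, H.fderiv_genFun_action hφ]
    have := congrFun (L.V_eq w.2 hw (φ ω) hφ) i
    simp only [Pi.add_apply] at this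
    rw [← this]
    simp [stepMap, Pi.single_apply]

theorem stepMap_shift (H : StepData n α τ r s σ K h η ε S P)
    (L : StepSol n α τ r s σ K h ε S P φ V) {x : Ext n}
    (hθ : x.1.2 ∈ strip n (s - 4 * σ)) (hω : x.2 ∈ freqDom S (h / 2)) (k : Fin n → ℤ) :
    stepMap P K φ V (shift k x) = shift k (stepMap P K φ V x) := by
  have h1 := L.V_period _ hθ _ (φ_mem H L hω) k
  have h2 : ∀ I θ ω : CVec n, actionShift P K ((I, θ + period k), ω) =
      actionShift P K ((I, θ), ω) := fun I θ ω => by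
    ext i
    have : (((I, θ + period k), ω) : Ext n) = ((I, θ), ω) + ((0, period k), 0) := by simp
    rw [actionShift, this, StepData.fderiv_genFun_add_period, actionShift]
  simp only [stepMap, shift_eq, Prod.fst_add, Prod.snd_add, add_zero, h1, h2, Prod.mk_add_mk]

theorem stepMap_real (H : StepData n α τ r s σ K h η ε S P)
    (L : StepSol n α τ r s σ K h ε S P φ V) {x : Ext n}
    (hθ : x.1.2 ∈ strip n (s - 4 * σ)) (hω : x.2 ∈ freqDom S (h / 2)) (hr : IsRealPt x) :
    IsRealPt (stepMap P K φ V x) := by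
  have hφ := L.φ_real _ hω hr.2.2
  have hV := L.V_real _ hθ _ (φ_mem H L hω) hr.2.1 hφ
  have hA : IsRealVec (actionShift P K ((x.1.1, V (x.1.2, φ x.2)), φ x.2)) := fun i =>
    H.fderiv_genFun_real (x := ((x.1.1, V (x.1.2, φ x.2)), φ x.2)) (φ_mem H L hω) ⟨hr.1, hV, hφ⟩
      (StepData.isRealVec_single i)
  exact ⟨IsRealVec.add hr.1 hA, hV, hφ⟩

theorem inGroup_stepMap (H : StepData n α τ r s σ K h η ε S P)
    (L : StepSol n α τ r s σ K h ε S P φ V) :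
    InGroup (stepMap P K φ V) (phaseDom n (r / 4) (s - 4 * σ)) (freqDom S (h / 2))
      (phaseDom n r s) (freqDom S h) where
  mapsTo x hx := stepMap_mem H L hx
  analytic := analyticOnNhd_of_differentiableOn ((isOpen_phaseDom _ _).prod (isOpen_freqDom S _))
    ((differentiableOn_stepMap H L).mono fun x hx => ⟨hx.1.2, hx.2⟩)
  real x hx hr := stepMap_real H L hx.1.2 hx.2 hr
  equivariant x hx k := stepMap_shift H L hx.1.2 hx.2 k
  shape := by
    refine ⟨fun θ ω i => fderiv ℂ (constGen P K) (V (θ, φ ω), φ ω) (Pi.single i 1, 0),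
      fun θ ω => LinearMap.id + LinearMap.pi fun i =>
        ∑ j, fderiv ℂ (angleGen P K) (V (θ, φ ω), φ ω) (Pi.single i 1, 0) j • LinearMap.proj j,
      fun θ ω => V (θ, φ ω), φ, ?_, ?_, fun ω hω => isInvertible_fderiv H L hω⟩
    · intro I θ ω _ hω
      refine Prod.ext (Prod.ext ?_ rfl) rfl
      ext i
      simp only [stepMap, Pi.add_apply, actionShift_eq H (φ_mem H L hω), LinearMap.add_apply,
        LinearMap.id_apply, LinearMap.pi_apply, LinearMap.sum_apply, LinearMap.smul_apply,
        LinearMap.proj_apply, smul_eq_mul]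
      ring
    · intro ω hω ω' hω' heq
      rw [← L.φ_eq ω hω, ← L.φ_eq ω' hω', heq]
  injective ω hω z hz z' hz' heq := by
    have hφ := φ_mem H L hω
    have hV : V (z.2, φ ω) = V (z'.2, φ ω) := congrArg Prod.snd heq
    have hU : z.1 + actionShift P K ((z.1, V (z.2, φ ω)), φ ω) =
      z'.1 + actionShift P K ((z'.1, V (z'.2, φ ω)), φ ω) := congrArg Prod.fst heq
    have hθ : z.2 = z'.2 := by
      rw [← L.V_eq _ hz.2 _ hφ, ← L.V_eq _ hz'.2 _ hφ, hV]
    refine Prod.ext ?_ hθ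
    have h1 := norm_actionShift_sub_le H (I := z'.1) (I' := z.1) hφ (V_mem H L hz.2 hφ)
    rw [← hV] at hU
    have h2 : actionShift P K ((z'.1, V (z.2, φ ω)), φ ω) -
        actionShift P K ((z.1, V (z.2, φ ω)), φ ω) = z.1 - z'.1 := by
      rw [sub_eq_sub_iff_add_eq_add, add_comm, hU.symm, add_comm]
    rw [h2, norm_sub_rev z'.1] at h1
    have : ‖z.1 - z'.1‖ = 0 := by linarith [norm_nonneg (z.1 - z'.1)]
    rwa [norm_eq_zero, sub_eq_zero] at this
  symplectic ω hω z hz u v := symplectic_stepMap H L hz.2 hω u v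

end StepSol

end StepMap

/-! ### Weighted norms and Lipschitz estimates -/

section Weights

variable {n : ℕ}

/-- The linear map `diag(r⁻¹ Id, σ⁻¹ Id, h⁻¹ Id)`. -/
def weightMap (n : ℕ) (r σ h : ℝ) : Ext n →L[ℂ] Ext n :=
  ((((r : ℂ)⁻¹) • ContinuousLinearMap.id ℂ (CVec n)).prodMap
    (((σ : ℂ)⁻¹) • ContinuousLinearMap.id ℂ (CVec n))).prodMap
    (((h : ℂ)⁻¹) • ContinuousLinearMap.id ℂ (CVec n))

/-- This carries Cauchy estimates over to the weighted norm, by composing maps with a complex linear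
one. -/
theorem norm_weightMap {r σ h : ℝ} (hr : 0 < r) (hσ : 0 < σ) (hh : 0 < h) (x : Ext n) :
    ‖weightMap n r σ h x‖ = weightedNorm r σ h x := by
  simp [weightMap, weightedNorm, Prod.norm_def, norm_smul, abs_of_pos, hr, hσ, hh]

theorem weightedNorm_nonneg {r σ h : ℝ} (hh : 0 < h) (x : Ext n) : 0 ≤ weightedNorm r σ h x :=
  le_max_of_le_right (by positivity)

theorem weightedNorm_le_iff {r σ h : ℝ} (hr : 0 < r) (hσ : 0 < σ) (hh : 0 < h) {x : Ext n}
    {B : ℝ} : weightedNorm r σ h x ≤ B ↔ ‖x.1.1‖ ≤ r * B ∧ ‖x.1.2‖ ≤ σ * B ∧ ‖x.2‖ ≤ h * B := by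
  simp only [weightedNorm, max_le_iff, inv_mul_le_iff₀ hr, inv_mul_le_iff₀ hσ, inv_mul_le_iff₀ hh,
    and_assoc]

theorem weightedNorm_add_le {r σ h : ℝ} (hr : 0 < r) (hσ : 0 < σ) (hh : 0 < h) (x y : Ext n) :
    weightedNorm r σ h (x + y) ≤ weightedNorm r σ h x + weightedNorm r σ h y := by
  simp only [← norm_weightMap hr hσ hh, map_add]
  exact norm_add_le _ _

theorem weightedNorm_anti {r σ h r' σ' h' : ℝ} (hr : 0 < r') (hσ : 0 < σ') (hh : 0 < h')
    (hr' : r' ≤ r) (hσ' : σ' ≤ σ) (hh' : h' ≤ h) (x : Ext n) :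
    weightedNorm r σ h x ≤ weightedNorm r' σ' h' x := by
  unfold weightedNorm
  gcongr

/-- A map close to the identity on a domain has a Lipschitz constant close to one on a smaller
domain. -/
theorem weightedNorm_sub_le_of_near_id {F : Ext n → Ext n} {r s σ h B : ℝ} {S : Set (Fin n → ℝ)}
    (hr : 0 < r) (hσ : 0 < σ) (hs : 5 * σ < s) (hh : 0 < h)
    (hF : DifferentiableOn ℂ F (phaseDom n (r / 4) (s - 4 * σ) ×ˢ freqDom S (h / 2)))
    (hB : ∀ x ∈ phaseDom n (r / 4) (s - 4 * σ) ×ˢ freqDom S (h / 2),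
      weightedNorm r σ h (F x - x) ≤ B) {ξ : Fin n → ℝ} (hξ : ξ ∈ S) {x y : Ext n}
    (hx : x.1 ∈ phaseDom n (r / 8) (s - 5 * σ)) (hx' : ‖x.2 - fun i => (ξ i : ℂ)‖ < h / 4)
    (hy : y.1 ∈ phaseDom n (r / 8) (s - 5 * σ)) (hy' : ‖y.2 - fun i => (ξ i : ℂ)‖ < h / 4) :
    weightedNorm r σ h (F x - F y) ≤ (1 + 8 * B) * weightedNorm r σ h (x - y) := by
  set A := phaseDom n (r / 4) (s - 4 * σ) ×ˢ freqDom S (h / 2) with hA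
  set v := x - y with hv
  have hx0 : y + v = x := by rw [hv]; abel
  rcases eq_or_ne v 0 with h0 | h0
  · have : x = y := by rw [← hx0, h0, add_zero]
    have hw : weightedNorm r σ h (0 : Ext n) = 0 := by simp [weightedNorm]
    rw [this, sub_self, h0, hw, mul_zero]
  set w := weightedNorm r σ h v with hw
  have hw0 : 0 < w := by
    refine lt_of_le_of_ne (weightedNorm_nonneg hh _) fun hc => h0 ?_
    have := (weightedNorm_le_iff hr hσ hh).1 hc.symm.le
    simp only [mul_zero, norm_le_zero_iff] at this
    exact Prod.ext (Prod.ext this.1 this.2.1) this.2.2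
  obtain ⟨w1, w2, w3⟩ := (weightedNorm_le_iff hr hσ hh).1 hw.symm.le
  -- A multiple `z v` with `‖z‖ < 1 / (8 w)` moves each component by less than an eighth of its
  -- weight. This fits into the gaps from `r / 8` to `r / 4`, from `s - 5σ` to `s - 4σ`, and from `h
  -- / 4` to `h / 2`. The segment itself stays in the domain because both frequencies lie in one
  -- ball about `ξ`; the union of such balls need not be convex.
  have hmem : ∀ t ∈ Icc (0 : ℝ) 1, ∀ z : ℂ, ‖z‖ < 1 / (8 * w) → y + (t : ℂ) • v + z • v ∈ A := by
    intro t ht z hz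
    have hzw : ‖z‖ * w < 1 / 8 := by
      rw [lt_div_iff₀ (by positivity)] at hz
      linarith
    have key : ∀ {b : CVec n} {c : ℝ}, ‖b‖ ≤ c * w → 0 < c → ‖z • b‖ < c * (1 / 8) := by
      intro b c hb hc
      rw [norm_smul]
      calc ‖z‖ * ‖b‖ ≤ ‖z‖ * (c * w) := by gcongr
        _ = c * (‖z‖ * w) := by ring
        _ < c * (1 / 8) := by gcongr
    have comb : ∀ {a b : CVec n}, a + (t : ℂ) • (b - a) = (1 - t) • a + t • b := by
      intro a b
      ext i
      simp only [Pi.add_apply, Pi.smul_apply, Pi.sub_apply, smul_eq_mul, Complex.real_smul]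
      push_cast
      ring
    have hv1 : v.1.1 = x.1.1 - y.1.1 := rfl
    have hv2 : v.1.2 = x.1.2 - y.1.2 := rfl
    have hv3 : v.2 = x.2 - y.2 := rfl
    refine ⟨⟨?_, ?_⟩, ?_⟩
    · have h1 : ‖y.1.1 + (t : ℂ) • v.1.1‖ < r / 8 := by
        have := (convex_ball (0 : CVec n) (r / 8)) (mem_ball_zero_iff.2 hy.1)
          (mem_ball_zero_iff.2 hx.1) (sub_nonneg.2 ht.2) ht.1 (by ring)
        rwa [mem_ball_zero_iff, ← comb, ← hv1] at this
      have h2 := key w1 hr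
      calc ‖y.1.1 + (t : ℂ) • v.1.1 + z • v.1.1‖ ≤ _ := norm_add_le _ _
        _ < r / 4 := by linarith
    · have h1 : y.1.2 + (t : ℂ) • v.1.2 ∈ strip n (s - 5 * σ) := by
        have hc : Convex ℝ (strip n (s - 5 * σ)) := by
          let L : CVec n →ₗ[ℝ] (Fin n → ℝ) := LinearMap.pi fun i =>
            Complex.imLm ∘ₗ LinearMap.proj i
          have : strip n (s - 5 * σ) = L ⁻¹' Metric.ball 0 (s - 5 * σ) := by
            ext θ
            simp only [mem_preimage, mem_ball_zero_iff]
            rfl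
          rw [this]
          exact (convex_ball _ _).linear_preimage L
        have := hc hy.2 hx.2 (sub_nonneg.2 ht.2) ht.1 (by ring)
        rwa [← comb, ← hv2] at this
      have h2 := key w2 hσ
      have := add_mem_strip (b := σ) (by linarith) hσ.le h1 (y := z • v.1.2) (by linarith)
      exact strip_mono (by linarith) this
    · have h1 : ‖y.2 + (t : ℂ) • v.2 - fun i => (ξ i : ℂ)‖ < h / 4 := by
        have := (convex_ball (fun i => (ξ i : ℂ) : CVec n) (h / 4)) (mem_ball_iff_norm.2 hy')
          (mem_ball_iff_norm.2 hx') (sub_nonneg.2 ht.2) ht.1 (by ring)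
        rwa [mem_ball_iff_norm, ← comb, ← hv3] at this
      have h2 := key w3 hh
      refine freqDom_mono ?_ (add_mem_freqDom (b := h / 8) (y := z • v.2) ⟨ξ, hξ, h1⟩
        (by linarith))
      linarith
  have hopen : IsOpen A := (isOpen_phaseDom _ _).prod (isOpen_freqDom S _)
  have h1 := norm_sub_le_of_segment (f := fun x => weightMap n r σ h (F x - x)) (x := y) (v := v)
    (M := B) (R := 1 / (8 * w)) (by positivity)
    (fun t ht z hz => DifferentiableAt.comp (g := weightMap n r σ h) (f := fun x => F x - x) _
      (ContinuousLinearMap.differentiableAt _) ((hF.differentiableAt (hopen.mem_nhds (hmem t ht z hz))).sub differentiableAt_id))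
    (fun t ht z hz => by
      rw [norm_weightMap hr hσ hh]
      exact hB _ (hmem t ht z hz))
  rw [← map_sub, norm_weightMap hr hσ hh, hx0] at h1
  have h2 : F x - F y = (F x - x - (F y - y)) + v := by rw [hv]; abel
  rw [h2]
  refine (weightedNorm_add_le hr hσ hh _ _).trans ?_
  have h3 : B / (1 / (8 * w)) = 8 * B * w := by field_simp
  rw [h3] at h1
  linarith

end Weights

/-! ### The new normal form and the new perturbation -/

section Remainder

variable {n : ℕ} {α τ r s σ K h η ε : ℝ} {S : Set (Fin n → ℝ)} {P : Ext n → ℂ}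
  {φ : CVec n → CVec n} {V : CVec n × CVec n → CVec n} {e : CVec n → ℂ}

/-- The energy of the new normal form. -/
def stepEnergy (P : Ext n → ℂ) (φ : CVec n → CVec n) (e : CVec n → ℂ) (ω : CVec n) : ℂ :=
  e (φ ω) + angleMean (torusPart P) (φ ω)

/-- The new perturbation. -/
def stepRemainder (P : Ext n → ℂ) (K : ℝ) (φ : CVec n → CVec n) (V : CVec n × CVec n → CVec n)
    (e : CVec n → ℂ) (x : Ext n) : ℂ :=
  normalForm e (stepMap P K φ V x) + P (stepMap P K φ V x) - normalForm (stepEnergy P φ e) x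

namespace StepSol

theorem weightedNorm_stepMap_sub_le (H : StepData n α τ r s σ K h η ε S P)
    (L : StepSol n α τ r s σ K h ε S P φ V) {x : Ext n}
    (hx : x ∈ phaseDom n (r / 4) (s - 4 * σ) ×ˢ freqDom S (h / 2)) :
    weightedNorm r σ h (stepMap P K φ V x - x) ≤
      2 * n * homConst n τ * (ε / (α * r * σ ^ (τ + 1)) + ε / (r * h)) := by
  have hr := H.r_pos
  have hσ := H.σ_pos
  have hh := H.h_pos
  have hε := H.ε_pos
  have hn := H.one_le_n
  have hC := one_le_homConst n τ
  have hδ := H.stepSize_pos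
  have hφ := φ_mem H L hx.2
  have hV := V_mem H L hx.1.2 hφ
  have hb : 0 < ε / (r * h) := by positivity
  have e1 : 2 * n * homConst n τ * (ε / (α * r * σ ^ (τ + 1)) + ε / (r * h)) =
      2 * n * stepSize n α τ r σ ε + 2 * (n * homConst n τ) * (ε / (r * h)) := by
    rw [stepSize]; ring
  have hnC : 1 ≤ n * homConst n τ := by nlinarith
  rw [e1, weightedNorm_le_iff hr hσ hh]
  refine ⟨?_, ?_, ?_⟩
  · have h1 := norm_actionShift_le H (x := ((x.1.1, V (x.1.2, φ x.2)), φ x.2)) hφ hV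
      (by have := hx.1.1; simp only; linarith)
    have h2 : (stepMap P K φ V x - x).1.1 =
        actionShift P K ((x.1.1, V (x.1.2, φ x.2)), φ x.2) := by simp [stepMap]
    rw [h2]
    refine h1.trans ?_
    have : 0 ≤ r * (2 * (n * homConst n τ) * (ε / (r * h))) := by positivity
    linarith
  · refine (L.V_sub _ hx.1.2 _ hφ).trans ?_
    rw [mul_comm]
    refine mul_le_mul_of_nonneg_left ?_ hσ.le
    have : 0 ≤ 2 * (n * homConst n τ) * (ε / (r * h)) := by positivity
    nlinarith
  · refine (L.φ_sub _ hx.2).trans ?_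
    have h3 : ε / r = h * (ε / (r * h)) := by field_simp
    rw [h3]
    refine mul_le_mul_of_nonneg_left ?_ hh.le
    have : 0 ≤ 2 * n * stepSize n α τ r σ ε := by positivity
    nlinarith

/-- This is where the homological equation enters: composing `⟨ω, I⟩` with the transformation
produces the derivative of the generating function along `ω`. -/
theorem sum_mul_actionShift (H : StepData n α τ r s σ K h η ε S P) {I θ ω : CVec n}
    (hω : ω ∈ freqDom S h) :
    ∑ i, ω i * actionShift P K ((I, θ), ω) i =
      -(∑ j, fderiv ℂ (homSol (actionPart P j) K) (θ, ω) (ω, 0) * I j +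
        fderiv ℂ (homSol (torusPart P) K) (θ, ω) (ω, 0)) := by
  have h1 : ∑ i, ω i * actionShift P K ((I, θ), ω) i =
      fderiv ℂ (genFun P K) ((I, θ), ω) ((0, ω), 0) := by
    have := apply_inr_eq_sum ((fderiv ℂ (genFun P K) ((I, θ), ω)).comp
      (ContinuousLinearMap.inl ℂ (Phase n) (CVec n))) ω
    simpa [actionShift] using this.symm
  have h2 : ∀ j, fderiv ℂ (angleGen P K) (θ, ω) (ω, 0) j =
      -fderiv ℂ (homSol (actionPart P j) K) (θ, ω) (ω, 0) := fun j => by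
    have hd := hasFDerivAt_pi'.1 (H.differentiableAt_angleGen (θ := θ) hω).hasFDerivAt j
    have hh : HasFDerivAt (fun p => angleGen P K p j) _ (θ, ω) :=
      ((H.homData_actionPart j).differentiableOn_homSol.differentiableAt
        ((isOpen_univ.prod (isOpen_freqDom S h)).mem_nhds ⟨trivial, hω⟩)).hasFDerivAt.neg
    exact DFunLike.congr_fun (hd.unique hh) (ω, 0)
  have h3 : fderiv ℂ (constGen P K) (θ, ω) (ω, 0) =
      -fderiv ℂ (homSol (torusPart P) K) (θ, ω) (ω, 0) := by
    have : constGen P K = -homSol (torusPart P) K := rfl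
    rw [this, fderiv_neg]
    rfl
  rw [h1, H.fderiv_genFun_angle hω, h3]
  simp only [h2, neg_mul, Finset.sum_neg_distrib, neg_add]

/-- The means cancel exactly, by the new energy and by the equation for `φ`. Four errors remain: the
motion of `P` by the action shift, its Taylor remainder in `I`, and the truncation errors of order
zero and one in `I`. -/
theorem stepRemainder_eq (H : StepData n α τ r s σ K h η ε S P)
    (L : StepSol n α τ r s σ K h ε S P φ V) {I θ ω v ω' : CVec n} (hω : ω ∈ freqDom S (h / 2))
    (hv : V (θ, φ ω) = v) (hω' : φ ω = ω') :
    stepRemainder P K φ V e ((I, θ), ω) =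
      (P (stepMap P K φ V ((I, θ), ω)) - P ((I, v), ω')) +
      (P ((I, v), ω') - P ((0, v), ω') - fderiv ℂ P ((0, v), ω') ((I, 0), 0)) +
      (torusPart P (v, ω') - angleMean (torusPart P) ω' -
        fderiv ℂ (homSol (torusPart P) K) (v, ω') (ω', 0)) +
      ∑ j, I j * (actionPart P j (v, ω') - angleMean (actionPart P j) ω' -
        fderiv ℂ (homSol (actionPart P j) K) (v, ω') (ω', 0)) := by
  have hmem := φ_mem H L hω
  rw [hω'] at hmem hv
  have h1 := sum_mul_actionShift H (I := I) (θ := v) hmem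
  have h2 : fderiv ℂ P ((0, v), ω') ((I, 0), 0) = ∑ j, I j * actionPart P j (v, ω') := by
    have := apply_inl_eq_sum ((fderiv ℂ P ((0, v), ω')).comp
      (ContinuousLinearMap.inl ℂ (Phase n) (CVec n))) I
    simpa [actionPart] using this
  have h3 : ∀ i, ω i = ω' i + angleMean (actionPart P i) ω' := fun i => by
    have := congrFun (L.φ_eq ω hω) i
    rw [hω'] at this
    exact this.symm
  have h4 : ∑ i, ω i * I i = ∑ i, ω' i * I i + ∑ i, I i * angleMean (actionPart P i) ω' := by
    rw [← Finset.sum_add_distrib]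
    refine Finset.sum_congr rfl fun i _ => ?_
    rw [h3 i]
    ring
  have h5 : ∑ j, fderiv ℂ (homSol (actionPart P j) K) (v, ω') (ω', 0) * I j =
      ∑ j, I j * fderiv ℂ (homSol (actionPart P j) K) (v, ω') (ω', 0) :=
    Finset.sum_congr rfl fun j _ => mul_comm _ _
  rw [h2]
  simp only [stepRemainder, normalForm, stepEnergy, h4, mul_sub, Finset.sum_sub_distrib]
  simp only [stepMap, hv, hω', Pi.add_apply, mul_add, Finset.sum_add_distrib, h1, h5, torusPart]
  ring

/-- The first error is a small displacement times a Cauchy bound for `∂_I P`, the second is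
quadratic in `η`, and the last two carry the factor `K^n e^{-Kσ}`. -/
theorem norm_stepRemainder_le (H : StepData n α τ r s σ K h η ε S P)
    (L : StepSol n α τ r s σ K h ε S P φ V) {x : Ext n}
    (hx : x ∈ phaseDom n (η * r) (s - 4 * σ) ×ˢ freqDom S (h / 2)) :
    ‖stepRemainder P K φ V e x‖ ≤ 8 * n * homConst n τ *
      (ε / (α * r * σ ^ (τ + 1)) + η ^ 2 + K ^ n * Real.exp (-(K * σ))) * ε := by
  obtain ⟨⟨I, θ⟩, ω⟩ := x
  obtain ⟨⟨hI, hθ⟩, hω⟩ := hx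
  simp only at hI hθ hω
  have hr := H.r_pos
  have hσ := H.σ_pos
  have hε := H.ε_pos
  have hη := H.η_pos
  have hη8 := H.η_le
  have hn := H.one_le_n
  have hC := one_le_homConst n τ
  have hδ := H.stepSize_pos
  have hnδ := H.n_mul_stepSize_le
  have hω' := φ_mem H L hω
  have hv3 := V_mem H L hθ hω'
  rw [stepRemainder_eq H L hω rfl rfl]
  set v := V (θ, φ ω)
  set ω' := φ ω
  have hv2 : v ∈ strip n (s - 2 * σ) := strip_mono (by linarith) hv3
  have hv : v ∈ strip n s := strip_mono (by linarith) hv3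
  have hI' : ‖I‖ < r / 8 := hI.trans_le (by nlinarith)
  have hmem : ∀ I : CVec n, ‖I‖ < r → (((I, v), ω') : Ext n) ∈ phaseDom n r s ×ˢ freqDom S h :=
    fun I hI => ⟨⟨hI, hv⟩, hω'⟩
  have hd : ∀ I : CVec n, ‖I‖ < r → DifferentiableAt ℂ P ((I, v), ω') :=
    fun I hI => (H.realAnalytic.analytic _ (hmem I hI)).differentiableAt
  have t1 : ‖P (stepMap P K φ V ((I, θ), ω)) - P ((I, v), ω')‖ ≤
      4 * n * stepSize n α τ r σ ε * ε := by
    set u := actionShift P K ((I, v), ω')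
    have hu : ‖u‖ ≤ 2 * n * stepSize n α τ r σ ε * r :=
      norm_actionShift_le H (x := ((I, v), ω')) hω' hv3 (by simp only; linarith)
    have e1 : stepMap P K φ V ((I, θ), ω) = ((I, v), ω') + ((u, 0), 0) := by
      simp [stepMap, u, v, ω']
    have e2 : ∀ t z : ℂ, (((I, v), ω') : Ext n) + t • ((u, 0), 0) + z • ((u, 0), 0) =
        ((I + t • u + z • u, v), ω') := by simp
    -- As `‖u‖ ≤ 2 n δ r` with `δ` the step size, `z u` has norm at most `r / 2` on this disc; the
    -- three summands are bounded by `r / 8`, `r / 16` and `r / 2`.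
    have hsmall : ∀ t ∈ Icc (0 : ℝ) 1, ∀ z : ℂ, ‖z‖ < 1 / (4 * n * stepSize n α τ r σ ε) →
        ‖I + (t : ℂ) • u + z • u‖ < r := by
      intro t ht z hz
      have h1 : ‖(t : ℂ) • u‖ ≤ 2 * n * stepSize n α τ r σ ε * r := by
        rw [norm_smul, Complex.norm_real, Real.norm_eq_abs, abs_of_nonneg ht.1]
        nlinarith [norm_nonneg u, ht.2]
      have h2 : ‖z • u‖ ≤ r / 2 := by
        rw [norm_smul]
        rw [lt_div_iff₀ (by positivity)] at hz
        calc ‖z‖ * ‖u‖ ≤ ‖z‖ * (2 * n * stepSize n α τ r σ ε * r) := by gcongr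
          _ = ‖z‖ * (4 * n * stepSize n α τ r σ ε) * (r / 2) := by ring
          _ ≤ 1 * (r / 2) := by gcongr
          _ = r / 2 := one_mul _
      have h3 := norm_add₃_le (a := I) (b := (t : ℂ) • u) (c := z • u)
      nlinarith
    rw [e1]
    refine (norm_sub_le_of_segment (M := ε) (R := 1 / (4 * n * stepSize n α τ r σ ε))
      (by positivity) ?_ ?_).trans (le_of_eq ?_)
    · intro t ht z hz
      rw [e2]
      exact hd _ (hsmall t ht z hz)
    · intro t ht z hz
      rw [e2]
      exact H.bound _ (hmem _ (hsmall t ht z hz))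
    · field_simp
  have t2 : ‖P ((I, v), ω') - P ((0, v), ω') - fderiv ℂ P ((0, v), ω') ((I, 0), 0)‖ ≤
      8 * η ^ 2 * ε := by
    have e1 : (((I, v), ω') : Ext n) = ((0, v), ω') + ((I, 0), 0) := by simp
    have e2 : ∀ z : ℂ, (((0, v), ω') : Ext n) + z • ((I, 0), 0) = ((z • I, v), ω') := by simp
    -- Since `‖I‖ < η r`, the line through `I` may be followed up to `‖z‖ < 1 / η`, which turns the
    -- Taylor bound `8 M / R²` into `8 η² ε`.
    have hsmall : ∀ z : ℂ, ‖z‖ < 1 / η → ‖z • I‖ < r := by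
      intro z hz
      rw [lt_div_iff₀ hη] at hz
      rw [norm_smul]
      calc ‖z‖ * ‖I‖ ≤ ‖z‖ * (η * r) := by gcongr
        _ = ‖z‖ * η * r := by ring
        _ < 1 * r := by gcongr
        _ = r := one_mul _
    rw [e1]
    refine (norm_taylor_remainder_le (M := ε) (R := 1 / η) ?_ ?_ ?_).trans (le_of_eq ?_)
    · rw [le_div_iff₀ hη]; linarith
    · intro z hz
      rw [e2]
      exact hd _ (hsmall z hz)
    · intro z hz
      rw [e2]
      exact H.bound _ (hmem _ (hsmall z hz))
    · field_simp
  set T := K ^ n * Real.exp (-(K * σ))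
  have hT : 0 ≤ T := by have := H.one_le_K; positivity
  have t3 := H.homData_torusPart.norm_homological_error_le hω' hv2
  have t4 : ‖∑ j, I j * (actionPart P j (v, ω') - angleMean (actionPart P j) ω' -
        fderiv ℂ (homSol (actionPart P j) K) (v, ω') (ω', 0))‖ ≤ n * homConst n τ * T * ε := by
    refine (norm_sum_le _ _).trans ?_
    calc ∑ j, ‖I j * (actionPart P j (v, ω') - angleMean (actionPart P j) ω' -
          fderiv ℂ (homSol (actionPart P j) K) (v, ω') (ω', 0))‖
        ≤ ∑ _j : Fin n, r * (homConst n τ * T * (ε / r)) := by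
          refine Finset.sum_le_sum fun j _ => ?_
          rw [norm_mul]
          exact mul_le_mul ((norm_le_pi_norm I j).trans (by linarith))
            ((H.homData_actionPart j).norm_homological_error_le hω' hv2) (norm_nonneg _) hr.le
      _ = n * homConst n τ * T * ε := by
          simp
          field_simp
  refine (norm_add₃_le.trans (add_le_add_left (add_le_add (norm_add_le _ _) t3) _)).trans ?_
  have e3 : 8 * n * homConst n τ * (ε / (α * r * σ ^ (τ + 1)) + η ^ 2 + T) * ε =
      8 * n * stepSize n α τ r σ ε * ε + 8 * (n * homConst n τ) * η ^ 2 * ε +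
        8 * (n * homConst n τ) * T * ε := by
    rw [stepSize]; ring
  rw [e3]
  have h1 : 0 ≤ n * stepSize n α τ r σ ε * ε := by positivity
  have hnC : 1 ≤ n * homConst n τ := by nlinarith
  have h2 : η ^ 2 * ε ≤ (n * homConst n τ) * (η ^ 2 * ε) := le_mul_of_one_le_left (by positivity) hnC
  have h3 : homConst n τ * (T * ε) ≤ n * (homConst n τ * (T * ε)) :=
    le_mul_of_one_le_left (by positivity) hn
  have h4 : 0 ≤ n * (homConst n τ * (T * ε)) := by positivity
  linarith

end StepSol

theorem normalForm_shift (e : CVec n → ℂ) (k : Fin n → ℤ) (x : Ext n) :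
    normalForm e (shift k x) = normalForm e x := rfl

theorem normalForm_real {O : Set (CVec n)} (he : IsRealAnalyticFreq e O) {x : Ext n}
    (hx : x.2 ∈ O) (hr : IsRealPt x) : (normalForm e x).im = 0 := by
  simp [normalForm, he.real _ hx hr.2.2, hr.1 _, hr.2.2 _]

theorem analyticAt_normalForm {O : Set (CVec n)} (he : IsRealAnalyticFreq e O) {x : Ext n}
    (hx : x.2 ∈ O) : AnalyticAt ℂ (normalForm e) x := by
  unfold normalForm
  refine AnalyticAt.fun_add ((he.analytic _ hx).fun_comp analyticAt_snd) ?_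
  refine Finset.analyticAt_fun_sum _ fun i _ => ?_
  have h1 : AnalyticAt ℂ (fun x : Ext n => x.2 i) x :=
    ((ContinuousLinearMap.proj (R := ℂ) (φ := fun _ : Fin n => ℂ) i).comp
      (ContinuousLinearMap.snd ℂ (Phase n) (CVec n))).analyticAt x
  have h2 : AnalyticAt ℂ (fun x : Ext n => x.1.1 i) x :=
    (((ContinuousLinearMap.proj (R := ℂ) (φ := fun _ : Fin n => ℂ) i).comp
      (ContinuousLinearMap.fst ℂ (CVec n) (CVec n))).comp
      (ContinuousLinearMap.fst ℂ (Phase n) (CVec n))).analyticAt x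
  exact h1.fun_mul h2

/-- One step of the iteration. -/
theorem StepData.exists_step (H : StepData n α τ r s σ K h η ε S P)
    (he : IsRealAnalyticFreq e (freqDom S h)) :
    ∃ (F : Ext n → Ext n) (e' : CVec n → ℂ) (P' : Ext n → ℂ),
      InGroup F (phaseDom n (r / 4) (s - 4 * σ)) (freqDom S (h / 2)) (phaseDom n r s)
        (freqDom S h) ∧
      IsRealAnalyticFreq e' (freqDom S (h / 2)) ∧
      IsRealAnalytic P' (phaseDom n (r / 4) (s - 4 * σ) ×ˢ freqDom S (h / 2)) ∧
      (∀ x, normalForm e (F x) + P (F x) = normalForm e' x + P' x) ∧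
      (∀ x ∈ phaseDom n (η * r) (s - 4 * σ) ×ˢ freqDom S (h / 2), ‖P' x‖ ≤
        8 * n * homConst n τ *
          (ε / (α * r * σ ^ (τ + 1)) + η ^ 2 + K ^ n * Real.exp (-(K * σ))) * ε) ∧
      ∀ x ∈ phaseDom n (r / 4) (s - 4 * σ) ×ˢ freqDom S (h / 2),
        weightedNorm r σ h (F x - x) ≤
          2 * n * homConst n τ * (ε / (α * r * σ ^ (τ + 1)) + ε / (r * h)) := by
  obtain ⟨φ, V, L⟩ := H.exists_stepSol
  have hF := StepSol.inGroup_stepMap H L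
  have he' : IsRealAnalyticFreq (stepEnergy P φ e) (freqDom S (h / 2)) := by
    constructor
    · refine analyticOnNhd_of_differentiableOn (isOpen_freqDom S _) ?_
      have hm : MapsTo φ (freqDom S (h / 2)) (freqDom S h) := fun ω hω => StepSol.φ_mem H L hω
      exact (he.analytic.differentiableOn.comp L.φ_diff hm).add
        ((H.homData_torusPart.differentiableOn_fcoeff 0).comp L.φ_diff hm)
    · intro ω hω hr
      have h1 := StepSol.φ_mem H L hω
      have h2 := L.φ_real ω hω hr
      rw [stepEnergy, Complex.add_im, he.real _ h1 h2, H.homData_torusPart.angleMean_real h1 h2,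
        add_zero]
  refine ⟨stepMap P K φ V, stepEnergy P φ e, stepRemainder P K φ V e, hF, he', ⟨?_, ?_, ?_⟩,
    fun x => by simp [stepRemainder], fun x hx => StepSol.norm_stepRemainder_le H L hx,
    fun x hx => StepSol.weightedNorm_stepMap_sub_le H L hx⟩
  · intro x hx
    have h1 := hF.mapsTo hx
    exact (((analyticAt_normalForm he h1.2).comp (hF.analytic x hx)).add
      ((H.realAnalytic.analytic _ h1).comp (hF.analytic x hx))).sub
      (analyticAt_normalForm he' hx.2)
  · intro x hx hr
    have h1 := hF.mapsTo hx
    have h2 := hF.real x hx hr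
    simp [stepRemainder, normalForm_real he h1.2 h2, H.realAnalytic.real _ h1 h2,
      normalForm_real he' hx.2 hr]
  · intro x hx k
    rw [stepRemainder, hF.equivariant x hx, normalForm_shift, normalForm_shift,
      H.realAnalytic.periodic _ (hF.mapsTo hx), stepRemainder]

end Remainder

/-! ### The group of transformations -/

section Group

open Filter Topology

variable {n : ℕ}

namespace InGroup

theorem mono {F : Ext n → Ext n} {D D₁ D' : Set (Phase n)} {O O₁ O' : Set (CVec n)}
    (hF : InGroup F D O D' O') (hD : D₁ ⊆ D) (hO : O₁ ⊆ O) : InGroup F D₁ O₁ D' O' where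
  mapsTo := hF.mapsTo.mono_left (prod_mono hD hO)
  analytic := hF.analytic.mono (prod_mono hD hO)
  real x hx := hF.real x ⟨hD hx.1, hO hx.2⟩
  equivariant x hx := hF.equivariant x ⟨hD hx.1, hO hx.2⟩
  shape := by
    obtain ⟨b, A, V, φ, h1, h2, h3⟩ := hF.shape
    exact ⟨b, A, V, φ, fun I θ ω h h' => h1 I θ ω (hD h) (hO h'), h2.mono hO,
      fun ω h => h3 ω (hO h)⟩
  injective ω hω := (hF.injective ω (hO hω)).mono hD
  symplectic ω hω z hz := hF.symplectic ω (hO hω) z (hD hz)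

theorem id (D : Set (Phase n)) (O : Set (CVec n)) : InGroup id D O D O where
  mapsTo := mapsTo_id _
  analytic := analyticOnNhd_id
  real _ _ h := h
  equivariant _ _ _ := rfl
  shape := by
    refine ⟨fun _ _ => 0, fun _ _ => LinearMap.id, fun θ _ => θ, fun ω => ω,
      fun I θ ω _ _ => by simp, injOn_id _, fun ω _ => ?_⟩
    rw [fderiv_fun_id]
    exact ⟨ContinuousLinearEquiv.refl ℂ (CVec n), rfl⟩
  injective _ _ := injOn_id _
  symplectic ω _ z _ u v := by
    have : (fun w : Phase n => (_root_.id (w, ω) : Ext n).1) = fun w => w := rfl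
    rw [this, fderiv_fun_id]
    rfl

/-- `InGroup` asks only that `fderiv` of the parameter map be invertible. At a point of
non-differentiability `fderiv` is 0 by default, and 0 is invertible only on a trivial space, where
every map is differentiable. -/
theorem differentiableAt_of_isInvertible {f : CVec n → CVec n} {x : CVec n}
    (h : (fderiv ℂ f x).IsInvertible) : DifferentiableAt ℂ f x := by
  by_contra hc
  rw [fderiv_zero_of_not_differentiableAt hc] at h
  have : Subsingleton (CVec n) := ⟨fun a b => h.injective rfl⟩
  exact hc (hasFDerivAt_of_subsingleton f x).differentiableAt

/-- A point of `D₂` is needed to deduce from the mapping property of `F` that its parameter map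
sends `O₂` into `O₁`. Openness of `D₂` lets derivatives be computed from the formula valid on `D₂`
only. -/
theorem comp {F G : Ext n → Ext n} {D₂ D₁ D₀ : Set (Phase n)} {O₂ O₁ O₀ : Set (CVec n)}
    (hG : InGroup G D₁ O₁ D₀ O₀) (hF : InGroup F D₂ O₂ D₁ O₁) (hD : IsOpen D₂)
    (hne : D₂.Nonempty) : InGroup (G ∘ F) D₂ O₂ D₀ O₀ := by
  obtain ⟨b, A, V, φ, hs, hφ, hφ'⟩ := hF.shape
  obtain ⟨b₁, A₁, V₁, φ₁, hs₁, hφ₁, hφ₁'⟩ := hG.shape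
  obtain ⟨z₀, hz₀⟩ := hne
  have hmaps : MapsTo φ O₂ O₁ := fun ω hω => by
    have := (hF.mapsTo (show (z₀, ω) ∈ D₂ ×ˢ O₂ from ⟨hz₀, hω⟩)).2
    rwa [hs z₀.1 z₀.2 ω hz₀ hω] at this
  have h2 : ∀ z ∈ D₂, ∀ ω ∈ O₂, F (z, ω) = ((F (z, ω)).1, φ ω) := fun z hz ω hω => by
    rw [hs z.1 z.2 ω hz hω]
  exact
  { mapsTo := hG.mapsTo.comp hF.mapsTo
    analytic := hG.analytic.comp hF.analytic hF.mapsTo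
    real := fun x hx hr => hG.real _ (hF.mapsTo hx) (hF.real x hx hr)
    equivariant := fun x hx k => by
      rw [Function.comp_apply, hF.equivariant x hx, hG.equivariant _ (hF.mapsTo hx)]
      rfl
    shape := by
      refine ⟨fun θ ω => b₁ (V θ ω) (φ ω) + A₁ (V θ ω) (φ ω) (b θ ω),
        fun θ ω => (A₁ (V θ ω) (φ ω)).comp (A θ ω), fun θ ω => V₁ (V θ ω) (φ ω),
        fun ω => φ₁ (φ ω), fun I θ ω h h' => ?_, hφ₁.comp hφ hmaps, fun ω hω => ?_⟩
      · have hm := hF.mapsTo (show ((I, θ), ω) ∈ D₂ ×ˢ O₂ from ⟨h, h'⟩)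
        rw [hs I θ ω h h'] at hm
        rw [Function.comp_apply, hs I θ ω h h', hs₁ _ _ _ hm.1 hm.2, map_add, add_assoc]
        rfl
      · have h3 := fderiv_fun_comp ω (differentiableAt_of_isInvertible (hφ₁' _ (hmaps hω)))
          (differentiableAt_of_isInvertible (hφ' ω hω))
        rw [h3]
        exact (hφ₁' _ (hmaps hω)).comp (hφ' ω hω)
    injective := fun ω hω z hz z' hz' heq => by
      refine hF.injective ω hω hz hz' (hG.injective (φ ω) (hmaps hω)
        (hF.mapsTo ⟨hz, hω⟩).1 (hF.mapsTo ⟨hz', hω⟩).1 ?_)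
      simp only [Function.comp_apply] at heq ⊢
      rwa [← h2 z hz ω hω, ← h2 z' hz' ω hω]
    symplectic := fun ω hω z hz u v => by
      have h3 : (fun w => ((G ∘ F) (w, ω)).1) =ᶠ[𝓝 z]
          (fun w => (G (w, φ ω)).1) ∘ fun w => (F (w, ω)).1 := by
        filter_upwards [hD.mem_nhds hz] with w hw
        simp only [Function.comp_apply]
        rw [← h2 w hw ω hω]
      have hd : DifferentiableAt ℂ (fun w => (F (w, ω)).1) z :=
        (DifferentiableAt.comp (g := F) (f := fun w : Phase n => (w, ω)) z
          (hF.analytic _ ⟨hz, hω⟩).differentiableAt (by fun_prop)).fst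
      have hm : (F (z, ω)).1 ∈ D₁ := (hF.mapsTo (show (z, ω) ∈ D₂ ×ˢ O₂ from ⟨hz, hω⟩)).1
      have hd₁ : DifferentiableAt ℂ (fun w => (G (w, φ ω)).1) (F (z, ω)).1 :=
        (DifferentiableAt.comp (g := G) (f := fun w : Phase n => (w, φ ω)) (F (z, ω)).1
          (hG.analytic ((F (z, ω)).1, φ ω) ⟨hm, hmaps hω⟩).differentiableAt (by fun_prop)).fst
      rw [h3.fderiv_eq, fderiv_comp z hd₁ hd]
      simp only [ContinuousLinearMap.comp_apply]
      rw [hG.symplectic _ (hmaps hω) _ hm, hF.symplectic ω hω z hz] }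

end InGroup

end Group

/-! ### The parameter sequences -/

section Parameters

variable {n : ℕ}

/-- The square root of the constant `c`. -/
def growthConst (n : ℕ) (τ : ℝ) : ℝ := 24 * n * homConst n τ * 2 ^ (τ + 1) * 4 ^ n

/-- The smallness required of `E_0`. -/
def smallConst (n : ℕ) (τ : ℝ) : ℝ := (1 / (2 * (growthConst n τ * 2 ^ (τ + 1)))) ^ 2

namespace Params

/-- Parameters with suitable constants and admissible initial values. -/
structure IsTuned (p : Params) (n : ℕ) : Prop where
  two_le : 2 ≤ n
  lt_τ : (n : ℝ) - 1 < p.τ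
  c_eq : p.c = growthConst n p.τ ^ 2
  c₀_eq : p.c₀ = 128 * n * homConst n p.τ
  α_pos : 0 < p.α
  r₀_pos : 0 < p.r₀
  s₀_pos : 0 < p.s₀
  admissible : p.Admissible n 1 (smallConst n p.τ)

namespace IsTuned

variable {p : Params}

theorem two_le' (T : p.IsTuned n) : (2 : ℝ) ≤ n := by exact_mod_cast T.two_le

theorem τ_pos (T : p.IsTuned n) : 0 < p.τ := by linarith [T.lt_τ, T.two_le']

theorem one_le_two_rpow (T : p.IsTuned n) : (1 : ℝ) ≤ 2 ^ (p.τ + 1) :=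
  Real.one_le_rpow (by norm_num) (by linarith [T.τ_pos])

theorem sixteen_le (T : p.IsTuned n) : (16 : ℝ) ≤ 4 ^ (p.τ + 1) := by
  calc (16 : ℝ) = 4 ^ (2 : ℝ) := by norm_num
    _ ≤ 4 ^ (p.τ + 1) :=
      Real.rpow_le_rpow_of_exponent_le (by norm_num) (by linarith [T.lt_τ, T.two_le'])

theorem le_growthConst (T : p.IsTuned n) :
    24 * n * homConst n p.τ ≤ growthConst n p.τ ∧ (4 : ℝ) ^ n ≤ growthConst n p.τ := by
  have h1 := T.two_le'
  have h2 := one_le_homConst n p.τ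
  have h3 := T.one_le_two_rpow
  have h4 : (1 : ℝ) ≤ 4 ^ n := one_le_pow₀ (by norm_num)
  have h5 : 1 ≤ n * homConst n p.τ := by nlinarith
  have h6 : (1 : ℝ) ≤ 2 ^ (p.τ + 1) * 4 ^ n := by nlinarith
  unfold growthConst
  constructor
  · have : n * homConst n p.τ ≤ n * homConst n p.τ * (2 ^ (p.τ + 1) * 4 ^ n) :=
      le_mul_of_one_le_right (by positivity) h6
    linarith
  · have h7 : 1 ≤ n * homConst n p.τ * 2 ^ (p.τ + 1) := by nlinarith
    have : (4 : ℝ) ^ n ≤ n * homConst n p.τ * 2 ^ (p.τ + 1) * 4 ^ n :=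
      le_mul_of_one_le_left (by positivity) h7
    have : (0 : ℝ) ≤ n * homConst n p.τ * 2 ^ (p.τ + 1) * 4 ^ n := by positivity
    linarith

theorem one_le_growthConst (T : p.IsTuned n) : 1 ≤ growthConst n p.τ :=
  (one_le_pow₀ (by norm_num)).trans T.le_growthConst.2

theorem σ_pos (T : p.IsTuned n) (j : ℕ) : 0 < p.σ j := by
  induction j with
  | zero => have := T.s₀_pos; rw [Params.σ]; positivity
  | succ j ih => rw [Params.σ]; positivity

theorem s_eq (p : Params) (j : ℕ) : p.s j = p.s₀ / 2 + 10 * p.σ j := by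
  induction j with
  | zero => rw [Params.s, Params.σ]; ring
  | succ j ih => rw [Params.s, Params.σ, ih]; ring

theorem one_le_K (T : p.IsTuned n) (j : ℕ) : 1 ≤ p.K j := by
  induction j with
  | zero => exact T.admissible.one_le_K
  | succ j ih => rw [Params.K]; linarith

theorem one_le_Kσ (T : p.IsTuned n) (j : ℕ) : 1 ≤ p.K j * p.σ j := by
  induction j with
  | zero => exact T.admissible.large
  | succ j ih => rw [Params.K, Params.σ]; linarith

theorem E_succ (T : p.IsTuned n) {j : ℕ} (hE : 0 < p.E j) :
    p.E (j + 1) = growthConst n p.τ * (p.E j * √(p.E j)) := by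
  have h1 := T.one_le_growthConst
  rw [Params.E, T.c_eq, κ]
  have e1 : (growthConst n p.τ ^ 2) ^ ((3 / 2 : ℝ) - 1) = growthConst n p.τ := by
    rw [← Real.rpow_natCast, ← Real.rpow_mul (by linarith)]
    norm_num
  have e2 : p.E j ^ (3 / 2 : ℝ) = p.E j * √(p.E j) := by
    rw [Real.sqrt_eq_rpow, show (3 / 2 : ℝ) = 1 + 1 / 2 by norm_num, Real.rpow_add hE,
      Real.rpow_one]
  rw [e1, e2]

/-- `E_j` decreases, so the smallness persists. The truncation condition persists because `K_j σ_j`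
doubles: the exponential is squared, which beats the factor `4^n` from `K_j^n` and the decay of
`E_j`. -/
theorem E_bounds (T : p.IsTuned n) (j : ℕ) : 0 < p.E j ∧
    growthConst n p.τ * 2 ^ (p.τ + 1) * √(p.E j) ≤ 1 / 2 ∧
    p.K j ^ n * Real.exp (-(p.K j * p.σ j)) ≤ p.E j := by
  have hΓ := T.one_le_growthConst
  have h2 := T.one_le_two_rpow
  have hΓ2 : 1 ≤ growthConst n p.τ * 2 ^ (p.τ + 1) := by nlinarith
  induction j with
  | zero =>
    have h3 := T.admissible.truncation
    have h4 := T.admissible.one_le_K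
    refine ⟨lt_of_lt_of_le (by positivity) h3, ?_, h3⟩
    -- `smallConst` is chosen to give precisely this bound.
    have h5 : √(p.E 0) ≤ 1 / (2 * (growthConst n p.τ * 2 ^ (p.τ + 1))) :=
      (Real.sqrt_le_sqrt T.admissible.small).trans
        (by rw [smallConst, Real.sqrt_sq (by positivity)])
    calc growthConst n p.τ * 2 ^ (p.τ + 1) * √(p.E 0)
        ≤ growthConst n p.τ * 2 ^ (p.τ + 1) * (1 / (2 * (growthConst n p.τ * 2 ^ (p.τ + 1)))) := by
          gcongr
      _ = 1 / 2 := by field_simp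
  | succ j ih =>
    obtain ⟨hE, hs, ht⟩ := ih
    have hq : 0 < √(p.E j) := Real.sqrt_pos.2 hE
    have hle : p.E (j + 1) ≤ p.E j := by
      rw [T.E_succ hE]
      have h6 : growthConst n p.τ * √(p.E j) ≤ 1 := by
        have : growthConst n p.τ * √(p.E j) ≤
            growthConst n p.τ * 2 ^ (p.τ + 1) * √(p.E j) := by
          gcongr
          exact le_mul_of_one_le_right (by linarith) h2
        linarith
      nlinarith
    refine ⟨by rw [T.E_succ hE]; positivity, ?_, ?_⟩
    · refine le_trans ?_ hs
      gcongr
    · have hK := T.one_le_K j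
      have hq1 : √(p.E j) ≤ 1 := by nlinarith
      have h7 : Real.exp (-(p.K j * p.σ j)) ≤ √(p.E j) := by
        have h8 : Real.exp (-(p.K j * p.σ j)) ≤ p.E j :=
          (le_mul_of_one_le_left (Real.exp_pos _).le (one_le_pow₀ hK)).trans ht
        nlinarith [Real.sq_sqrt hE.le]
      have h9 : -(p.K (j + 1) * p.σ (j + 1)) = -(p.K j * p.σ j) + -(p.K j * p.σ j) := by
        rw [Params.K, Params.σ]; ring
      -- One exponential factor together with `K_j^n` is at most `E_j`, the other at most `√E_j`;
      -- the factor `4^n` contained in `growthConst` absorbs the growth of `K_j^n`.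
      rw [h9, Real.exp_add, T.E_succ hE, Params.K, mul_pow]
      calc 4 ^ n * p.K j ^ n * (Real.exp (-(p.K j * p.σ j)) * Real.exp (-(p.K j * p.σ j)))
          = 4 ^ n * ((p.K j ^ n * Real.exp (-(p.K j * p.σ j))) * Real.exp (-(p.K j * p.σ j))) := by
            ring
        _ ≤ growthConst n p.τ * (p.E j * √(p.E j)) := by
            gcongr
            exact T.le_growthConst.2

theorem E_pos (T : p.IsTuned n) (j : ℕ) : 0 < p.E j := (T.E_bounds j).1

theorem η_pos (T : p.IsTuned n) (j : ℕ) : 0 < p.η j := Real.sqrt_pos.2 (T.E_pos j)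

theorem η_sq (T : p.IsTuned n) (j : ℕ) : p.η j ^ 2 = p.E j := Real.sq_sqrt (T.E_pos j).le

theorem mul_η_le (T : p.IsTuned n) (j : ℕ) :
    growthConst n p.τ * 2 ^ (p.τ + 1) * p.η j ≤ 1 / 2 := (T.E_bounds j).2.1

theorem homConst_mul_η_le (T : p.IsTuned n) (j : ℕ) : n * homConst n p.τ * p.η j ≤ 1 / 48 := by
  have h1 := T.mul_η_le j
  have h2 := T.one_le_two_rpow
  have h3 := T.le_growthConst.1
  have hη := T.η_pos j
  have hΓ := T.one_le_growthConst
  have h4 : growthConst n p.τ * p.η j ≤ growthConst n p.τ * 2 ^ (p.τ + 1) * p.η j := by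
    gcongr
    exact le_mul_of_one_le_right (by linarith) h2
  nlinarith

theorem η_le (T : p.IsTuned n) (j : ℕ) : p.η j ≤ 1 / 8 := by
  have h1 := T.homConst_mul_η_le j
  have h2 := T.two_le'
  have h3 := one_le_homConst n p.τ
  have hη := T.η_pos j
  have h4 : 1 ≤ n * homConst n p.τ := by nlinarith
  nlinarith

theorem r_pos (T : p.IsTuned n) (j : ℕ) : 0 < p.r j := by
  induction j with
  | zero => exact T.r₀_pos
  | succ j ih => have := T.η_pos j; rw [Params.r]; positivity

theorem h_pos (T : p.IsTuned n) (j : ℕ) : 0 < p.h j := by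
  induction j with
  | zero =>
    have := T.α_pos
    have := T.E_pos 0
    have := T.σ_pos 0
    have := T.two_le'
    have := one_le_homConst n p.τ
    have h0 : 0 < p.c₀ := by rw [T.c₀_eq]; positivity
    have h1 : 0 < p.E₀ := T.E_pos 0
    rw [Params.h]
    positivity
  | succ j ih => rw [Params.h]; positivity

/-- Both sides are divided by `4^ν` at each step, so the initial condition propagates unchanged. -/
theorem h_le (T : p.IsTuned n) (j : ℕ) : p.h j ≤ p.α / (2 * p.K j ^ (p.τ + 1)) := by
  induction j with
  | zero => exact T.admissible.divisors
  | succ j ih =>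
    have hK := T.one_le_K j
    rw [Params.h, Params.K, Real.mul_rpow (by norm_num) (by linarith), Params.ν]
    calc p.h j / 4 ^ (p.τ + 1) ≤ p.α / (2 * p.K j ^ (p.τ + 1)) / 4 ^ (p.τ + 1) := by gcongr
      _ = _ := by field_simp

theorem h_le_σ (T : p.IsTuned n) (j : ℕ) : p.h j ≤ p.α * p.σ j ^ (p.τ + 1) := by
  have hK := T.one_le_K j
  have hσ := T.σ_pos j
  have hα := T.α_pos
  have h1 : 1 ≤ p.K j ^ (p.τ + 1) * p.σ j ^ (p.τ + 1) := by
    rw [← Real.mul_rpow (by linarith) hσ.le]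
    exact Real.one_le_rpow (T.one_le_Kσ j) (by linarith [T.τ_pos])
  refine (T.h_le j).trans ?_
  have hKp : 0 < p.K j ^ (p.τ + 1) := by positivity
  rw [div_le_iff₀ (by positivity)]
  nlinarith

theorem ε_pos (T : p.IsTuned n) (j : ℕ) : 0 < p.ε j := by
  have := T.α_pos
  have := T.E_pos j
  have := T.r_pos j
  have := T.σ_pos j
  unfold Params.ε
  positivity

theorem ε_div_eq (T : p.IsTuned n) (j : ℕ) : p.ε j / (p.α * p.r j * p.σ j ^ (p.τ + 1)) = p.E j := by
  have := T.α_pos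
  have := T.r_pos j
  have := T.σ_pos j
  rw [Params.ε, Params.ν]
  field_simp

/-- It lets the displacement of the frequencies, measured by `ε_j / (r_j h_j)`, dominate those of
actions and angles, which are of order `E_j`. -/
theorem E_le (T : p.IsTuned n) (j : ℕ) : p.E j ≤ p.ε j / (p.r j * p.h j) := by
  have h1 := T.h_le_σ j
  have h2 := T.h_pos j
  have h3 := T.r_pos j
  have h4 := T.E_pos j
  rw [le_div_iff₀ (by positivity), Params.ε, Params.ν]
  calc p.E j * (p.r j * p.h j) ≤ p.E j * (p.r j * (p.α * p.σ j ^ (p.τ + 1))) := by gcongr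
    _ = _ := by ring

theorem σ_succ_rpow (T : p.IsTuned n) (j : ℕ) :
    p.σ (j + 1) ^ (p.τ + 1) = p.σ j ^ (p.τ + 1) / 2 ^ (p.τ + 1) := by
  rw [Params.σ, Real.div_rpow (T.σ_pos j).le (by norm_num)]

theorem four_rpow (x : ℝ) : (4 : ℝ) ^ x = 2 ^ x * 2 ^ x := by
  rw [← Real.mul_rpow (by norm_num) (by norm_num)]
  norm_num

/-- Initially the quotient is `1 / c₀`. Each step multiplies it by `growthConst * 2^ν * √E_j`, which
the smallness of `E_0` keeps below `1 / 2`. -/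
theorem ε_div_le (T : p.IsTuned n) (j : ℕ) :
    p.ε j / (p.r j * p.h j) ≤ 1 / (128 * n * homConst n p.τ) * (1 / 2) ^ j := by
  induction j with
  | zero =>
    have := T.α_pos
    have := T.r_pos 0
    have := T.σ_pos 0
    have := T.E_pos 0
    have h0 : p.E 0 = p.E₀ := rfl
    have := T.two_le'
    have := one_le_homConst n p.τ
    rw [Params.ε, Params.h, T.c₀_eq, ← h0]
    refine le_of_eq ?_
    field_simp
  | succ j ih =>
    have hα := T.α_pos
    have hr := T.r_pos j
    have hr' := T.r_pos (j + 1)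
    have hσ := T.σ_pos j
    have hE := T.E_pos j
    have hh := T.h_pos j
    have e1 : p.ε (j + 1) / (p.r (j + 1) * p.h (j + 1)) =
        (growthConst n p.τ * 2 ^ (p.τ + 1) * p.η j) * (p.ε j / (p.r j * p.h j)) := by
      rw [Params.ε, Params.ν, T.σ_succ_rpow, Params.h, T.E_succ hE, Params.ε, Params.ν, Params.η,
        four_rpow]
      field_simp
    rw [e1, pow_succ]
    have h2 : 0 < p.ε j / (p.r j * p.h j) := by have := T.ε_pos j; positivity
    nlinarith [T.mul_η_le j]

theorem r_succ_le (T : p.IsTuned n) (j : ℕ) : p.r (j + 1) ≤ p.r j / 8 := by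
  rw [Params.r]
  nlinarith [T.η_le j, T.r_pos j]

theorem h_succ_le (T : p.IsTuned n) (j : ℕ) : p.h (j + 1) ≤ p.h j / 16 := by
  rw [Params.h, Params.ν]
  have := T.h_pos j
  have := T.sixteen_le
  gcongr

theorem five_σ_lt (T : p.IsTuned n) (j : ℕ) : 5 * p.σ j < p.s j := by
  rw [s_eq]
  linarith [T.s₀_pos, T.σ_pos j]

/-- Each of the three summands in the bracket is at most `E_j`, which accounts for `24 = 3 * 8` in
`growthConst`; its factor `2^ν` compensates for halving `σ_j` in `ε_{j+1}`. -/
theorem remainder_le (T : p.IsTuned n) (j : ℕ) :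
    8 * n * homConst n p.τ * (p.ε j / (p.α * p.r j * p.σ j ^ (p.τ + 1)) + p.η j ^ 2 +
      p.K j ^ n * Real.exp (-(p.K j * p.σ j))) * p.ε j ≤ p.ε (j + 1) := by
  have hE := T.E_pos j
  have hε := T.ε_pos j
  have hn := T.two_le'
  have hC := one_le_homConst n p.τ
  have e1 : p.ε (j + 1) = 4 ^ n * (24 * n * homConst n p.τ * p.E j * p.ε j) := by
    rw [Params.ε, Params.ν, T.σ_succ_rpow, Params.r, T.E_succ hE, growthConst, Params.η, Params.ε,
      Params.ν]
    have h1 := Real.mul_self_sqrt hE.le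
    have h2 : (2 : ℝ) ^ (p.τ + 1) ≠ 0 := by positivity
    field_simp
    rw [Real.sq_sqrt hE.le]
  rw [e1, T.ε_div_eq, T.η_sq]
  have h4 : (1 : ℝ) ≤ 4 ^ n := one_le_pow₀ (by norm_num)
  calc _ ≤ 8 * n * homConst n p.τ * (p.E j + p.E j + p.E j) * p.ε j := by
        gcongr
        exact (T.E_bounds j).2.2
    _ = 24 * n * homConst n p.τ * p.E j * p.ε j := by ring
    _ ≤ _ := le_mul_of_one_le_left (by positivity) h4

theorem displacement_le (T : p.IsTuned n) (j : ℕ) :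
    2 * n * homConst n p.τ * (p.ε j / (p.α * p.r j * p.σ j ^ (p.τ + 1)) +
      p.ε j / (p.r j * p.h j)) ≤ 4 * n * homConst n p.τ * (p.ε j / (p.r j * p.h j)) := by
  rw [T.ε_div_eq]
  have hn := T.two_le'
  have hC := one_le_homConst n p.τ
  have : 2 * n * homConst n p.τ * p.E j ≤ 2 * n * homConst n p.τ * (p.ε j / (p.r j * p.h j)) := by
    gcongr
    exact T.E_le j
  linarith

theorem mul_ε_div_le (T : p.IsTuned n) (j : ℕ) :
    4 * n * homConst n p.τ * (p.ε j / (p.r j * p.h j)) ≤ (1 / 2) ^ j / 32 := by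
  have hn := T.two_le'
  have hC := one_le_homConst n p.τ
  calc _ ≤ 4 * n * homConst n p.τ * (1 / (128 * n * homConst n p.τ) * (1 / 2) ^ j) := by
        gcongr
        exact T.ε_div_le j
    _ = _ := by
        field_simp
        norm_num

theorem stepData (T : p.IsTuned n) (Ω : Set (Fin n → ℝ)) (j : ℕ) {P : Ext n → ℂ}
    (hP : IsRealAnalytic P (p.D n j ×ˢ p.O Ω j))
    (hb : ∀ x ∈ p.D n j ×ˢ p.O Ω j, ‖P x‖ ≤ p.ε j) :
    StepData n p.α p.τ (p.r j) (p.s j) (p.σ j) (p.K j) (p.h j) (p.η j) (p.ε j)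
      (diophantineSet p.α p.τ Ω) P where
  n_pos := by have := T.two_le; omega
  α_pos := T.α_pos
  τ_nonneg := T.τ_pos.le
  r_pos := T.r_pos j
  σ_pos := T.σ_pos j
  σ_lt := T.five_σ_lt j
  one_le_K := T.one_le_K j
  one_le_Kσ := T.one_le_Kσ j
  h_pos := T.h_pos j
  h_le := T.h_le j
  ε_pos := T.ε_pos j
  η_pos := T.η_pos j
  η_le := T.η_le j
  dioph ξ hξ := hξ.2.1
  realAnalytic := hP
  bound := hb
  small₁ := by
    rw [T.ε_div_eq, ← T.η_sq]
    nlinarith [T.homConst_mul_η_le j, T.η_pos j, T.η_le j]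
  small₂ := by
    have h1 := T.mul_ε_div_le j
    have h2 : ((1 : ℝ) / 2) ^ j ≤ 1 := pow_le_one₀ (by norm_num) (by norm_num)
    linarith

end IsTuned

end Params

end Parameters

/-! ### The iteration -/

section Iteration

open Filter Topology

variable {n : ℕ}

namespace Params

/-- With `E₀ = 1 / (2 c₀ (Kσ)^ν)` the condition on `h₀` is an equality for every `α`. The remaining
conditions hold for large `K`, since `E₀` decays like a power of `K` and the truncation term
exponentially. -/
theorem exists_admissible {τ s₀ c c₀ e₀ : ℝ} (hτ : 0 < τ) (hs₀ : 0 < s₀) (hc₀ : 0 < c₀)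
    (he₀ : 0 < e₀) : ∃ K₀ E₀ : ℝ, ∀ α r₀ : ℝ, 0 < α → 0 < r₀ →
      (Params.mk α τ c c₀ r₀ s₀ K₀ E₀).Admissible n 1 e₀ := by
  set σ := s₀ / 20 with hσ
  have hσ0 : 0 < σ := by positivity
  have l1 : Tendsto (fun K : ℝ => 2 * c₀ * σ ^ (τ + 1) *
      (K ^ (n + (τ + 1)) * Real.exp (-σ * K))) atTop (𝓝 0) := by
    simpa using (tendsto_rpow_mul_exp_neg_mul_atTop_nhds_zero (n + (τ + 1)) σ hσ0).const_mul
      (2 * c₀ * σ ^ (τ + 1))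
  have l2 : Tendsto (fun K : ℝ => K ^ (τ + 1)) atTop atTop :=
    tendsto_rpow_atTop (by linarith)
  obtain ⟨K, hK1, hKσ, h1, h2⟩ := ((eventually_ge_atTop 1).and ((eventually_ge_atTop (1 / σ)).and
    ((l1.eventually_le_const one_pos).and
      (l2.eventually_ge_atTop (1 / (2 * c₀ * σ ^ (τ + 1) * e₀)))))).exists
  have hK0 : 0 < K := by linarith
  have hd : 0 < 2 * c₀ * (K * σ) ^ (τ + 1) := by positivity
  have hm : (K * σ) ^ (τ + 1) = K ^ (τ + 1) * σ ^ (τ + 1) := Real.mul_rpow hK0.le hσ0.le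
  refine ⟨K, 1 / (2 * c₀ * (K * σ) ^ (τ + 1)), fun α r₀ hα hr₀ => ⟨hK1, ?_, ?_, ?_, ?_⟩⟩
  · change 1 ≤ K * σ
    rwa [div_le_iff₀ hσ0] at hKσ
  · change 1 / (2 * c₀ * (K * σ) ^ (τ + 1)) ≤ e₀
    rw [div_le_iff₀ (by positivity)] at h2 ⊢
    rw [hm]
    linarith
  · change K ^ n * Real.exp (-(K * σ)) ≤ 1 / (2 * c₀ * (K * σ) ^ (τ + 1))
    rw [le_div_iff₀ hd, hm]
    rw [Real.rpow_add hK0, Real.rpow_natCast] at h1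
    rw [show -(K * σ) = -σ * K by ring]
    linarith
  · change α * c₀ * (1 / (2 * c₀ * (K * σ) ^ (τ + 1))) * σ ^ (τ + 1) ≤ α / (2 * K ^ (τ + 1))
    rw [hm]
    refine le_of_eq ?_
    field_simp

/-- The hypotheses on the Hamiltonian at the beginning of a step. -/
structure IsControlled (p : Params) (Ω : Set (Fin n → ℝ)) (j : ℕ) (e : CVec n → ℂ)
    (P : Ext n → ℂ) : Prop where
  energy : IsRealAnalyticFreq e (p.O Ω j)
  perturbation : IsRealAnalytic P (p.D n j ×ˢ p.O Ω j)
  bound : ∀ x ∈ p.D n j ×ˢ p.O Ω j, ‖P x‖ ≤ p.ε j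

/-- The conclusions about the transformation of a step. -/
structure IsStep (p : Params) (Ω : Set (Fin n → ℝ)) (j : ℕ) (F : Ext n → Ext n) : Prop where
  inGroup : InGroup F (p.D n (j + 1)) (p.O Ω (j + 1)) (p.D n j) (p.O Ω j)
  near_id : ∀ x ∈ p.D n (j + 1) ×ˢ p.O Ω (j + 1), weightedNorm (p.r j) (p.σ j) (p.h j) (F x - x) ≤
    4 * n * homConst n p.τ * (p.ε j / (p.r j * p.h j))
  lipschitz : ∀ ξ ∈ diophantineSet p.α p.τ Ω, ∀ x y : Ext n, x.1 ∈ p.D n (j + 1) →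
    ‖x.2 - fun i => (ξ i : ℂ)‖ < p.h (j + 1) → y.1 ∈ p.D n (j + 1) →
    ‖y.2 - fun i => (ξ i : ℂ)‖ < p.h (j + 1) →
    weightedNorm (p.r j) (p.σ j) (p.h j) (F x - F y) ≤
      (1 + (1 / 2) ^ j / 4) * weightedNorm (p.r j) (p.σ j) (p.h j) (x - y)

variable {p : Params} {Ω : Set (Fin n → ℝ)}

theorem phaseDom_mono {r r' s s' : ℝ} (hr : r ≤ r') (hs : s ≤ s') :
    phaseDom n r s ⊆ phaseDom n r' s' :=
  fun _ hz => ⟨hz.1.trans_le hr, hz.2.trans_le hs⟩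

namespace IsTuned

theorem D_succ_subset (T : p.IsTuned n) (j : ℕ) : p.D n (j + 1) ⊆ p.D n j :=
  phaseDom_mono (by linarith [T.r_succ_le j, T.r_pos j]) (by
    rw [Params.s]; linarith [T.σ_pos j])

theorem D_nonempty (T : p.IsTuned n) (j : ℕ) : (p.D n j).Nonempty :=
  ⟨0, by simpa using T.r_pos j, by
    have : (fun i => ((0 : Phase n).2 i).im) = 0 := rfl
    rw [this, norm_zero]
    linarith [T.five_σ_lt j, T.σ_pos j]⟩

theorem exists_step (T : p.IsTuned n) {j : ℕ} {e : CVec n → ℂ} {P : Ext n → ℂ}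
    (hc : p.IsControlled Ω j e P) :
    ∃ (F : Ext n → Ext n) (e' : CVec n → ℂ) (P' : Ext n → ℂ), p.IsStep Ω j F ∧
      p.IsControlled Ω (j + 1) e' P' ∧
      ∀ x, normalForm e (F x) + P (F x) = normalForm e' x + P' x := by
  obtain ⟨F, e', P', hF, he', hP', heq, hb, hd⟩ :=
    (T.stepData Ω j hc.perturbation hc.bound).exists_step hc.energy
  have hr := T.r_pos j
  have hσ := T.σ_pos j
  have hh := T.h_pos j
  have hs : p.s (j + 1) = p.s j - 5 * p.σ j := rfl
  -- The step provides its transformation and displacement bound on a larger domain. The gap to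
  -- `D_{j+1} × O_{j+1}` pays for the Cauchy estimate behind the Lipschitz bound.
  have hD : p.D n (j + 1) ⊆ phaseDom n (p.r j / 4) (p.s j - 4 * p.σ j) :=
    phaseDom_mono (by linarith [T.r_succ_le j]) (by linarith)
  have hO : p.O Ω (j + 1) ⊆ freqDom (diophantineSet p.α p.τ Ω) (p.h j / 2) :=
    freqDom_mono (by linarith [T.h_succ_le j])
  have hd' := fun x hx => (hd x hx).trans (T.displacement_le j)
  refine ⟨F, e', P', ⟨hF.mono hD hO, fun x hx => hd' x ⟨hD hx.1, hO hx.2⟩, ?_⟩,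
    ⟨⟨he'.analytic.mono hO, fun ω hω => he'.real ω (hO hω)⟩,
      ⟨hP'.analytic.mono (prod_mono hD hO), fun x hx => hP'.real x ⟨hD hx.1, hO hx.2⟩,
        fun x hx => hP'.periodic x ⟨hD hx.1, hO hx.2⟩⟩, fun x hx => ?_⟩, heq⟩
  · intro ξ hξ x y hx hx' hy hy'
    have hh' : p.h (j + 1) ≤ p.h j / 4 := by linarith [T.h_succ_le j]
    have hD' : p.D n (j + 1) ⊆ phaseDom n (p.r j / 8) (p.s j - 5 * p.σ j) :=
      phaseDom_mono (T.r_succ_le j) hs.le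
    refine (weightedNorm_sub_le_of_near_id hr hσ (T.five_σ_lt j) hh hF.analytic.differentiableOn
      hd' hξ (hD' hx) (hx'.trans_le hh') (hD' hy) (hy'.trans_le hh')).trans ?_
    refine mul_le_mul_of_nonneg_right ?_ (weightedNorm_nonneg hh _)
    linarith [T.mul_ε_div_le j]
  · exact (hb x ⟨phaseDom_mono le_rfl (by linarith) hx.1, hO hx.2⟩).trans (T.remainder_le j)

theorem inGroup_compSeq (T : p.IsTuned n) {F : ℕ → Ext n → Ext n}
    (hF : ∀ j, p.IsStep Ω j (F j)) (j : ℕ) :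
    InGroup (compSeq F j) (p.D n j) (p.O Ω j) (p.D n 0) (p.O Ω 0) := by
  induction j with
  | zero => exact InGroup.id _ _
  | succ j ih => exact ih.comp (hF j).inGroup (isOpen_phaseDom _ _) (T.D_nonempty _)

/-- Membership in `O_j` alone would forget which `ξ` is near. Keeping the same `ξ` allows the
Lipschitz bounds, valid only within one ball, to be chained; `h_j / 16 + h_j / 32 < h_j` leaves
room. -/
theorem mem_ball_of_near_id (T : p.IsTuned n) {F : Ext n → Ext n} {j : ℕ} (hF : p.IsStep Ω j F)
    {ξ : Fin n → ℝ} (hξ : ξ ∈ diophantineSet p.α p.τ Ω) {x : Ext n} (hx : x.1 ∈ p.D n (j + 1))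
    (hx' : ‖x.2 - fun i => (ξ i : ℂ)‖ < p.h (j + 1)) :
    (F x).1 ∈ p.D n j ∧ ‖(F x).2 - fun i => (ξ i : ℂ)‖ < p.h j := by
  have hm : x ∈ p.D n (j + 1) ×ˢ p.O Ω (j + 1) := ⟨hx, ξ, hξ, hx'⟩
  have hh := T.h_pos j
  refine ⟨(hF.inGroup.mapsTo hm).1, ?_⟩
  have h1 := ((weightedNorm_le_iff (T.r_pos j) (T.σ_pos j) hh).1
    ((hF.near_id x hm).trans (T.mul_ε_div_le j))).2.2
  have h2 : ((1 : ℝ) / 2) ^ j ≤ 1 := pow_le_one₀ (by norm_num) (by norm_num)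
  have h3 : p.h j * ((1 / 2) ^ j / 32) ≤ p.h j * (1 / 32) := by gcongr
  calc ‖(F x).2 - fun i => (ξ i : ℂ)‖ = ‖(F x - x).2 + (x.2 - fun i => (ξ i : ℂ))‖ := by
        congr 1
        rw [Prod.snd_sub]
        abel
    _ ≤ _ := norm_add_le _ _
    _ < p.h j := by linarith [T.h_succ_le j]

/-- The weights only grow with `j`, so the one-step bounds can be chained. The constant `2 - 2^{-j}`
is an induction-friendly bound below 2 for the product of the factors `1 + 2^{-j} / 4`. -/
theorem lipschitz_compSeq (T : p.IsTuned n) {F : ℕ → Ext n → Ext n}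
    (hF : ∀ j, p.IsStep Ω j (F j)) {ξ : Fin n → ℝ} (hξ : ξ ∈ diophantineSet p.α p.τ Ω) (j : ℕ) :
    ∀ x y : Ext n, x.1 ∈ p.D n j → ‖x.2 - fun i => (ξ i : ℂ)‖ < p.h j → y.1 ∈ p.D n j →
      ‖y.2 - fun i => (ξ i : ℂ)‖ < p.h j →
      weightedNorm (p.r 0) (p.σ 0) (p.h 0) (compSeq F j x - compSeq F j y) ≤
        (2 - (1 / 2) ^ j) * weightedNorm (p.r j) (p.σ j) (p.h j) (x - y) := by
  induction j with
  | zero =>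
    intro x y _ _ _ _
    norm_num [compSeq]
  | succ j ih =>
    intro x y hx hx' hy hy'
    obtain ⟨h1, h1'⟩ := T.mem_ball_of_near_id (hF j) hξ hx hx'
    obtain ⟨h2, h2'⟩ := T.mem_ball_of_near_id (hF j) hξ hy hy'
    have h3 : ((1 : ℝ) / 2) ^ j ≤ 1 := pow_le_one₀ (by norm_num) (by norm_num)
    have h4 : (0 : ℝ) < (1 / 2) ^ j := by positivity
    have h5 := weightedNorm_nonneg (r := p.r j) (σ := p.σ j) (T.h_pos j) (x - y)
    have h6 := weightedNorm_anti (T.r_pos (j + 1)) (T.σ_pos (j + 1)) (T.h_pos (j + 1))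
      (show p.r (j + 1) ≤ p.r j by linarith [T.r_succ_le j, T.r_pos j])
      (show p.σ (j + 1) ≤ p.σ j by rw [Params.σ]; linarith [T.σ_pos j])
      (show p.h (j + 1) ≤ p.h j by linarith [T.h_succ_le j, T.h_pos j]) (x - y)
    calc weightedNorm (p.r 0) (p.σ 0) (p.h 0) (compSeq F (j + 1) x - compSeq F (j + 1) y)
        ≤ (2 - (1 / 2) ^ j) * weightedNorm (p.r j) (p.σ j) (p.h j) (F j x - F j y) :=
          ih _ _ h1 h1' h2 h2'
      _ ≤ (2 - (1 / 2) ^ j) * ((1 + (1 / 2) ^ j / 4) *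
          weightedNorm (p.r j) (p.σ j) (p.h j) (x - y)) :=
          mul_le_mul_of_nonneg_left ((hF j).lipschitz ξ hξ x y hx hx' hy hy') (by linarith)
      _ = ((2 - (1 / 2) ^ j) * (1 + (1 / 2) ^ j / 4)) *
          weightedNorm (p.r j) (p.σ j) (p.h j) (x - y) := by ring
      -- With `q = 2^{-j}`: `(2 - q)(1 + q/4) = 2 - q/2 - q²/4`.
      _ ≤ (2 - (1 / 2) ^ (j + 1)) * weightedNorm (p.r j) (p.σ j) (p.h j) (x - y) := by
          refine mul_le_mul_of_nonneg_right ?_ h5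
          rw [pow_succ]
          nlinarith
      _ ≤ _ := by
          refine mul_le_mul_of_nonneg_left h6 ?_
          rw [pow_succ]
          linarith

/-- The increment is `F^j` at the two points `F_j x` and `x`, so the Lipschitz constant 2 is applied
to the displacement bound. -/
theorem weightedNorm_compSeq_sub_le (T : p.IsTuned n) {F : ℕ → Ext n → Ext n}
    (hF : ∀ j, p.IsStep Ω j (F j)) (j : ℕ) {x : Ext n}
    (hx : x ∈ p.D n (j + 1) ×ˢ p.O Ω (j + 1)) :
    weightedNorm (p.r 0) (p.σ 0) (p.h 0) (compSeq F (j + 1) x - compSeq F j x) ≤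
      8 * n * homConst n p.τ * (p.ε j / (p.r j * p.h j)) := by
  obtain ⟨ξ, hξ, hd⟩ := id hx.2
  obtain ⟨h1, h1'⟩ := T.mem_ball_of_near_id (hF j) hξ hx.1 hd
  have hlt : p.h (j + 1) ≤ p.h j := by linarith [T.h_succ_le j, T.h_pos j]
  have h2 := T.lipschitz_compSeq hF hξ j (F j x) x h1 h1' (T.D_succ_subset j hx.1)
    (hd.trans_le hlt)
  have h3 := (hF j).near_id x hx
  have h4 : (0 : ℝ) < (1 / 2) ^ j := by positivity
  have h5 := weightedNorm_nonneg (r := p.r j) (σ := p.σ j) (T.h_pos j) (F j x - x)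
  refine h2.trans ?_
  nlinarith

/-- The sequences of transformations and Hamiltonians. -/
theorem exists_iteration (T : p.IsTuned n) {e : CVec n → ℂ} {P₀ : Ext n → ℂ}
    (hc : p.IsControlled Ω 0 e P₀) :
    ∃ (F : ℕ → Ext n → Ext n) (eN : ℕ → CVec n → ℂ) (P : ℕ → Ext n → ℂ),
      eN 0 = e ∧ P 0 = P₀ ∧ ∀ j, p.IsStep Ω j (F j) ∧ p.IsControlled Ω j (eN j) (P j) ∧
        ∀ x, normalForm e (compSeq F j x) + P₀ (compSeq F j x) =
          normalForm (eN j) x + P j x := by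
  have hstep : ∀ (j : ℕ) (e : CVec n → ℂ) (P : Ext n → ℂ), p.IsControlled Ω j e P →
      ∃ (F : Ext n → Ext n) (e' : CVec n → ℂ) (P' : Ext n → ℂ), p.IsStep Ω j F ∧
        p.IsControlled Ω (j + 1) e' P' ∧
        ∀ x, normalForm e (F x) + P (F x) = normalForm e' x + P' x :=
    fun j e P hc => T.exists_step hc
  -- The chosen data are total functions of `(j, e, P)`, so the sequences are defined by plain
  -- recursion and shown to be controlled afterwards. The conjugation identity holds at every `x`,
  -- hence iterates without domain conditions.
  choose! F e' P' h1 h2 h3 using hstep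
  let q : ℕ → (CVec n → ℂ) × (Ext n → ℂ) :=
    Nat.rec (e, P₀) fun j q => (e' j q.1 q.2, P' j q.1 q.2)
  have hq : ∀ j, p.IsControlled Ω j (q j).1 (q j).2 := fun j => by
    induction j with
    | zero => exact hc
    | succ j ih => exact h2 j _ _ ih
  refine ⟨fun j => F j (q j).1 (q j).2, fun j => (q j).1, fun j => (q j).2, rfl, rfl,
    fun j => ⟨h1 j _ _ (hq j), hq j, ?_⟩⟩
  induction j with
  | zero => exact fun x => rfl
  | succ j ih => exact fun x => (ih _).trans (h3 j _ _ (hq j) x)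

end IsTuned

end Params

end Iteration

end KAM

end

open KAM in
theorem mainTheorem5 (n : ℕ) (hn : 2 ≤ n) (τ : ℝ) (hτ : (n : ℝ) - 1 < τ) :
    -- all constants depend on `n` and `τ` only
    ∃ c c₀ x₀ e₀ C : ℝ, 1 ≤ c ∧ 0 < c₀ ∧ 0 < x₀ ∧ 0 < e₀ ∧ 1 ≤ C ∧
      -- admissible initial values exist
      (∀ s₀ : ℝ, 0 < s₀ → ∃ K₀ E₀ : ℝ, ∀ α r₀ : ℝ, 0 < α → 0 < r₀ →
        (Params.mk α τ c c₀ r₀ s₀ K₀ E₀).Admissible n x₀ e₀) ∧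
      ∀ p : Params, p.τ = τ → p.c = c → p.c₀ = c₀ → 0 < p.α → 0 < p.r₀ → 0 < p.s₀ →
        p.Admissible n x₀ e₀ →
        ∀ (Ω : Set (Fin n → ℝ)) (e : CVec n → ℂ) (P₀ : Ext n → ℂ),
          IsRealAnalyticFreq e (p.O Ω 0) →
          IsRealAnalytic P₀ (p.D n 0 ×ˢ p.O Ω 0) →
          (∀ x ∈ p.D n 0 ×ˢ p.O Ω 0, ‖P₀ x‖ ≤ p.ε 0) →
          ∃ (F : ℕ → Ext n → Ext n) (eN : ℕ → CVec n → ℂ) (P : ℕ → Ext n → ℂ),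
            eN 0 = e ∧ P 0 = P₀ ∧
            ∀ j : ℕ,
              InGroup (F j) (p.D n (j + 1)) (p.O Ω (j + 1)) (p.D n j) (p.O Ω j) ∧
              InGroup (compSeq F j) (p.D n j) (p.O Ω j) (p.D n 0) (p.O Ω 0) ∧
              IsRealAnalyticFreq (eN j) (p.O Ω j) ∧
              IsRealAnalytic (P j) (p.D n j ×ˢ p.O Ω j) ∧
              (∀ x ∈ p.D n j ×ˢ p.O Ω j,
                normalForm e (compSeq F j x) + P₀ (compSeq F j x) =
                  normalForm (eN j) x + P j x) ∧
              (∀ x ∈ p.D n j ×ˢ p.O Ω j, ‖P j x‖ ≤ p.ε j) ∧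
              (∀ x ∈ p.D n (j + 1) ×ˢ p.O Ω (j + 1),
                weightedNorm (p.r 0) (p.σ 0) (p.h 0) (compSeq F (j + 1) x - compSeq F j x) ≤
                  C * (p.ε j / (p.r j * p.h j))) := by
  have hn' : (2 : ℝ) ≤ n := by exact_mod_cast hn
  have hτ0 : 0 < τ := by linarith
  have hC := one_le_homConst n τ
  have hΓ : 1 ≤ growthConst n τ := by
    have h1 : (1 : ℝ) ≤ 2 ^ (τ + 1) := Real.one_le_rpow (by norm_num) (by linarith)
    have h2 : (1 : ℝ) ≤ 4 ^ n := one_le_pow₀ (by norm_num)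
    have h3 : 1 ≤ 24 * n * homConst n τ := by nlinarith
    exact one_le_mul_of_one_le_of_one_le (one_le_mul_of_one_le_of_one_le h3 h1) h2
  have hc₀ : 0 < 128 * n * homConst n τ := by positivity
  have he₀ : 0 < smallConst n τ := by
    unfold smallConst
    positivity
  -- `c` is the square of `growthConst` because it enters as `c^{κ-1} = √c`. The value `x₀ = 1`
  -- expresses the only use of largeness, `K σ ≥ 1`. The final constant is the Lipschitz constant 2
  -- times the displacement constant `4 * n * homConst n τ`.
  refine ⟨growthConst n τ ^ 2, 128 * n * homConst n τ, 1, smallConst n τ, 8 * n * homConst n τ,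
    one_le_pow₀ hΓ, hc₀, one_pos, he₀, by nlinarith,
    fun s₀ hs₀ => Params.exists_admissible hτ0 hs₀ hc₀ he₀, ?_⟩
  intro p hpτ hpc hpc₀ hα hr₀ hs₀ hadm Ω e P₀ he hP₀ hb
  subst hpτ
  have T : p.IsTuned n := ⟨hn, hτ, hpc, hpc₀, hα, hr₀, hs₀, hadm⟩
  obtain ⟨F, eN, P, h0, h0', h⟩ := T.exists_iteration ⟨he, hP₀, hb⟩
  have hF := fun j => (h j).1
  exact ⟨F, eN, P, h0, h0', fun j => ⟨(hF j).inGroup, T.inGroup_compSeq hF j, (h j).2.1.energy,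
    (h j).2.1.perturbation, fun x _ => (h j).2.2 x, (h j).2.1.bound,
    fun x hx => T.weightedNorm_compSeq_sub_le hF j hx⟩⟩
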